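/- Let $p$ be a prime, let $\mathbb{Z}_{(p)}\subset\mathbb{Q}_{(p)}$ denote the $p$-adic integers and the $p$-adic numbers, and let $A,B$ be $n\times n$ integer matrices (for example nonnegative ones) such that $A^n$ and $B^n$ have the same rank (this is automatic if $A$ and $B$ are nonsingular). The (unordered) dimension group of $A$ is $G(A)=\{g\in A^n\mathbb{Q}^n : A^kg\in\mathbb{Z}^n\text{ for some }k\ge 0\}$; it equals $\bigcup_k A^{-k}\mathbb{Z}^n$ when $\det A\ne0$. The groups $G(A)$ and $G(B)$ are *strongly locally isomorphic at $p$* if there is a $\mathbb{Z}_{(p)}$-isomorphism $G(A)\otimes\mathbb{Z}_{(p)}\to G(B)\otimes\mathbb{Z}_{(p)}$ that is induced by an integer matrix $J\in M_n(\mathbb{Z})$, i.e. that is $v\mapsto Jv$ when both sides are regarded as submodules of $\mathbb{Q}_{(p)}^n$. Let $E_{(p)}(A)\in M_n(\mathbb{Z}_{(p)})$ be the idempotent $\lim_m A^{e(m)}$, where $e(0)<e(1)<\cdots$ is a sequence such that $A^{e(m)}$ is idempotent modulo $p^m$ and the limit exists (such sequences exist, and the limit does not depend on the choice). The $p$-adic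 eventual row space $G_{(p)}(A)\subseteq\mathbb{Z}_{(p)}^n$ is the $\mathbb{Z}_{(p)}$-span of the rows of $E_{(p)}(A)$. Then $G(A)$ and $G(B)$ are strongly locally isomorphic at $p$ if and only if the following condition holds: $(*)$ $G_{(p)}(A)$ and $G_{(p)}(B)$ have the same rank $n_p$, and for some $n_p\times n$ matrices $M_A,M_B$ over $\mathbb{Z}_{(p)}$ whose rows form $\mathbb{Z}_{(p)}$-bases of $G_{(p)}(A)$ and $G_{(p)}(B)$, there are $C\in\mathrm{GL}(n,\mathbb{Q})$ and $D\in\mathrm{GL}(n_p,\mathbb{Z}_{(p)})$ with $M_AC=DM_B$ (an equation over $\mathbb{Q}_{(p)}$). Moreover, whenever $M_A,M_B$ are any two matrices of basis rows with the same number $n_p$ of rows, strong local isomorphism at $p$ is equivalent to the existence of such $C,D$ for these $M_A,M_B$. Finally, condition $(*)$ is decidable: there is one algorithm (a total computable function) which, given any two integer matrices $A,B$ of the same size $n\times n$ (with no assumption on ranks) and any prime $p$, decides whether $(*)$ holds. -/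

import Mathlib

open Filter Topology
open scoped TensorProduct

namespace DimGroup

variable {n : ℕ}

/-- The integer matrix `A`, regarded as a matrix over `ℚ`. -/
def ratMatrix (A : Matrix (Fin n) (Fin n) ℤ) : Matrix (Fin n) (Fin n) ℚ :=
  A.map (Int.cast : ℤ → ℚ)

/-- The (unordered) dimension group `G(A)` of an `n × n` integer matrix `A`, acting on columns:
all `g` in the eventual range `𝒲(A) = Aⁿ ℚⁿ` such that `Aᵏ g` is an integer vector for some `k`.
It is the direct limit of `ℤⁿ → ℤⁿ → ⋯` along `A`; when `det A ≠ 0` it is `⋃ₖ A⁻ᵏ ℤⁿ`. -/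
def dimensionGroup (A : Matrix (Fin n) (Fin n) ℤ) : Submodule ℤ (Fin n → ℚ) where
  carrier := {g | (∃ x : Fin n → ℚ, g = (ratMatrix A ^ n).mulVec x) ∧
    ∃ (k : ℕ) (m : Fin n → ℤ), (ratMatrix A ^ k).mulVec g = fun i => (m i : ℚ)}
  zero_mem' := ⟨⟨0, by simp⟩, 0, 0, by ext i; simp⟩
  add_mem' := by
    have lift : ∀ (k l : ℕ) (g : Fin n → ℚ) (m : Fin n → ℤ),
        (ratMatrix A ^ k).mulVec g = (fun i => (m i : ℚ)) →
        (ratMatrix A ^ (l + k)).mulVec g = fun i => (((A ^ l).mulVec m i : ℤ) : ℚ) := by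
      intro k l g m h
      rw [pow_add, ← Matrix.mulVec_mulVec, h]
      have : ratMatrix A ^ l = (A ^ l).map (Int.cast : ℤ → ℚ) := by
        simpa [ratMatrix] using (Matrix.map_pow A (Int.castRingHom ℚ) l).symm
      rw [this]
      ext i
      simp [Matrix.mulVec, dotProduct]
    rintro g h ⟨⟨x, hx⟩, k, m, hk⟩ ⟨⟨y, hy⟩, l, q, hl⟩
    refine ⟨⟨x + y, by rw [Matrix.mulVec_add, hx, hy]⟩, l + k,
      (A ^ l).mulVec m + (A ^ k).mulVec q, ?_⟩
    rw [Matrix.mulVec_add, lift k l g m hk, add_comm l k, lift l k h q hl]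
    ext i
    simp
  smul_mem' := by
    rintro c g ⟨⟨x, hx⟩, k, m, hk⟩
    refine ⟨⟨c • x, by rw [Matrix.mulVec_smul, hx]⟩, k, c • m, ?_⟩
    rw [Matrix.mulVec_smul, hk]
    ext i
    simp

section padic

variable (p : ℕ) [Fact p.Prime]

/-- The inclusion `G(A) → ℚⁿ → ℚ_pⁿ`. -/
noncomputable def dimensionGroupToPadic (A : Matrix (Fin n) (Fin n) ℤ) :
    dimensionGroup A →ₗ[ℤ] (Fin n → ℚ_[p]) where
  toFun g i := ((g : Fin n → ℚ) i : ℚ_[p])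
  map_add' g h := by ext i; simp
  map_smul' c g := by ext i; simp

/-- The canonical map `ℤ_p ⊗ G(A) → ℚ_pⁿ`, `z ⊗ g ↦ z g` (an injection, since `ℤ_p` and `ℚ_p` are
torsion-free), by which matrices act on `ℤ_p ⊗ G(A)`. -/
noncomputable def tensorToPadic (A : Matrix (Fin n) (Fin n) ℤ) :
    ℤ_[p] ⊗[ℤ] dimensionGroup A →ₗ[ℤ_[p]] (Fin n → ℚ_[p]) :=
  (dimensionGroupToPadic p A).liftBaseChange ℤ_[p]

/-- The dimension groups of `A` and `B` are strongly locally isomorphic at `p`: some isomorphism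
`ℤ_p ⊗ G(A) ≃ ℤ_p ⊗ G(B)` is given by multiplication of column vectors by an integer matrix. -/
def StronglyLocallyIsomorphic (A B : Matrix (Fin n) (Fin n) ℤ) : Prop :=
  ∃ (J : Matrix (Fin n) (Fin n) ℤ)
    (e : (ℤ_[p] ⊗[ℤ] dimensionGroup A) ≃ₗ[ℤ_[p]] (ℤ_[p] ⊗[ℤ] dimensionGroup B)),
    ∀ x, tensorToPadic p B (e x) =
      (J.map (Int.cast : ℤ → ℚ_[p])).mulVec (tensorToPadic p A x)

/-- `E` is a `p`-adic limit of powers `A^{e(m)}` that are idempotent modulo `pᵐ`, where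
`e(0) < e(1) < ⋯`. -/
def IsEventualIdempotent (A : Matrix (Fin n) (Fin n) ℤ) (E : Matrix (Fin n) (Fin n) ℤ_[p]) :
    Prop :=
  ∃ e : ℕ → ℕ, StrictMono e ∧
    (∀ m i j, (p : ℤ) ^ m ∣ (A ^ e m * A ^ e m - A ^ e m) i j) ∧
    Tendsto (fun m => (A ^ e m).map (Int.cast : ℤ → ℤ_[p])) atTop (𝓝 E)

/-- In a finite monoid, some power of `a` with arbitrarily large exponent is idempotent. -/
theorem exists_large_idempotent_pow {M : Type*} [Monoid M] [Finite M] (a : M) (N : ℕ) :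
    ∃ k, N ≤ k ∧ IsIdempotentElem (a ^ k) := by
  obtain ⟨i, j, hij, h⟩ := Finite.exists_ne_map_eq_of_infinite (fun k : ℕ => a ^ k)
  wlog hlt : i < j generalizing i j
  · exact this j i hij.symm h.symm (by omega)
  obtain ⟨d, rfl⟩ := Nat.exists_eq_add_of_lt hlt
  have period : ∀ t s, a ^ (i + s + t * (d + 1)) = a ^ (i + s) := by
    intro t
    induction t with
    | zero => simp
    | succ t ih =>
      intro s
      have h' : a ^ i = a ^ (i + d + 1) := h
      have e1 : i + s + (t + 1) * (d + 1) = (i + (s + (d + 1))) + t * (d + 1) := by ring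
      rw [e1, ih, show i + (s + (d + 1)) = (i + d + 1) + s by ring, pow_add, ← h', ← pow_add]
  refine ⟨(i + N) * (d + 1), by nlinarith, ?_⟩
  unfold IsIdempotentElem
  have hs : i + ((i + N) * (d + 1) - i) = (i + N) * (d + 1) :=
    Nat.add_sub_cancel' (by nlinarith)
  have := period (i + N) ((i + N) * (d + 1) - i)
  rw [hs] at this
  rw [← pow_add, this]

/-- Two idempotent powers of the same element, with positive exponents, are equal. -/
theorem idempotent_pow_unique {M : Type*} [Monoid M] {a : M} {s t : ℕ} (hs : s ≠ 0) (ht : t ≠ 0)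
    (h₁ : IsIdempotentElem (a ^ s)) (h₂ : IsIdempotentElem (a ^ t)) : a ^ s = a ^ t := by
  rw [← h₁.pow_eq ht, ← h₂.pow_eq hs, ← pow_mul, ← pow_mul, mul_comm]

theorem dvd_sub_iff_map_eq (q : ℕ) (X Y : Matrix (Fin n) (Fin n) ℤ) :
    (∀ i j, (q : ℤ) ∣ (X - Y) i j) ↔
      (Int.castRingHom (ZMod q)).mapMatrix X = (Int.castRingHom (ZMod q)).mapMatrix Y := by
  rw [← Matrix.ext_iff]
  refine forall₂_congr fun i j => ?_
  rw [← ZMod.intCast_zmod_eq_zero_iff_dvd]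
  simp [sub_eq_zero]

/-- Every integer matrix has exactly one eventual idempotent. -/
theorem existsUnique_eventualIdempotent (A : Matrix (Fin n) (Fin n) ℤ) :
    ∃! E, IsEventualIdempotent p A E := by
  have key : ∀ (m k : ℕ), (∀ i j, (p : ℤ) ^ m ∣ (A ^ k * A ^ k - A ^ k) i j) ↔
      IsIdempotentElem ((Int.castRingHom (ZMod (p ^ m))).mapMatrix A ^ k) := by
    intro m k
    have := dvd_sub_iff_map_eq (p ^ m) (A ^ k * A ^ k) (A ^ k)
    rw [map_mul, map_pow] at this
    exact_mod_cast this
  apply existsUnique_of_exists_of_unique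
  · obtain ⟨e, he, hidem⟩ := extraction_forall_of_frequently
      (P := fun m k => ∀ i j, (p : ℤ) ^ m ∣ (A ^ k * A ^ k - A ^ k) i j) (fun m => by
        rw [frequently_atTop]
        intro N
        have : NeZero (p ^ m) := ⟨pow_ne_zero _ (Fact.out : p.Prime).ne_zero⟩
        have : Finite (Matrix (Fin n) (Fin n) (ZMod (p ^ m))) :=
          inferInstanceAs (Finite (Fin n → Fin n → ZMod (p ^ m)))
        obtain ⟨k, hk, hi⟩ := exists_large_idempotent_pow
          ((Int.castRingHom (ZMod (p ^ m))).mapMatrix A) N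
        exact ⟨k, hk, (key m k).2 hi⟩)
    obtain ⟨E, φ, hφ, hlim⟩ := CompactSpace.tendsto_subseq
      (X := Fin n → Fin n → ℤ_[p]) (fun m => (A ^ e m).map (Int.cast : ℤ → ℤ_[p]))
    exact ⟨E, e ∘ φ, he.comp hφ, fun m i j =>
      (pow_dvd_pow _ (hφ.id_le m)).trans (hidem (φ m) i j), hlim⟩
  · rintro E E' ⟨e, he, hi, hl⟩ ⟨e', he', hi', hl'⟩
    ext1 i j
    have hl₁ := (tendsto_pi_nhds.1 ((tendsto_pi_nhds.1 hl) i)) j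
    have hl₂ := (tendsto_pi_nhds.1 ((tendsto_pi_nhds.1 hl') i)) j
    have hz : Tendsto (fun m => (A ^ e m).map (Int.cast : ℤ → ℤ_[p]) i j -
        (A ^ e' m).map (Int.cast : ℤ → ℤ_[p]) i j) atTop (𝓝 0) := by
      have hp1 : (1 : ℝ) < p := by exact_mod_cast (Fact.out : p.Prime).one_lt
      refine squeeze_zero_norm' (a := fun m : ℕ => ((p : ℝ)⁻¹) ^ m) ?_
        (tendsto_pow_atTop_nhds_zero_of_lt_one (by positivity) (inv_lt_one_of_one_lt₀ hp1))
      filter_upwards [eventually_ge_atTop 1] with m hm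
      have h1 : e m ≠ 0 := by have : m ≤ e m := he.id_le m; omega
      have h2 : e' m ≠ 0 := by have : m ≤ e' m := he'.id_le m; omega
      have := idempotent_pow_unique h1 h2 ((key m _).1 (hi m)) ((key m _).1 (hi' m))
      rw [← map_pow, ← map_pow] at this
      have hd := (dvd_sub_iff_map_eq (p ^ m) _ _).2 this i j
      push_cast at hd
      have := (PadicInt.norm_int_le_pow_iff_dvd (p := p)).2 (by exact_mod_cast hd)
      simpa using this
    exact sub_eq_zero.1 (tendsto_nhds_unique (hl₁.sub hl₂) hz)

/-- The idempotent `E_(p)(A) ∈ M_n(ℤ_p)`. -/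
noncomputable def eventualIdempotent (A : Matrix (Fin n) (Fin n) ℤ) :
    Matrix (Fin n) (Fin n) ℤ_[p] :=
  (existsUnique_eventualIdempotent p A).choose

/-- The `p`-adic eventual row space `G_(p)(A)`: all `ℤ_p`-linear combinations of the rows of
`E_(p)(A)`. -/
noncomputable def eventualRowSpace (A : Matrix (Fin n) (Fin n) ℤ) :
    Submodule ℤ_[p] (Fin n → ℤ_[p]) :=
  Submodule.span ℤ_[p] (Set.range (eventualIdempotent p A).row)

variable {p}

/-- The rows of `M` form a `ℤ_p`-basis of `S`. -/
def IsRowBasis {r : ℕ} (M : Matrix (Fin r) (Fin n) ℤ_[p])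
    (S : Submodule ℤ_[p] (Fin n → ℤ_[p])) : Prop :=
  LinearIndependent ℤ_[p] M.row ∧ Submodule.span ℤ_[p] (Set.range M.row) = S

/-- `M C = D M'` for some `C ∈ GL(n, ℚ)` and `D ∈ GL(r, ℤ_p)`, as an equation over `ℚ_p`. -/
def Intertwined {r : ℕ} (M M' : Matrix (Fin r) (Fin n) ℤ_[p]) : Prop :=
  ∃ (C : GL (Fin n) ℚ) (D : GL (Fin r) ℤ_[p]),
    M.map ((↑) : ℤ_[p] → ℚ_[p]) * (C : Matrix (Fin n) (Fin n) ℚ).map ((↑) : ℚ → ℚ_[p]) =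
      (D : Matrix (Fin r) (Fin r) ℤ_[p]).map ((↑) : ℤ_[p] → ℚ_[p]) *
        M'.map ((↑) : ℤ_[p] → ℚ_[p])

variable (p)

/-- The `p`-adic eventual row spaces of `A` and `B` have the same rank `r`, and some matrices
of basis rows of them are intertwined. -/
def RowSpaceCondition (A B : Matrix (Fin n) (Fin n) ℤ) : Prop :=
  ∃ (r : ℕ) (M M' : Matrix (Fin r) (Fin n) ℤ_[p]),
    IsRowBasis M (eventualRowSpace p A) ∧ IsRowBasis M' (eventualRowSpace p B) ∧
      Intertwined M M'

end padic

/-- An integer matrix as the list of its rows, the form in which an algorithm receives it. -/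
def rows (A : Matrix (Fin n) (Fin n) ℤ) : List (List ℤ) :=
  List.ofFn fun i => List.ofFn fun j => A i j

end DimGroup

/-! Write the eventual idempotent of `A` as `E = L M` with `M L = 1`, the rows of `M` being a basis
of the eventual row space. Since `E` is congruent modulo `p` to a positive power of `A`, one has `M
A = A' M` with `A'` invertible over `ℤ_p` (`isUnit_of_factorization`). Over `ℚ`, a Drazin inverse
`S` gives the projection `A S` onto the eventual range. The key fact is
`IsLocalFrame.mem_range_iff`: inside `ℚ_pⁿ`, the module `ℤ_p ⊗ G(A)` consists of the vectors `v` of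
the eventual range for which `M v` is integral. It is thus an extension of `ℤ_pʳ` by its divisible
part, the kernel of `M`.

A strong local isomorphism `J` respects divisible parts, hence induces an invertible `D` on the
quotients. As `J` is rational, it follows that `D M` and `M'` map `ℚⁿ` onto the same `ℚ`-subspace of
`ℚ_pʳ`; two linear maps on `ℚⁿ` with the same range differ by an automorphism of `ℚⁿ`, which is `C`.
Conversely, equality of ranges and of ranks yields a rational isomorphism `Φ` of the eventual ranges
compatible with the coordinates. For suitable exponents and some `N` prime to `p`, the matrix `N Bᵉ
Φ Aᶠ` is integral (`exists_integral_sandwich`), and it still induces an isomorphism, because `A` and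
`B` act invertibly on the eventual ranges over `ℚ` and on the coordinates over `ℤ_p`.

For decidability, `C` may be taken integral; the condition then reads `det C ≠ 0`, `E_A C (1 - E_B)
= 0`, and invertibility of `Aˢ C Bˢ` modulo `p` between the images of two idempotents
(`rowSpaceCondition_iff_exists_integer`). The linear equation says that `C` is killed by a `p`-adic
idempotent `Φ` which is congruent modulo `p` to an integer operator `W` and commutes with it. The
integral kernel of `Φ` is `W`-invariant and `W` is divisible by `p` on it; conversely, if `W K = K W
K` is divisible by `p`, then `Φ K = 0`. Moreover this kernel is the kernel of `g(W)`, where `g` is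
the characteristic polynomial of the restriction of `W`; the roots of `g` are eigenvalues of `W`, so
the entries of `g(W)` are bounded explicitly (`exists_bounded_annihilator`). Finitely many lattices
therefore have to be tried, each tested by a sound criterion. Within one lattice only small
coordinates matter, since `det` has degree at most `n` along any line (`exists_small_det_ne_zero`).
-/

namespace DimGroup

/-! ### Computability of integer arithmetic, bounded quantifiers and searches -/

section Computability

variable {σ τ : Type*} [Primcodable σ] [Primcodable τ]

theorem computable_fst_of {β γ : Type*} [Primcodable β] [Primcodable γ] {f : σ → β × γ}
    (hf : Computable f) : Computable fun s => (f s).1 := Computable.fst.comp hf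

theorem computable_snd_of {β γ : Type*} [Primcodable β] [Primcodable γ] {f : σ → β × γ}
    (hf : Computable f) : Computable fun s => (f s).2 := Computable.snd.comp hf

theorem computable_nat_add {f g : σ → ℕ} (hf : Computable f) (hg : Computable g) :
    Computable fun s => f s + g s := Primrec.nat_add.to_comp.comp hf hg

theorem computable_nat_mul {f g : σ → ℕ} (hf : Computable f) (hg : Computable g) :
    Computable fun s => f s * g s := Primrec.nat_mul.to_comp.comp hf hg

theorem computable_nat_div {f g : σ → ℕ} (hf : Computable f) (hg : Computable g) :
    Computable fun s => f s / g s := Primrec.nat_div.to_comp.comp hf hg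

theorem computable_nat_mod {f g : σ → ℕ} (hf : Computable f) (hg : Computable g) :
    Computable fun s => f s % g s := Primrec.nat_mod.to_comp.comp hf hg

theorem computable_nat_pow {f g : σ → ℕ} (hf : Computable f) (hg : Computable g) :
    Computable fun s => f s ^ g s :=
  ((Primrec₂.unpaired'.1 Nat.Primrec.pow).to_comp.comp hf hg)

theorem encode_int_ofNat (n : ℕ) : Encodable.encode (n : ℤ) = 2 * n := rfl

theorem encode_int_negSucc (n : ℕ) : Encodable.encode (Int.negSucc n) = 2 * n + 1 := rfl

/-- Nonnegative integers have the even codes and negative ones the odd codes, so parity of the code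
gives the sign and halving gives the size. -/
theorem primrec_toNat : Primrec Int.toNat := by
  have : Primrec fun z : ℤ => if Encodable.encode z % 2 = 0 then Encodable.encode z / 2 else 0 :=
    Primrec.ite (Primrec.eq.comp (Primrec.nat_mod.comp Primrec.encode (Primrec.const 2))
      (Primrec.const 0)) (Primrec.nat_div.comp Primrec.encode (Primrec.const 2)) (Primrec.const 0)
  refine this.of_eq fun z => ?_
  cases z with
  | ofNat n =>
    have := encode_int_ofNat n
    simp only [Int.ofNat_eq_natCast, this]
    simp
  | negSucc n =>
    rw [encode_int_negSucc, if_neg (by omega)]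
    rfl

theorem primrec_neg_toNat : Primrec fun z : ℤ => (-z).toNat := by
  have : Primrec fun z : ℤ =>
      if Encodable.encode z % 2 = 0 then 0 else Encodable.encode z / 2 + 1 :=
    Primrec.ite (Primrec.eq.comp (Primrec.nat_mod.comp Primrec.encode (Primrec.const 2))
      (Primrec.const 0)) (Primrec.const 0)
      (Primrec.succ.comp (Primrec.nat_div.comp Primrec.encode (Primrec.const 2)))
  refine this.of_eq fun z => ?_
  cases z with
  | ofNat n =>
    have := encode_int_ofNat n
    simp only [Int.ofNat_eq_natCast, this]
    simp
  | negSucc n =>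
    rw [encode_int_negSucc, if_neg (by omega), Int.neg_negSucc]
    simp only [Int.toNat_natCast]
    omega

/-- All integer arithmetic is reduced to this function: an integer is the difference of its positive
and negative parts, and sums and products of such differences are again differences of natural
numbers. -/
theorem primrec_natCast_sub : Primrec₂ fun a b : ℕ => (a : ℤ) - (b : ℤ) := by
  have : Primrec fun q : ℕ × ℕ => Denumerable.ofNat ℤ
      (if q.2 ≤ q.1 then 2 * (q.1 - q.2) else 2 * (q.2 - q.1 - 1) + 1) := by
    refine (Primrec.ofNat ℤ).comp (Primrec.ite (Primrec.nat_le.comp Primrec.snd Primrec.fst)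
      (Primrec.nat_double.comp (Primrec.nat_sub.comp Primrec.fst Primrec.snd)) ?_)
    exact Primrec.nat_double_succ.comp (Primrec.nat_sub.comp
      (Primrec.nat_sub.comp Primrec.snd Primrec.fst) (Primrec.const 1))
  refine this.of_eq fun q => ?_
  apply Encodable.encode_injective
  rw [Denumerable.encode_ofNat]
  split_ifs with h
  · rw [← encode_int_ofNat]
    congr 1
    show ((q.1 - q.2 : ℕ) : ℤ) = (q.1 : ℤ) - q.2
    omega
  · rw [← encode_int_negSucc]
    congr 1
    show Int.negSucc (q.2 - q.1 - 1) = (q.1 : ℤ) - q.2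
    omega

theorem computable_toNat {f : σ → ℤ} (hf : Computable f) : Computable fun s => (f s).toNat :=
  primrec_toNat.to_comp.comp hf

theorem computable_neg_toNat {f : σ → ℤ} (hf : Computable f) :
    Computable fun s => (-f s).toNat :=
  primrec_neg_toNat.to_comp.comp hf

theorem computable_natAbs {f : σ → ℤ} (hf : Computable f) : Computable fun s => (f s).natAbs :=
  (computable_nat_add (computable_toNat hf) (computable_neg_toNat hf)).of_eq fun s => by omega

theorem computable_natCast {f : σ → ℕ} (hf : Computable f) : Computable fun s => (f s : ℤ) :=
  (primrec_natCast_sub.to_comp.comp hf (Computable.const 0)).of_eq fun s => by simp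

theorem computable_int_add {f g : σ → ℤ} (hf : Computable f) (hg : Computable g) :
    Computable fun s => f s + g s :=
  (primrec_natCast_sub.to_comp.comp
    (computable_nat_add (computable_toNat hf) (computable_toNat hg))
    (computable_nat_add (computable_neg_toNat hf) (computable_neg_toNat hg))).of_eq
    fun s => by push_cast; omega

theorem computable_int_sub {f g : σ → ℤ} (hf : Computable f) (hg : Computable g) :
    Computable fun s => f s - g s :=
  (primrec_natCast_sub.to_comp.comp
    (computable_nat_add (computable_toNat hf) (computable_neg_toNat hg))
    (computable_nat_add (computable_neg_toNat hf) (computable_toNat hg))).of_eq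
    fun s => by push_cast; omega

theorem computable_int_mul {f g : σ → ℤ} (hf : Computable f) (hg : Computable g) :
    Computable fun s => f s * g s := by
  have h₁ := computable_nat_add (computable_nat_mul (computable_toNat hf) (computable_toNat hg))
    (computable_nat_mul (computable_neg_toNat hf) (computable_neg_toNat hg))
  have h₂ := computable_nat_add
    (computable_nat_mul (computable_toNat hf) (computable_neg_toNat hg))
    (computable_nat_mul (computable_neg_toNat hf) (computable_toNat hg))
  refine (computable_int_sub (computable_natCast h₁) (computable_natCast h₂)).of_eq fun s => ?_
  have e : ∀ z : ℤ, z = (z.toNat : ℤ) - ((-z).toNat : ℤ) := fun z => by omega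
  conv_rhs => rw [e (f s), e (g s)]
  push_cast
  ring

theorem computable_sum {b : σ → ℕ} {f : σ → ℕ → ℤ} (hb : Computable b)
    (hf : Computable fun q : σ × ℕ => f q.1 q.2) :
    Computable fun s => ∑ i ∈ Finset.range (b s), f s i := by
  have hf' : Computable fun q : σ × ℕ × ℤ => f q.1 q.2.1 :=
    Computable.comp (f := fun q : σ × ℕ => f q.1 q.2) (g := fun q : σ × ℕ × ℤ => (q.1, q.2.1)) hf
      (Computable.pair Computable.fst (computable_fst_of Computable.snd))
  have hr : Computable fun q : σ × ℕ × ℤ => q.2.2 := Computable.snd.comp Computable.snd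
  have h : Computable₂ fun (s : σ) (q : ℕ × ℤ) => q.2 + f s q.1 := computable_int_add hr hf'
  have h' : Computable fun s => (Nat.rec 0 (fun i r => r + f s i) (b s) : ℤ) :=
    Computable.nat_rec hb (Computable.const (0 : ℤ)) h
  refine h'.of_eq fun s => ?_
  induction b s with
  | zero => simp
  | succ n ih => rw [Finset.sum_range_succ, ← ih]

/-! ### Computable predicates -/

theorem computablePred_of {P : σ → Prop} {f : σ → Bool} (hf : Computable f)
    (h : ∀ s, f s = true ↔ P s) : ComputablePred P :=
  ComputablePred.computable_iff.2 ⟨f, hf, funext fun s => propext (h s).symm⟩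

theorem exists_of_computablePred {P : σ → Prop} (h : ComputablePred P) :
    ∃ f : σ → Bool, Computable f ∧ ∀ s, f s = true ↔ P s := by
  obtain ⟨f, hf, rfl⟩ := ComputablePred.computable_iff.1 h
  exact ⟨f, hf, fun s => Iff.rfl⟩

theorem computablePred_comp {P : τ → Prop} (h : ComputablePred P) {g : σ → τ}
    (hg : Computable g) : ComputablePred fun s => P (g s) := by
  obtain ⟨f, hf, hP⟩ := exists_of_computablePred h
  exact computablePred_of (hf.comp hg) fun s => hP (g s)

theorem computablePred_and {P Q : σ → Prop} (hP : ComputablePred P) (hQ : ComputablePred Q) :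
    ComputablePred fun s => P s ∧ Q s := by
  obtain ⟨f, hf, hP⟩ := exists_of_computablePred hP
  obtain ⟨g, hg, hQ⟩ := exists_of_computablePred hQ
  exact computablePred_of (Primrec.and.to_comp.comp hf hg) fun s => by simp [hP, hQ]

theorem computablePred_or {P Q : σ → Prop} (hP : ComputablePred P) (hQ : ComputablePred Q) :
    ComputablePred fun s => P s ∨ Q s := by
  obtain ⟨f, hf, hP⟩ := exists_of_computablePred hP
  obtain ⟨g, hg, hQ⟩ := exists_of_computablePred hQ
  exact computablePred_of (Primrec.or.to_comp.comp hf hg) fun s => by simp [hP, hQ]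

theorem computablePred_nat_eq {f g : σ → ℕ} (hf : Computable f) (hg : Computable g) :
    ComputablePred fun s => f s = g s :=
  computablePred_of (Primrec.beq.to_comp.comp hf hg) fun s => by simp

theorem computablePred_int_eq {f g : σ → ℤ} (hf : Computable f) (hg : Computable g) :
    ComputablePred fun s => f s = g s :=
  computablePred_of (Primrec.beq.to_comp.comp hf hg) fun s => by simp

theorem computablePred_ne {f g : σ → ℤ} (hf : Computable f) (hg : Computable g) :
    ComputablePred fun s => f s ≠ g s :=
  (computablePred_int_eq hf hg).not

theorem computablePred_dvd {f : σ → ℕ} {g : σ → ℤ} (hf : Computable f) (hg : Computable g) :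
    ComputablePred fun s => (f s : ℤ) ∣ g s :=
  -- The divisor zero needs no separate case, since `x % 0 = x`.
  (computablePred_nat_eq (computable_nat_mod (computable_natAbs hg) hf)
    (Computable.const 0)).of_eq fun s => by
      rw [← Nat.dvd_iff_mod_eq_zero, Int.natCast_dvd]

theorem computablePred_exists_lt {b : σ → ℕ} {P : σ → ℕ → Prop} (hb : Computable b)
    (hP : ComputablePred fun q : σ × ℕ => P q.1 q.2) :
    ComputablePred fun s => ∃ i < b s, P s i := by
  obtain ⟨f, hf, hP⟩ := exists_of_computablePred hP
  have h : Computable₂ fun (s : σ) (q : ℕ × Bool) => q.2 || f (s, q.1) :=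
    Primrec.or.to_comp.comp (Computable.snd.comp Computable.snd)
      (hf.comp (Computable.pair Computable.fst (Computable.fst.comp Computable.snd)))
  refine computablePred_of (Computable.nat_rec hb (Computable.const false) h) fun s => ?_
  induction b s with
  | zero => simp
  | succ n ih =>
    simp only [Bool.or_eq_true, ih, hP (s, n)]
    constructor
    · rintro (⟨i, hi, h⟩ | h)
      exacts [⟨i, by omega, h⟩, ⟨n, by omega, h⟩]
    · rintro ⟨i, hi, h⟩
      rcases Nat.lt_succ_iff_lt_or_eq.1 hi with h' | rfl
      exacts [Or.inl ⟨i, h', h⟩, Or.inr h]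

theorem computablePred_forall_lt {b : σ → ℕ} {P : σ → ℕ → Prop} (hb : Computable b)
    (hP : ComputablePred fun q : σ × ℕ => P q.1 q.2) :
    ComputablePred fun s => ∀ i < b s, P s i :=
  (computablePred_exists_lt (P := fun s i => ¬ P s i) hb hP.not).not.of_eq fun s => by
    simp only [not_exists, not_and, not_not]

/-- Unbounded search: a computable relation that is total contains a computable function. -/
theorem exists_computable_choice {R : σ → τ → Prop}
    (hR : ComputablePred fun q : σ × τ => R q.1 q.2) (total : ∀ s, ∃ t, R s t) :
    ∃ f : σ → τ, Computable f ∧ ∀ s, R s (f s) := by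
  obtain ⟨g, hg, hR⟩ := exists_of_computablePred hR
  let h : σ → ℕ → Option τ := fun s k =>
    (Encodable.decode (α := τ) k).bind fun t => cond (g (s, t)) (some t) none
  have hh : Computable₂ h :=
    Computable.option_bind (Computable.decode.comp Computable.snd)
      (Computable.cond (hg.comp (Computable.pair (Computable.fst.comp Computable.fst)
        Computable.snd)) (Computable.option_some.comp Computable.snd) (Computable.const none))
  have dom : ∀ s, (Nat.rfindOpt (h s)).Dom := fun s => by
    obtain ⟨t, ht⟩ := total s
    refine Nat.rfindOpt_dom.2 ⟨Encodable.encode t, t, ?_⟩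
    simp [h, (hR (s, t)).2 ht]
  refine ⟨fun s => (Nat.rfindOpt (h s)).get (dom s),
    (Partrec.rfindOpt hh).of_eq_tot fun s => Part.get_mem _, fun s => ?_⟩
  obtain ⟨k, hk⟩ := Nat.rfindOpt_spec (Part.get_mem (dom s))
  simp only [h, Option.mem_def, Option.bind_eq_some_iff] at hk
  obtain ⟨t, -, ht⟩ := hk
  cases hb : g (s, t)
  · simp [hb] at ht
  · simp only [hb, cond_true, Option.some.injEq] at ht
    have ht' : t = (Nat.rfindOpt (h s)).get (dom s) := ht
    have hRt : R s t := (hR (s, t)).1 hb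
    rw [ht'] at hRt
    exact hRt

/-- A predicate that is semi-decidable together with its complement is computable. -/
theorem computablePred_of_certificates {P : σ → Prop} {R R' : σ → τ → Prop}
    (hR : ComputablePred fun q : σ × τ => R q.1 q.2)
    (hR' : ComputablePred fun q : σ × τ => R' q.1 q.2)
    (pos : ∀ s t, R s t → P s) (neg : ∀ s t, R' s t → ¬ P s)
    (total : ∀ s, ∃ t, R s t ∨ R' s t) : ComputablePred P := by
  obtain ⟨f, hf, h⟩ := exists_computable_choice (R := fun s t => R s t ∨ R' s t)
    (computablePred_or hR hR') total
  refine (computablePred_comp hR (Computable.pair Computable.id hf)).of_eq fun s => ?_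
  exact ⟨pos s _, fun hP => (h s).resolve_right fun h' => neg s _ h' hP⟩

/-! ### Arrays -/

/-- The entry in row `i` and column `j` of a list of rows, `0` outside of the list. -/
def entry (l : List (List ℤ)) (i j : ℕ) : ℤ := (l.getD i []).getD j 0

theorem computable_entry {l : σ → List (List ℤ)} {i j : σ → ℕ} (hl : Computable l)
    (hi : Computable i) (hj : Computable j) : Computable fun s => entry (l s) (i s) (j s) :=
  (Primrec.list_getD 0).to_comp.comp ((Primrec.list_getD []).to_comp.comp hl hi) hj

theorem exists_entry_eq (m n : ℕ) (f : ℕ → ℕ → ℤ) :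
    ∃ l : List (List ℤ), ∀ i < m, ∀ j < n, entry l i j = f i j := by
  refine ⟨(List.range m).map fun i => (List.range n).map fun j => f i j, fun i hi j hj => ?_⟩
  simp [entry, List.getD_eq_getElem?_getD, hi, hj]

theorem entry_rows {n : ℕ} (A : Matrix (Fin n) (Fin n) ℤ) (i j : Fin n) :
    entry (rows A) i j = A i j := by
  simp [entry, rows, List.getD_eq_getElem?_getD]

/-- The digit of index `i` of `c` in base `b`. -/
def digit (b c i : ℕ) : ℕ := c / b ^ i % b

/-- Turns a quantifier over functions with bounded values into a bounded quantifier over one natural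
number. -/
theorem exists_digit_eq (b m : ℕ) (f : ℕ → ℕ) (hf : ∀ i < m, f i < b) :
    ∃ c < b ^ m, ∀ i < m, digit b c i = f i := by
  refine ⟨finFunctionFinEquiv fun i : Fin m => (⟨f i, hf i i.2⟩ : Fin b), Fin.is_lt _,
    fun i hi => ?_⟩
  have := finFunctionFinEquiv_symm_apply_val
    (finFunctionFinEquiv fun i : Fin m => (⟨f i, hf i i.2⟩ : Fin b)) ⟨i, hi⟩
  rw [Equiv.symm_apply_apply] at this
  exact this.symm

theorem computable_digit {b c i : σ → ℕ} (hb : Computable b) (hc : Computable c)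
    (hi : Computable i) : Computable fun s => digit (b s) (c s) (i s) :=
  computable_nat_mod (computable_nat_div hc (computable_nat_pow hb hi)) hb

end Computability

/-! ### The eventual idempotent and bases of its row space -/

section EventualIdempotent

variable {n : ℕ} (p : ℕ) [Fact p.Prime]

/-- An integer matrix, regarded as a matrix over `ℤ_p`. -/
noncomputable abbrev intToPadic {ι : Type*} [Fintype ι] [DecidableEq ι] :
    Matrix ι ι ℤ →+* Matrix ι ι ℤ_[p] :=
  (Int.castRingHom ℤ_[p]).mapMatrix

variable {p}

/-- Replaces passage to the limit: identities for the eventual idempotent are proved modulo every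
power of `p`. -/
theorem padicInt_eq_zero_of_forall_dvd {x : ℤ_[p]} (h : ∀ k : ℕ, (p : ℤ_[p]) ^ k ∣ x) : x = 0 := by
  by_contra hx
  have := (PadicInt.mem_span_pow_iff_le_valuation x hx (x.valuation + 1)).1
    (Ideal.mem_span_singleton.2 (h _))
  omega

theorem padicInt_funext_of_forall_dvd {ι : Type*} {v : ι → ℤ_[p]}
    (h : ∀ k : ℕ, ∃ w : ι → ℤ_[p], v = (p : ℤ_[p]) ^ k • w) : v = 0 := by
  funext i
  refine padicInt_eq_zero_of_forall_dvd fun k => ?_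
  obtain ⟨w, hw⟩ := h k
  exact ⟨w i, by rw [hw]; rfl⟩

theorem padicInt_matrix_eq_zero_of_forall_dvd {ι κ : Type*} {X : Matrix ι κ ℤ_[p]}
    (h : ∀ k : ℕ, ∃ Z : Matrix ι κ ℤ_[p], X = (p : ℤ_[p]) ^ k • Z) : X = 0 := by
  ext i j
  refine padicInt_eq_zero_of_forall_dvd fun k => ?_
  obtain ⟨w, hw⟩ := h k
  exact ⟨w i j, by rw [hw]; rfl⟩

/-- `ℤ_p` is local with residue field `ZMod p`, so whether a determinant is a unit depends only on
its residue. -/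
theorem isUnit_of_eq_add_smul {ι : Type*} [Fintype ι] [DecidableEq ι] {X U Y : Matrix ι ι ℤ_[p]}
    (hU : IsUnit U) (h : X = U + (p : ℤ_[p]) • Y) : IsUnit X := by
  have key : ∀ x : ℤ_[p], IsUnit x ↔ PadicInt.toZMod x ≠ 0 := fun x => by
    rw [Ne, ← RingHom.mem_ker, PadicInt.ker_toZMod, IsLocalRing.mem_maximalIdeal, mem_nonunits_iff,
      not_not]
  rw [Matrix.isUnit_iff_isUnit_det, key] at hU ⊢
  have : PadicInt.toZMod.mapMatrix X = PadicInt.toZMod.mapMatrix U := by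
    ext i j
    simp [h]
  rwa [RingHom.map_det, this, ← RingHom.map_det]

theorem exists_smul_of_forall_dvd {ι κ : Type*} {q : ℤ} {X : Matrix ι κ ℤ} (h : ∀ i j, q ∣ X i j) :
    ∃ Y : Matrix ι κ ℤ, X = q • Y := by
  choose Y hY using h
  exact ⟨Matrix.of Y, by ext i j; simpa using hY i j⟩

theorem intToPadic_smul {ι : Type*} [Fintype ι] [DecidableEq ι] (q : ℤ) (X : Matrix ι ι ℤ) :
    intToPadic p (q • X) = (q : ℤ_[p]) • intToPadic p X := by
  rw [map_zsmul, Int.cast_smul_eq_zsmul]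

/-- The algebraic form of convergence, through which the definition as a limit is used from here on.
-/
theorem exists_eventualIdempotent_eq (A : Matrix (Fin n) (Fin n) ℤ) (k N : ℕ) :
    ∃ e, N ≤ e ∧ (∀ i j, (p : ℤ) ^ k ∣ (A ^ e * A ^ e - A ^ e) i j) ∧
      ∃ Z, eventualIdempotent p A = intToPadic p (A ^ e) + (p : ℤ_[p]) ^ k • Z := by
  obtain ⟨e, he, hi, hl⟩ := (existsUnique_eventualIdempotent p A).choose_spec.1
  change Tendsto _ _ (𝓝 (eventualIdempotent p A)) at hl
  have hp : (0 : ℝ) < (p : ℝ) ^ (-k : ℤ) := by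
    have : (0 : ℝ) < p := by exact_mod_cast (Fact.out : p.Prime).pos
    positivity
  have ev : ∀ i j, ∀ᶠ m in atTop,
      (p : ℤ_[p]) ^ k ∣ eventualIdempotent p A i j - ((A ^ e m) i j : ℤ_[p]) := fun i j => by
    have := tendsto_pi_nhds.1 (tendsto_pi_nhds.1 hl i) j
    filter_upwards [Metric.tendsto_nhds.1 this _ hp] with m hm
    rw [← Ideal.mem_span_singleton, ← PadicInt.norm_le_pow_iff_mem_span_pow, norm_sub_rev]
    rw [dist_eq_norm] at hm
    exact hm.le
  -- Both `N ≤ e m` and idempotency modulo `pᵏ` follow from `max N k ≤ m ≤ e m`.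
  obtain ⟨m, hm, hd⟩ := ((eventually_ge_atTop (max N k)).and
    (eventually_all.2 fun i => eventually_all.2 fun j => ev i j)).exists
  have hm' : m ≤ e m := he.id_le m
  refine ⟨e m, by omega, fun i j => (pow_dvd_pow _ (by omega)).trans (hi m i j), ?_⟩
  choose Z hZ using hd
  refine ⟨Matrix.of Z, ?_⟩
  ext i j
  simp only [Matrix.add_apply, Matrix.smul_apply, Matrix.of_apply, smul_eq_mul, ← hZ]
  simp [-map_pow]

theorem intToPadic_commute_eventualIdempotent (A : Matrix (Fin n) (Fin n) ℤ) :
    intToPadic p A * eventualIdempotent p A = eventualIdempotent p A * intToPadic p A := by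
  rw [← sub_eq_zero]
  refine padicInt_matrix_eq_zero_of_forall_dvd fun k => ?_
  obtain ⟨e, -, -, Z, hZ⟩ := exists_eventualIdempotent_eq (p := p) A k 0
  refine ⟨intToPadic p A * Z - Z * intToPadic p A, ?_⟩
  rw [hZ, map_pow, mul_add, add_mul, ← pow_succ, ← pow_succ', smul_sub, Matrix.mul_smul,
    Matrix.smul_mul]
  abel

theorem eventualIdempotent_mul_self (A : Matrix (Fin n) (Fin n) ℤ) :
    eventualIdempotent p A * eventualIdempotent p A = eventualIdempotent p A := by
  rw [← sub_eq_zero]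
  refine padicInt_matrix_eq_zero_of_forall_dvd fun k => ?_
  obtain ⟨e, -, hi, Z, hZ⟩ := exists_eventualIdempotent_eq (p := p) A k 0
  obtain ⟨Y, hY⟩ := exists_smul_of_forall_dvd hi
  have hY' : intToPadic p (A ^ e) * intToPadic p (A ^ e) - intToPadic p (A ^ e) =
      (p : ℤ_[p]) ^ k • intToPadic p Y := by
    rw [← map_mul, ← map_sub, hY, intToPadic_smul]
    push_cast
    rfl
  generalize intToPadic p (A ^ e) = P at *
  refine ⟨intToPadic p Y + P * Z + Z * P + (p : ℤ_[p]) ^ k • (Z * Z) - Z, ?_⟩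
  rw [hZ, smul_sub, smul_add, smul_add, smul_add, ← hY']
  simp only [mul_add, add_mul, Matrix.mul_smul, Matrix.smul_mul]
  abel

/-- Modulo `p`, the eventual idempotent is every idempotent power of the matrix. -/
theorem eventualIdempotent_eq_pow_add {A : Matrix (Fin n) (Fin n) ℤ} {s : ℕ} (hs : s ≠ 0)
    (h : ∀ i j, (p : ℤ) ∣ (A ^ s * A ^ s - A ^ s) i j) :
    ∃ Z, eventualIdempotent p A = intToPadic p (A ^ s) + (p : ℤ_[p]) • Z := by
  obtain ⟨e, he, hi, Z, hZ⟩ := exists_eventualIdempotent_eq (p := p) A 1 1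
  rw [pow_one] at hi hZ
  rw [dvd_sub_iff_map_eq, map_mul, map_pow] at h hi
  have := idempotent_pow_unique (by omega) hs hi h
  rw [← map_pow, ← map_pow, ← dvd_sub_iff_map_eq] at this
  obtain ⟨Y, hY⟩ := exists_smul_of_forall_dvd this
  refine ⟨intToPadic p Y + Z, ?_⟩
  rw [hZ, ← sub_add_cancel (A ^ e) (A ^ s), hY, map_add, intToPadic_smul, smul_add,
    Int.cast_natCast]
  abel

/-! ### Bases of the eventual row space -/

theorem exists_isRowBasis (A : Matrix (Fin n) (Fin n) ℤ) :
    ∃ (r : ℕ) (M : Matrix (Fin r) (Fin n) ℤ_[p]), IsRowBasis M (eventualRowSpace p A) := by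
  obtain ⟨r, b⟩ := Submodule.basisOfPid (Pi.basisFun ℤ_[p] (Fin n)) (eventualRowSpace p A)
  refine ⟨r, Matrix.of fun i => (b i : Fin n → ℤ_[p]), ?_, ?_⟩
  · exact b.linearIndependent.map' (eventualRowSpace p A).subtype (Submodule.ker_subtype _)
  · have := congrArg (Submodule.map (eventualRowSpace p A).subtype) b.span_eq
    rw [Submodule.map_span, Submodule.map_top, Submodule.range_subtype, ← Set.range_comp] at this
    exact this

variable {r : ℕ} {A : Matrix (Fin n) (Fin n) ℤ} {M : Matrix (Fin r) (Fin n) ℤ_[p]}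
  {L : Matrix (Fin n) (Fin r) ℤ_[p]}

theorem exists_mul_eq_of_row_mem_span {m k : ℕ} {X : Matrix (Fin m) (Fin n) ℤ_[p]}
    {Y : Matrix (Fin k) (Fin n) ℤ_[p]}
    (h : ∀ i, X.row i ∈ Submodule.span ℤ_[p] (Set.range Y.row)) :
    ∃ Q : Matrix (Fin m) (Fin k) ℤ_[p], X = Q * Y := by
  have : ∀ i, ∃ c : Fin k → ℤ_[p], ∑ j, c j • Y.row j = X.row i := fun i =>
    (Submodule.mem_span_range_iff_exists_fun _).1 (h i)
  choose c hc using this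
  refine ⟨Matrix.of c, ?_⟩
  refine Matrix.ext fun i j => ?_
  have := congrFun (hc i) j
  simp only [Finset.sum_apply, Pi.smul_apply, Matrix.row_apply, smul_eq_mul] at this
  rw [Matrix.mul_apply, ← this]
  rfl

/-- A matrix of basis rows is one factor of a full rank factorization of the idempotent. -/
theorem IsRowBasis.exists_factorization (h : IsRowBasis M (eventualRowSpace p A)) :
    ∃ L : Matrix (Fin n) (Fin r) ℤ_[p], L * M = eventualIdempotent p A ∧ M * L = 1 := by
  obtain ⟨L, hL⟩ := exists_mul_eq_of_row_mem_span (X := eventualIdempotent p A) (Y := M)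
    fun i => by rw [h.2]; exact Submodule.subset_span ⟨i, rfl⟩
  obtain ⟨Q, hQ⟩ := exists_mul_eq_of_row_mem_span (X := M) (Y := eventualIdempotent p A)
    fun i => by
      have : M.row i ∈ eventualRowSpace p A := by
        rw [← h.2]; exact Submodule.subset_span ⟨i, rfl⟩
      exact this
  refine ⟨L, hL.symm, ?_⟩
  -- The rows of `M` are combinations of rows of the idempotent, hence fixed by it from the right;
  -- linear independence of the rows then allows `M` to be cancelled.
  have hME : M * L * M = M := by
    rw [Matrix.mul_assoc, ← hL]
    conv_lhs => rw [hQ]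
    rw [Matrix.mul_assoc, eventualIdempotent_mul_self, ← hQ]
  have hz : (M * L - 1) * M = 0 := by rw [Matrix.sub_mul, hME, Matrix.one_mul, sub_self]
  rw [← sub_eq_zero]
  ext i j
  have hi := congrFun hz i
  have := Fintype.linearIndependent_iff.1 h.1
    (fun k => (M * L - 1 : Matrix (Fin r) (Fin r) ℤ_[p]) i k) (by
    funext k
    have := congrFun hi k
    rw [Matrix.mul_apply] at this
    simpa [Finset.sum_apply, Matrix.row_apply] using this)
  exact this j

theorem mul_eventualIdempotent_of_factorization (hLM : L * M = eventualIdempotent p A)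
    (hML : M * L = 1) : M * eventualIdempotent p A = M := by
  rw [← hLM, ← Matrix.mul_assoc, hML, Matrix.one_mul]

/-- The action of `A` on the coordinates given by a full rank factorization is invertible. -/
theorem mul_intToPadic_of_factorization (hLM : L * M = eventualIdempotent p A)
    (hML : M * L = 1) (k : ℕ) :
    M * intToPadic p A ^ k = (M * intToPadic p A * L) ^ k * M := by
  have h1 : M * intToPadic p A = M * intToPadic p A * L * M := by
    rw [Matrix.mul_assoc _ L M, hLM, Matrix.mul_assoc, intToPadic_commute_eventualIdempotent,
      ← Matrix.mul_assoc, mul_eventualIdempotent_of_factorization hLM hML]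
  induction k with
  | zero => rw [pow_zero, pow_zero, Matrix.mul_one, Matrix.one_mul]
  | succ k ih =>
    generalize hA' : M * intToPadic p A * L = A' at *
    rw [pow_succ, ← Matrix.mul_assoc, ih, Matrix.mul_assoc, h1, ← Matrix.mul_assoc, ← pow_succ]

/-- Modulo `p` some power `Aᵉ` with `e ≥ 1` agrees with the idempotent, which is the identity in the
coordinates `M`. So the `e`-th power of the matrix of `A` is congruent to `1`. -/
theorem isUnit_of_factorization (hLM : L * M = eventualIdempotent p A) (hML : M * L = 1) :
    IsUnit (M * intToPadic p A * L) := by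
  obtain ⟨e, he, -, Z, hZ⟩ := exists_eventualIdempotent_eq (p := p) A 1 1
  have h1 : (M * intToPadic p A * L) ^ e = 1 + (p : ℤ_[p]) • -(M * Z * L) := by
    have h2 : M * intToPadic p A ^ e * L = (M * intToPadic p A * L) ^ e := by
      rw [mul_intToPadic_of_factorization hLM hML, Matrix.mul_assoc, hML, Matrix.mul_one]
    rw [← h2, ← map_pow, eq_sub_of_add_eq hZ.symm, Matrix.mul_sub, Matrix.sub_mul,
      mul_eventualIdempotent_of_factorization hLM hML, hML, pow_one, smul_neg, Matrix.mul_smul,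
      Matrix.smul_mul, sub_eq_add_neg]
  exact (isUnit_pow_iff (by omega)).1 (isUnit_of_eq_add_smul isUnit_one h1)

end EventualIdempotent

/-! ### Matrices over `ℤ_p`, `ℚ` and `ℚ_p`, and clearing of denominators -/

section PadicMatrices

variable {p : ℕ} [Fact p.Prime] {ι κ μ : Type*}

/-- A matrix over `ℤ_p`, regarded as a matrix over `ℚ_p`. -/
noncomputable abbrev padicMap (X : Matrix ι κ ℤ_[p]) : Matrix ι κ ℚ_[p] :=
  X.map ((↑) : ℤ_[p] → ℚ_[p])

/-- A rational matrix, regarded as a matrix over `ℚ_p`. -/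
noncomputable abbrev ratPadic (p : ℕ) [Fact p.Prime] (X : Matrix ι κ ℚ) : Matrix ι κ ℚ_[p] :=
  X.map ((↑) : ℚ → ℚ_[p])

theorem padicMap_mul [Fintype κ] (X : Matrix ι κ ℤ_[p]) (Y : Matrix κ μ ℤ_[p]) :
    padicMap (X * Y) = padicMap X * padicMap Y :=
  Matrix.map_mul (f := PadicInt.Coe.ringHom)

theorem padicMap_add (X Y : Matrix ι κ ℤ_[p]) : padicMap (X + Y) = padicMap X + padicMap Y :=
  Matrix.ext fun _ _ => PadicInt.coe_add _ _

theorem padicMap_smul (c : ℤ_[p]) (X : Matrix ι κ ℤ_[p]) :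
    padicMap (c • X) = (c : ℚ_[p]) • padicMap X :=
  Matrix.ext fun _ _ => PadicInt.coe_mul _ _

theorem padicMap_one [DecidableEq ι] : padicMap (1 : Matrix ι ι ℤ_[p]) = 1 :=
  Matrix.map_one _ PadicInt.coe_zero PadicInt.coe_one

theorem padicMap_injective : Function.Injective (padicMap (p := p) (ι := ι) (κ := κ)) :=
  fun X Y h => by
    ext i j
    exact PadicInt.ext (congrFun (congrFun h i) j) ▸ rfl

theorem ratPadic_mul [Fintype κ] (X : Matrix ι κ ℚ) (Y : Matrix κ μ ℚ) :
    ratPadic p (X * Y) = ratPadic p X * ratPadic p Y :=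
  Matrix.map_mul (f := Rat.castHom ℚ_[p])

theorem ratPadic_smul (c : ℚ) (X : Matrix ι κ ℚ) :
    ratPadic p (c • X) = (c : ℚ_[p]) • ratPadic p X := by
  ext; simp

theorem ratPadic_one [DecidableEq ι] : ratPadic p (1 : Matrix ι ι ℚ) = 1 :=
  Matrix.map_one _ Rat.cast_zero Rat.cast_one

theorem exists_padicMap_eq {X : Matrix ι κ ℚ_[p]} (h : ∀ i j, ‖X i j‖ ≤ 1) :
    ∃ Y : Matrix ι κ ℤ_[p], X = padicMap Y :=
  ⟨Matrix.of fun i j => ⟨X i j, h i j⟩, by ext; rfl⟩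

theorem exists_pow_smul_integral [Finite ι] (x : ι → ℚ_[p]) :
    ∃ t : ℕ, ∀ i, ‖(p : ℚ_[p]) ^ t * x i‖ ≤ 1 := by
  have hp1 : (1 : ℝ) < p := by exact_mod_cast (Fact.out : p.Prime).one_lt
  have : ∀ i, ∃ t : ℕ, ‖x i‖ ≤ (p : ℝ) ^ t := fun i =>
    (pow_unbounded_of_one_lt ‖x i‖ hp1).imp fun _ h => h.le
  choose t ht using this
  have := Fintype.ofFinite ι
  refine ⟨∑ i, t i, fun i => ?_⟩
  rw [norm_mul, norm_pow, Padic.norm_p, inv_pow, inv_mul_le_iff₀ (by positivity), mul_one]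
  exact (ht i).trans (pow_le_pow_right₀ hp1.le (Finset.single_le_sum (fun _ _ => Nat.zero_le _)
    (Finset.mem_univ i)))

theorem exists_pow_smul_eq_padicMap [Finite ι] [Finite κ] (X : Matrix ι κ ℚ_[p]) :
    ∃ (t : ℕ) (Y : Matrix ι κ ℤ_[p]), (p : ℚ_[p]) ^ t • X = padicMap Y := by
  obtain ⟨t, ht⟩ := exists_pow_smul_integral fun q : ι × κ => X q.1 q.2
  exact ⟨t, exists_padicMap_eq fun i j => ht (i, j)⟩

theorem exists_prod_den_smul [Fintype ι] [Fintype κ] (X : Matrix ι κ ℚ) :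
    ∃ Z : Matrix ι κ ℤ, ((∏ q : ι × κ, (X q.1 q.2).den : ℕ) : ℚ) • X =
      Z.map (Int.cast : ℤ → ℚ) := by
  have hd : ∀ q : ι × κ, ∃ z : ℤ, ((∏ q : ι × κ, (X q.1 q.2).den : ℕ) : ℚ) * X q.1 q.2 = z :=
    fun q => by
      obtain ⟨c, hc⟩ := Finset.dvd_prod_of_mem (fun q : ι × κ => (X q.1 q.2).den)
        (Finset.mem_univ q)
      refine ⟨c * (X q.1 q.2).num, ?_⟩
      rw [hc]
      push_cast
      rw [mul_comm ((X q.1 q.2).den : ℚ), mul_assoc, Rat.den_mul_eq_num]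
  choose Z hZ using hd
  exact ⟨Matrix.of fun i j => Z (i, j), by ext i j; exact hZ (i, j)⟩

/-- A rational matrix that is `p`-adically integral becomes integral after multiplication with
an integer prime to `p`. -/
theorem exists_isUnit_natCast_smul [Fintype ι] [Fintype κ] {X : Matrix ι κ ℚ}
    {Y : Matrix ι κ ℤ_[p]} (h : ratPadic p X = padicMap Y) :
    ∃ (N : ℕ) (Z : Matrix ι κ ℤ), IsUnit (N : ℤ_[p]) ∧ (N : ℚ) • X = Z.map (Int.cast : ℤ → ℚ) := by
  have hu : ∀ q : ι × κ, IsUnit ((X q.1 q.2).den : ℤ_[p]) := fun q => by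
    refine PadicInt.isUnit_den _ ?_
    have : ((X q.1 q.2 : ℚ) : ℚ_[p]) = Y q.1 q.2 := congrFun (congrFun h q.1) q.2
    rw [this]
    exact (Y q.1 q.2).2
  obtain ⟨Z, hZ⟩ := exists_prod_den_smul X
  refine ⟨_, Z, ?_, hZ⟩
  push_cast
  exact IsUnit.prod_univ_iff.2 hu

theorem exists_natCast_smul [Fintype ι] [Fintype κ] (X : Matrix ι κ ℚ) :
    ∃ (N : ℕ) (Z : Matrix ι κ ℤ), N ≠ 0 ∧ (N : ℚ) • X = Z.map (Int.cast : ℤ → ℚ) := by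
  obtain ⟨Z, hZ⟩ := exists_prod_den_smul X
  exact ⟨_, Z, Finset.prod_ne_zero_iff.2 fun q _ => (X q.1 q.2).den_nz, hZ⟩

variable {n : ℕ}

theorem padicMap_intToPadic [Fintype ι] [DecidableEq ι] (X : Matrix ι ι ℤ) :
    padicMap (intToPadic p X) = ratPadic p (X.map (Int.cast : ℤ → ℚ)) :=
  Matrix.ext fun i j => (PadicInt.coe_intCast (X i j)).trans (Rat.cast_intCast (X i j)).symm

theorem ratMatrix_pow (A : Matrix (Fin n) (Fin n) ℤ) (k : ℕ) :
    ratMatrix (A ^ k) = ratMatrix A ^ k :=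
  Matrix.map_pow A (Int.castRingHom ℚ) k

/-- If `E_(p)(X) Ψ E_(p)(Y)` is integral then so is `N Xᵉ Ψ Yᶠ` for large suitable `e`, `f` and
some `N` prime to `p`. -/
theorem exists_integral_sandwich {X Y : Matrix (Fin n) (Fin n) ℤ} {Ψ : Matrix (Fin n) (Fin n) ℚ}
    {Z : Matrix (Fin n) (Fin n) ℤ_[p]}
    (h : padicMap (eventualIdempotent p X) * ratPadic p Ψ * padicMap (eventualIdempotent p Y) =
      padicMap Z) :
    ∃ (e f N : ℕ) (J : Matrix (Fin n) (Fin n) ℤ), IsUnit (N : ℤ_[p]) ∧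
      (N : ℚ) • (ratMatrix X ^ e * Ψ * ratMatrix Y ^ f) = ratMatrix J := by
  -- `pᵗ` clears the `p`-part of the denominators of `Ψ`. With powers of `X` and `Y` approximating
  -- the idempotents modulo `pᵗ`, each error term contains `pᵗ Ψ` and is integral. What remains in
  -- the denominators is prime to `p`.
  obtain ⟨t, Ψ₀, hΨ⟩ := exists_pow_smul_eq_padicMap (ratPadic p Ψ)
  obtain ⟨e, -, -, U, hU⟩ := exists_eventualIdempotent_eq (p := p) X t 0
  obtain ⟨f, -, -, V, hV⟩ := exists_eventualIdempotent_eq (p := p) Y t 0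
  have hU' : ratPadic p (ratMatrix X ^ e) =
      padicMap (eventualIdempotent p X) - (p : ℚ_[p]) ^ t • padicMap U := by
    rw [hU, padicMap_add, padicMap_smul, padicMap_intToPadic, ← ratMatrix_pow]
    simp [ratMatrix]
  have hV' : ratPadic p (ratMatrix Y ^ f) =
      padicMap (eventualIdempotent p Y) - (p : ℚ_[p]) ^ t • padicMap V := by
    rw [hV, padicMap_add, padicMap_smul, padicMap_intToPadic, ← ratMatrix_pow]
    simp [ratMatrix]
  have key : ratPadic p (ratMatrix X ^ e * Ψ * ratMatrix Y ^ f) =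
      padicMap (Z + (-1 : ℤ_[p]) • (U * Ψ₀ * eventualIdempotent p Y) +
        (-1 : ℤ_[p]) • (eventualIdempotent p X * Ψ₀ * V) + (p : ℤ_[p]) ^ t • (U * Ψ₀ * V)) := by
    simp only [ratPadic_mul, hU', hV', padicMap_add, padicMap_smul, padicMap_mul, ← h, ← hΨ,
      sub_mul, mul_sub, Matrix.smul_mul, Matrix.mul_smul]
    push_cast
    module
  obtain ⟨N, J, hN, hJ⟩ := exists_isUnit_natCast_smul key
  exact ⟨e, f, N, J, hN, hJ⟩

end PadicMatrices

/-! ### Determinants along a line -/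

section DetLine

variable {ι : Type*} [Fintype ι] [DecidableEq ι]

/-- The determinant along a line is a polynomial in the parameter. -/
theorem exists_polynomial_det_line (X Y : Matrix ι ι ℤ) :
    ∃ f : Polynomial ℤ, f.natDegree ≤ Fintype.card ι ∧ f.coeff (Fintype.card ι) = X.det ∧
      ∀ s, f.eval s = (s • X + Y).det := by
  refine ⟨_, Polynomial.natDegree_det_X_add_C_le X Y, Polynomial.coeff_det_X_add_C_card X Y,
    fun s => ?_⟩
  rw [← Polynomial.coe_evalRingHom, RingHom.map_det]
  congr 1
  ext i j
  simp [-zsmul_eq_mul]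

end DetLine

/-! ### Replacing the rational intertwiner by an integral one -/

section IntegerIntertwiner

variable {n r : ℕ} {p : ℕ} [Fact p.Prime] {A B : Matrix (Fin n) (Fin n) ℤ}
  {M M' : Matrix (Fin r) (Fin n) ℤ_[p]}

theorem padicMap_intToPadic_ratMatrix (X : Matrix (Fin n) (Fin n) ℤ) :
    padicMap (intToPadic p X) = ratPadic p (ratMatrix X) :=
  padicMap_intToPadic X

theorem padicMap_eventualIdempotent_mul {M : Matrix (Fin r) (Fin n) ℤ_[p]}
    {L : Matrix (Fin n) (Fin r) ℤ_[p]} (hLM : L * M = eventualIdempotent p A) :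
    padicMap (eventualIdempotent p A) = padicMap L * padicMap M := by
  rw [← hLM, padicMap_mul]

/-- The rational matrix of an intertwining relation may be taken integral. -/
theorem Intertwined.exists_integer (hM : IsRowBasis M (eventualRowSpace p A))
    (hM' : IsRowBasis M' (eventualRowSpace p B)) (h : Intertwined M M') :
    ∃ (C : Matrix (Fin n) (Fin n) ℤ) (D : Matrix (Fin r) (Fin r) ℤ_[p]),
      C.det ≠ 0 ∧ IsUnit D ∧ M * intToPadic p C = D * M' := by
  obtain ⟨L, hLM, hML⟩ := hM.exists_factorization
  obtain ⟨L', hLM', hML'⟩ := hM'.exists_factorization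
  obtain ⟨C, D, hCD⟩ := h
  set C₀ : Matrix (Fin n) (Fin n) ℚ := C.1 with hC₀
  set D₀ : Matrix (Fin r) (Fin r) ℤ_[p] := D.1 with hD₀
  change padicMap M * ratPadic p C₀ = padicMap D₀ * padicMap M' at hCD
  have hint : padicMap (eventualIdempotent p A) * ratPadic p C₀ *
      padicMap (eventualIdempotent p B) = padicMap (L * D₀ * M') := by
    rw [padicMap_eventualIdempotent_mul hLM, Matrix.mul_assoc (padicMap L), hCD,
      ← Matrix.mul_assoc, ← padicMap_mul, ← padicMap_mul, ← padicMap_mul, Matrix.mul_assoc,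
      mul_eventualIdempotent_of_factorization hLM' hML']
  obtain ⟨e, f, N, J, hN, hJ⟩ := exists_integral_sandwich hint
  obtain ⟨d, C₂, hd, hC₂⟩ := exists_natCast_smul C₀
  -- `J` is integral and its factor over `ℤ_p` is a unit, but `J` may be singular when `A` or `B`
  -- is.
  have hJM : M * intToPadic p J = ((N : ℤ_[p]) • ((M * intToPadic p A * L) ^ e * D₀ *
      (M' * intToPadic p B * L') ^ f)) * M' := by
    apply padicMap_injective
    have hA := congrArg padicMap (mul_intToPadic_of_factorization hLM hML e)
    have hB := congrArg padicMap (mul_intToPadic_of_factorization hLM' hML' f)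
    rw [← map_pow, padicMap_mul, padicMap_mul, padicMap_intToPadic_ratMatrix] at hA hB
    rw [padicMap_mul, padicMap_intToPadic_ratMatrix, ← hJ, ratPadic_smul, ratPadic_mul,
      ratPadic_mul, ← ratMatrix_pow, ← ratMatrix_pow,
      Matrix.mul_smul, ← Matrix.mul_assoc, ← Matrix.mul_assoc, hA,
      Matrix.mul_assoc _ (padicMap M), hCD, Matrix.mul_assoc, Matrix.mul_assoc (padicMap D₀), hB,
      padicMap_mul, padicMap_smul, padicMap_mul, padicMap_mul, Matrix.smul_mul]
    simp only [Matrix.mul_assoc]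
    simp
  -- `C₂` is integral and nonsingular, but its factor need not be a unit, as `p` may divide `d`.
  -- Adding `p t C₂` to `J` combines the virtues of both.
  have hCM : M * intToPadic p C₂ = ((d : ℤ_[p]) • D₀) * M' := by
    apply padicMap_injective
    rw [padicMap_mul, padicMap_intToPadic, ← hC₂, ratPadic_smul, Matrix.mul_smul, hCD,
      padicMap_mul, padicMap_smul, Matrix.smul_mul]
    simp
  have hdet : C₂.det ≠ 0 := by
    intro h0
    have h1 : (C₂.map (Int.cast : ℤ → ℚ)).det = 0 := by
      have := (Int.castRingHom ℚ).map_det C₂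
      rw [h0, map_zero] at this
      exact this.symm
    rw [← hC₂, Matrix.det_smul] at h1
    have h2 : IsUnit C₀.det := (Matrix.isUnit_iff_isUnit_det _).1 ⟨C, rfl⟩
    have h3 : ((d : ℚ) ^ Fintype.card (Fin n)) ≠ 0 := pow_ne_zero _ (Nat.cast_ne_zero.2 hd)
    exact (mul_ne_zero h3 h2.ne_zero) h1
  obtain ⟨g, -, hg, hgs⟩ := exists_polynomial_det_line C₂ J
  -- The coefficient of degree `n` is `det C₂ ≠ 0`, so the polynomial cannot vanish on all multiples
  -- of `p`.
  obtain ⟨t, ht⟩ : ∃ t : ℤ, g.eval ((p : ℤ) * t) ≠ 0 := by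
    by_contra! hall
    have hinj : Function.Injective fun t : ℤ => (p : ℤ) * t :=
      mul_right_injective₀ (by exact_mod_cast (Fact.out : p.Prime).ne_zero)
    have := Polynomial.eq_zero_of_infinite_isRoot g
      ((Set.infinite_range_of_injective hinj).mono (by rintro _ ⟨t, rfl⟩; exact hall t))
    rw [this, Polynomial.coeff_zero] at hg
    exact hdet hg.symm
  refine ⟨((p : ℤ) * t) • C₂ + J, (N : ℤ_[p]) • ((M * intToPadic p A * L) ^ e * D₀ *
      (M' * intToPadic p B * L') ^ f) + (p : ℤ_[p]) • ((t : ℤ_[p]) • ((d : ℤ_[p]) • D₀)),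
    by rw [← hgs]; exact ht, isUnit_of_eq_add_smul ?_ rfl, ?_⟩
  · obtain ⟨u, hu⟩ := hN
    rw [← hu, ← Units.smul_def]
    exact IsUnit.smul u (((isUnit_of_factorization hLM hML).pow e).mul ⟨D, rfl⟩ |>.mul
      ((isUnit_of_factorization hLM' hML').pow f))
  · rw [map_add, intToPadic_smul, Matrix.mul_add, hJM, Matrix.mul_smul, hCM, Matrix.add_mul,
      add_comm, smul_smul, smul_smul, Matrix.smul_mul, Matrix.smul_mul, Matrix.smul_mul,
      smul_smul]
    push_cast
    rfl

end IntegerIntertwiner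

/-! ### An integral form of the condition, with the unit reduced modulo `p` -/

section Reduction

variable {n : ℕ} {p : ℕ} [Fact p.Prime] {A B : Matrix (Fin n) (Fin n) ℤ}

theorem map_toZMod_intToPadic {ι : Type*} [Fintype ι] [DecidableEq ι] (X : Matrix ι ι ℤ) :
    (intToPadic p X).map PadicInt.toZMod = (Int.castRingHom (ZMod p)).mapMatrix X := by
  ext i j
  simp

theorem map_toZMod_eventualIdempotent {s : ℕ} (hs : s ≠ 0)
    (h : ∀ i j, (p : ℤ) ∣ (A ^ s * A ^ s - A ^ s) i j) :
    (eventualIdempotent p A).map PadicInt.toZMod =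
      (Int.castRingHom (ZMod p)).mapMatrix (A ^ s) := by
  obtain ⟨Z, hZ⟩ := eventualIdempotent_eq_pow_add hs h
  rw [hZ, ← map_toZMod_intToPadic]
  ext i j
  simp [-map_pow]

theorem map_toZMod_mul {ι κ μ : Type*} [Fintype κ] (X : Matrix ι κ ℤ_[p]) (Y : Matrix κ μ ℤ_[p]) :
    (X * Y).map PadicInt.toZMod = X.map PadicInt.toZMod * Y.map PadicInt.toZMod :=
  Matrix.map_mul

theorem map_toZMod_one {ι : Type*} [DecidableEq ι] :
    (1 : Matrix ι ι ℤ_[p]).map PadicInt.toZMod = 1 :=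
  Matrix.map_one _ (map_zero _) (map_one _)

theorem isUnit_of_isUnit_map_toZMod {ι : Type*} [Fintype ι] [DecidableEq ι]
    {X : Matrix ι ι ℤ_[p]} (h : IsUnit (X.map PadicInt.toZMod)) : IsUnit X := by
  rw [Matrix.isUnit_iff_isUnit_det] at h ⊢
  have key : PadicInt.toZMod X.det ≠ 0 := by
    rw [RingHom.map_det]
    exact h.ne_zero
  by_contra hX
  apply key
  rw [← RingHom.mem_ker, PadicInt.ker_toZMod]
  exact hX

/-- Exact reformulation of the row space condition with an integer matrix, in which the unit `D`
only appears through its reduction modulo `p`. -/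
theorem rowSpaceCondition_iff_exists_integer {s : ℕ} (hs : s ≠ 0)
    (hA : ∀ i j, (p : ℤ) ∣ (A ^ s * A ^ s - A ^ s) i j)
    (hB : ∀ i j, (p : ℤ) ∣ (B ^ s * B ^ s - B ^ s) i j) :
    RowSpaceCondition p A B ↔ ∃ C : Matrix (Fin n) (Fin n) ℤ, C.det ≠ 0 ∧
      eventualIdempotent p A * intToPadic p C * (1 - eventualIdempotent p B) = 0 ∧
      ∃ X : Matrix (Fin n) (Fin n) (ZMod p),
        (Int.castRingHom (ZMod p)).mapMatrix (A ^ s * C * B ^ s) * X =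
          (Int.castRingHom (ZMod p)).mapMatrix (A ^ s) ∧
        X * (Int.castRingHom (ZMod p)).mapMatrix (A ^ s * C * B ^ s) =
          (Int.castRingHom (ZMod p)).mapMatrix (B ^ s) := by
  simp only [map_mul, ← map_toZMod_eventualIdempotent hs hA, ← map_toZMod_eventualIdempotent hs hB,
    ← map_toZMod_intToPadic, ← map_toZMod_mul]
  constructor
  · rintro ⟨r, M, M', hM, hM', h⟩
    obtain ⟨C, D, hC, ⟨D, rfl⟩, hCD⟩ := h.exists_integer hM hM'
    obtain ⟨L, hLM, hML⟩ := hM.exists_factorization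
    obtain ⟨L', hLM', hML'⟩ := hM'.exists_factorization
    have hM'E := mul_eventualIdempotent_of_factorization hLM' hML'
    have hEC : eventualIdempotent p A * intToPadic p C =
        L * (D : Matrix (Fin r) (Fin r) ℤ_[p]) * M' := by
      rw [← hLM, Matrix.mul_assoc, hCD, Matrix.mul_assoc]
    have hDD : (D : Matrix (Fin r) (Fin r) ℤ_[p]) * (D⁻¹ : (Matrix (Fin r) (Fin r) ℤ_[p])ˣ) = 1 :=
      D.mul_inv
    have hDD' : ((D⁻¹ : (Matrix (Fin r) (Fin r) ℤ_[p])ˣ) : Matrix (Fin r) (Fin r) ℤ_[p]) * D = 1 :=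
      D.inv_mul
    generalize (D : Matrix (Fin r) (Fin r) ℤ_[p]) = D₀ at *
    generalize ((D⁻¹ : (Matrix (Fin r) (Fin r) ℤ_[p])ˣ) : Matrix (Fin r) (Fin r) ℤ_[p]) = D₁ at *
    -- In coordinates `E_A C = L D M'`, so `L' D⁻¹ M` is the inverse between the images of the two
    -- idempotents.
    refine ⟨C, hC, ?_, (L' * D₁ * M).map PadicInt.toZMod, ?_, ?_⟩
    · rw [hEC, Matrix.mul_sub, Matrix.mul_one, Matrix.mul_assoc _ M', hM'E, sub_self]
    · rw [← map_toZMod_mul, hEC, Matrix.mul_assoc _ M', hM'E]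
      congr 1
      rw [Matrix.mul_assoc _ M', ← Matrix.mul_assoc M', ← Matrix.mul_assoc M', hML',
        Matrix.one_mul, Matrix.mul_assoc L, ← Matrix.mul_assoc D₀, hDD, Matrix.one_mul, hLM]
    · rw [← map_toZMod_mul, hEC, Matrix.mul_assoc _ M', hM'E]
      congr 1
      rw [Matrix.mul_assoc _ M, ← Matrix.mul_assoc M, ← Matrix.mul_assoc M, hML,
        Matrix.one_mul, Matrix.mul_assoc L', ← Matrix.mul_assoc D₁, hDD', Matrix.one_mul, hLM']
  · rintro ⟨C, hC, hz, X, hX, hX'⟩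
    obtain ⟨r, M, hM⟩ := exists_isRowBasis (p := p) A
    obtain ⟨r', M', hM'⟩ := exists_isRowBasis (p := p) B
    obtain ⟨L, hLM, hML⟩ := hM.exists_factorization
    obtain ⟨L', hLM', hML'⟩ := hM'.exists_factorization
    have hME := mul_eventualIdempotent_of_factorization hLM hML
    have hCE : eventualIdempotent p A * intToPadic p C * eventualIdempotent p B =
        eventualIdempotent p A * intToPadic p C := by
      rw [Matrix.mul_sub, Matrix.mul_one, sub_eq_zero] at hz
      exact hz.symm
    -- The linear equation for `C` puts the rows of `M C` in the row space of `B`, and `L'` reads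
    -- off their coordinates; this gives the candidate for `D`.
    have hMC : M * intToPadic p C = M * intToPadic p C * L' * M' := by
      rw [Matrix.mul_assoc _ L', hLM']
      conv_lhs => rw [← hME, Matrix.mul_assoc, ← hCE, ← Matrix.mul_assoc, ← Matrix.mul_assoc, hME]
    have hMC' : M * (eventualIdempotent p A * intToPadic p C * eventualIdempotent p B) =
        M * intToPadic p C * L' * M' := by
      rw [hCE, ← Matrix.mul_assoc, hME, ← hMC]
    have hEL' : eventualIdempotent p B * L' = L' := by
      rw [← hLM', Matrix.mul_assoc, hML', Matrix.mul_one]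
    have hEL : eventualIdempotent p A * L = L := by
      rw [← hLM, Matrix.mul_assoc, hML, Matrix.mul_one]
    set D := M * intToPadic p C * L' with hD
    have h1 : D.map PadicInt.toZMod *
        (M'.map PadicInt.toZMod * X * L.map PadicInt.toZMod) = 1 := by
      rw [← Matrix.mul_assoc, ← Matrix.mul_assoc, ← map_toZMod_mul, ← hMC', map_toZMod_mul,
        Matrix.mul_assoc (M.map _), hX, ← map_toZMod_mul, ← map_toZMod_mul, hME, hML,
        map_toZMod_one]
    have h2 : (M'.map PadicInt.toZMod * X * L.map PadicInt.toZMod) * D.map PadicInt.toZMod = 1 := by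
      have : L * D = eventualIdempotent p A * intToPadic p C * eventualIdempotent p B * L' := by
        rw [hCE, hD, ← Matrix.mul_assoc, ← Matrix.mul_assoc, hLM]
      rw [Matrix.mul_assoc, ← map_toZMod_mul, this, map_toZMod_mul, Matrix.mul_assoc _ X,
        ← Matrix.mul_assoc X, hX', ← map_toZMod_mul, hEL', ← map_toZMod_mul, hML', map_toZMod_one]
    -- Equality of ranks is not assumed: it follows from the two-sided inverse over the field `ZMod
    -- p`.
    obtain rfl : r = r' := by
      simpa using Matrix.square_of_invertible _ _ h1 h2
    have hDu : IsUnit D := isUnit_of_isUnit_map_toZMod (IsUnit.of_mul_eq_one _ h1)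
    have hdet : IsUnit (C.map (Int.cast : ℤ → ℚ)) := by
      rw [Matrix.isUnit_iff_isUnit_det, isUnit_iff_ne_zero]
      have := (Int.castRingHom ℚ).map_det C
      intro h0
      have h3 : ((C.det : ℤ) : ℚ) = 0 := this.trans h0
      exact hC (by exact_mod_cast h3)
    refine ⟨r, M, M', hM, hM', hdet.unit, hDu.unit, ?_⟩
    change padicMap M * ratPadic p (C.map (Int.cast : ℤ → ℚ)) = padicMap D * padicMap M'
    rw [← padicMap_intToPadic, ← padicMap_mul, ← padicMap_mul, hMC]

end Reduction

/-! ### Integral projections onto kernels -/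

section Kernel

variable {ι : Type*} [Fintype ι] [DecidableEq ι]

/-- The kernel of an integral linear map is a direct summand of `ℤ^ι`. -/
theorem exists_matrix_parametrization_ker {N : Type*} [AddCommGroup N] [Module.IsTorsionFree ℤ N]
    (f : (ι → ℤ) →ₗ[ℤ] N) :
    ∃ (d : ℕ) (K : Matrix ι (Fin d) ℤ) (K' : Matrix (Fin d) ι ℤ), K' * K = 1 ∧
      (∀ u, f (K.mulVec u) = 0) ∧ ∀ v, f v = 0 → K.mulVec (K'.mulVec v) = v := by
  -- The image is finitely generated and torsion-free, hence free, so `f` splits over its image and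
  -- `id - s f` projects onto the kernel.
  have : Module.Free ℤ (LinearMap.range f) := Module.free_of_finite_type_torsion_free'
  obtain ⟨s, hs⟩ := Module.projective_lifting_property f.rangeRestrict LinearMap.id
    f.surjective_rangeRestrict
  have hs' : ∀ v, f (s (f.rangeRestrict v)) = f v := fun v =>
    congrArg Subtype.val (LinearMap.congr_fun hs (f.rangeRestrict v))
  let π : (ι → ℤ) →ₗ[ℤ] LinearMap.ker f :=
    (LinearMap.id - s ∘ₗ f.rangeRestrict).codRestrict _ fun v => by
      simp only [LinearMap.mem_ker, LinearMap.sub_apply, LinearMap.id_apply, LinearMap.comp_apply,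
        map_sub, hs', sub_self]
  have hπ : ∀ v (hv : f v = 0), π v = ⟨v, hv⟩ := fun v hv => by
    apply Subtype.ext
    have h0 : f.rangeRestrict v = 0 := Subtype.ext hv
    simp [π, h0]
  obtain ⟨d, b⟩ := Submodule.basisOfPid (Pi.basisFun ℤ ι) (LinearMap.ker f)
  let k : (Fin d → ℤ) →ₗ[ℤ] ι → ℤ := (LinearMap.ker f).subtype ∘ₗ b.equivFun.symm.toLinearMap
  let k' : (ι → ℤ) →ₗ[ℤ] Fin d → ℤ := b.equivFun.toLinearMap ∘ₗ π
  have hk : ∀ u, (LinearMap.toMatrix' k).mulVec u = k u := fun u => by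
    rw [← Matrix.toLin'_apply, Matrix.toLin'_toMatrix']
  have hk' : ∀ u, (LinearMap.toMatrix' k').mulVec u = k' u := fun u => by
    rw [← Matrix.toLin'_apply, Matrix.toLin'_toMatrix']
  refine ⟨d, LinearMap.toMatrix' k, LinearMap.toMatrix' k', ?_, fun u => ?_, fun v hv => ?_⟩
  · rw [← LinearMap.toMatrix'_comp, ← LinearMap.toMatrix'_id]
    congr 1
    refine LinearMap.ext fun u => ?_
    have := hπ (b.equivFun.symm u : LinearMap.ker f) (b.equivFun.symm u).2
    change b.equivFun (π ((b.equivFun.symm u : LinearMap.ker f) : ι → ℤ)) = u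
    rw [this]
    exact b.equivFun.apply_symm_apply u
  · rw [hk]
    exact (b.equivFun.symm u).2
  · rw [hk, hk']
    simp [k, k', hπ v hv]

/-- Every integer matrix `G` has an integral projection `K` onto its kernel, and this property of
`K` is witnessed by a matrix equation. -/
theorem exists_projection_ker (G : Matrix ι ι ℤ) :
    ∃ (K K' : Matrix ι ι ℤ) (q : ℤ), q ≠ 0 ∧ G * K = 0 ∧ K' * G = q • (1 - K) := by
  obtain ⟨d, K, K', hK, h0, h1⟩ := exists_matrix_parametrization_ker (Matrix.toLin' G)
  -- After clearing denominators, a rational kernel vector is integral and fixed by `K K'`. Hence `1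
  -- - K K'` factors through `G` over `ℚ`, and `q` is a common denominator of the factor.
  have hle : LinearMap.ker (Matrix.toLin' (G.map (Int.cast : ℤ → ℚ))) ≤
      LinearMap.ker (Matrix.toLin' ((1 - K * K').map (Int.cast : ℤ → ℚ))) := by
    intro v hv
    obtain ⟨N, Z, hN, hZ⟩ := exists_natCast_smul (Matrix.of fun i (_ : Unit) => v i)
    have hz : ∀ i, (N : ℚ) * v i = Z i () := fun i => congrFun (congrFun hZ i) ()
    have cast_mulVec : ∀ (X : Matrix ι ι ℤ) (i : ι),
        (N : ℚ) * (X.map (Int.cast : ℤ → ℚ)).mulVec v i = (X.mulVec fun j => Z j ()) i := by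
      intro X i
      simp only [Matrix.mulVec, dotProduct, Finset.mul_sum, Matrix.map_apply]
      push_cast
      refine Finset.sum_congr rfl fun j _ => ?_
      rw [← hz]
      ring
    have hv' : (Matrix.toLin' G) (fun j => Z j ()) = 0 := by
      funext i
      have := cast_mulVec G i
      rw [LinearMap.mem_ker, Matrix.toLin'_apply] at hv
      rw [hv, Pi.zero_apply, mul_zero] at this
      rw [Matrix.toLin'_apply]
      exact_mod_cast this.symm
    have h2 := h1 _ hv'
    rw [LinearMap.mem_ker, Matrix.toLin'_apply]
    funext i
    have := cast_mulVec (1 - K * K') i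
    rw [Matrix.sub_mulVec, Matrix.one_mulVec, ← Matrix.mulVec_mulVec, h2, sub_self] at this
    simpa [hN] using this
  obtain ⟨l, hl⟩ : ∃ l : (ι → ℚ) →ₗ[ℚ] (ι → ℚ), l ∘ₗ Matrix.toLin' (G.map (Int.cast : ℤ → ℚ)) =
      Matrix.toLin' ((1 - K * K').map (Int.cast : ℤ → ℚ)) := by
    set g := Matrix.toLin' (G.map (Int.cast : ℤ → ℚ))
    set h := Matrix.toLin' ((1 - K * K').map (Int.cast : ℤ → ℚ))
    obtain ⟨l, hl⟩ := LinearMap.exists_extend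
      ((LinearMap.ker g).liftQ h hle ∘ₗ g.quotKerEquivRange.symm.toLinearMap)
    refine ⟨l, LinearMap.ext fun v => ?_⟩
    have := LinearMap.congr_fun hl ⟨g v, LinearMap.mem_range_self g v⟩
    simpa [LinearMap.quotKerEquivRange_symm_apply_image] using this
  obtain ⟨N, Z, hN, hZ⟩ := exists_natCast_smul (LinearMap.toMatrix' l)
  refine ⟨K * K', Z, N, by exact_mod_cast hN, ?_, ?_⟩
  · have : G * K = 0 := by
      refine Matrix.toLin'.injective (LinearMap.ext fun u => ?_)
      rw [Matrix.toLin'_apply, ← Matrix.mulVec_mulVec, ← Matrix.toLin'_apply, h0]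
      simp
    rw [← Matrix.mul_assoc, this, Matrix.zero_mul]
  · have h3 := congrArg LinearMap.toMatrix' hl
    rw [LinearMap.toMatrix'_comp, LinearMap.toMatrix'_toLin', LinearMap.toMatrix'_toLin'] at h3
    have h4 := congrArg (fun X => (N : ℚ) • X) h3
    simp only [← Matrix.smul_mul, hZ] at h4
    have inj : Function.Injective fun X : Matrix ι ι ℤ => X.map (Int.cast : ℤ → ℚ) :=
      Matrix.map_injective Int.cast_injective
    apply inj
    change (Z * G).map (Int.castRingHom ℚ) = _
    rw [Matrix.map_mul]
    refine h4.trans ?_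
    ext i j
    change (N : ℚ) * (((1 - K * K' : Matrix ι ι ℤ) i j : ℤ) : ℚ) =
      (((N : ℤ) * (1 - K * K' : Matrix ι ι ℤ) i j : ℤ) : ℚ)
    push_cast
    rfl

end Kernel

/-! ### The kernel of an idempotent congruent to an integer matrix -/

section NilpotentPart

variable {ι : Type*} [Fintype ι] [DecidableEq ι] {p : ℕ} [Fact p.Prime]
  {W : Matrix ι ι ℤ} {Φ : Matrix ι ι ℤ_[p]}

/-- A `W`-invariant direct summand on which `W` vanishes modulo `p` is annihilated by an
idempotent that is congruent to `W` modulo `p`. -/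
theorem idempotent_mul_eq_zero_of_invariant (hΦ : Φ * Φ = Φ)
    (hc : intToPadic p W * Φ = Φ * intToPadic p W) {Z : Matrix ι ι ℤ_[p]}
    (hW : intToPadic p W = Φ + (p : ℤ_[p]) • Z) {K : Matrix ι ι ℤ} (hK : K * (W * K) = W * K)
    (hd : ∀ i j, (p : ℤ) ∣ (W * K) i j) : Φ * intToPadic p K = 0 := by
  obtain ⟨Y, hY⟩ := exists_smul_of_forall_dvd hd
  have hWK : W * K = (p : ℤ) • (K * Y) := by rw [← Matrix.mul_smul, ← hY, hK]
  have hWK' : intToPadic p W * intToPadic p K =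
      (p : ℤ_[p]) • (intToPadic p K * intToPadic p Y) := by
    rw [← map_mul, hWK, intToPadic_smul, map_mul]
    push_cast
    rfl
  refine padicInt_matrix_eq_zero_of_forall_dvd fun k => ?_
  induction k with
  | zero => exact ⟨_, by rw [pow_zero, one_smul]⟩
  | succ k ih =>
    obtain ⟨T, hT⟩ := ih
    refine ⟨T * intToPadic p Y - Z * T, ?_⟩
    -- `W` gains a factor `p` on `K` and differs from `Φ` by a multiple of `p`. In `Φ K = W Φ K - p
    -- Z Φ K` both terms are thus divisible by one more power of `p` than `Φ K` was known to be.
    have h1 : intToPadic p W * (Φ * intToPadic p K) =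
        (p : ℤ_[p]) ^ (k + 1) • (T * intToPadic p Y) := by
      rw [← Matrix.mul_assoc, hc, Matrix.mul_assoc, hWK', Matrix.mul_smul, ← Matrix.mul_assoc, hT,
        Matrix.smul_mul, smul_smul, pow_succ']
    have h2 : Φ * intToPadic p K = Φ * (Φ * intToPadic p K) := by rw [← Matrix.mul_assoc, hΦ]
    have h3 : Φ * (Φ * intToPadic p K) =
        (intToPadic p W - (p : ℤ_[p]) • Z) * (Φ * intToPadic p K) := by
      rw [← eq_sub_of_add_eq hW.symm]
    rw [h2, h3, Matrix.sub_mul, h1, hT, Matrix.smul_mul, Matrix.mul_smul, smul_smul, pow_succ',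
      smul_sub]

theorem intToPadic_mulVec (X : Matrix ι ι ℤ) (v : ι → ℤ) :
    (fun i => (X.mulVec v i : ℤ_[p])) = (intToPadic p X).mulVec fun i => (v i : ℤ_[p]) := by
  funext i
  simp [Matrix.mulVec, dotProduct]

theorem idempotent_mul_pow (hΦ : Φ * Φ = Φ) {Z : Matrix ι ι ℤ_[p]}
    (hW : intToPadic p W = Φ + (p : ℤ_[p]) • Z) (d : ℕ) :
    ∃ Y, Φ * intToPadic p W ^ d = Φ + (p : ℤ_[p]) • Y := by
  induction d with
  | zero => exact ⟨0, by simp⟩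
  | succ d ih =>
    obtain ⟨Y, hY⟩ := ih
    refine ⟨Φ * Z + Y * (Φ + (p : ℤ_[p]) • Z), ?_⟩
    rw [pow_succ, ← Matrix.mul_assoc, hY, Matrix.add_mul, hW, Matrix.mul_add, hΦ, Matrix.mul_smul,
      Matrix.smul_mul, smul_add, add_assoc]

/-- If `g(W) v = 0` with `g` congruent to a power of the variable, then an idempotent that is
congruent to `W` annihilates `v`. -/
theorem idempotent_mulVec_eq_zero (hΦ : Φ * Φ = Φ)
    (hc : intToPadic p W * Φ = Φ * intToPadic p W) {Z : Matrix ι ι ℤ_[p]}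
    (hW : intToPadic p W = Φ + (p : ℤ_[p]) • Z) {d : ℕ} {F : Matrix ι ι ℤ} (hF : Commute W F)
    {v : ι → ℤ} (hv : (W ^ d + (p : ℤ) • F).mulVec v = 0) :
    Φ.mulVec (fun i => (v i : ℤ_[p])) = 0 := by
  obtain ⟨Y, hY⟩ := idempotent_mul_pow hΦ hW d
  refine padicInt_funext_of_forall_dvd fun k => ?_
  -- The vector varies because the step also uses the claim for `F v`, which satisfies the same
  -- equation as `F` commutes with `W`. From `Wᵈ v = -p F v` and `Φ Wᵈ ≡ Φ` modulo `p` one more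
  -- factor `p` is gained.
  induction k generalizing v with
  | zero => exact ⟨_, by rw [pow_zero, one_smul]⟩
  | succ k ih =>
    have hcomm : Commute (W ^ d + (p : ℤ) • F) F :=
      (hF.pow_left d).add_left ((Commute.refl F).smul_left _)
    have hFv : (W ^ d + (p : ℤ) • F).mulVec (F.mulVec v) = 0 := by
      rw [Matrix.mulVec_mulVec, hcomm.eq, ← Matrix.mulVec_mulVec, hv, Matrix.mulVec_zero]
    obtain ⟨w, hw⟩ := ih hv
    obtain ⟨u, hu⟩ := ih hFv
    rw [intToPadic_mulVec] at hu
    have hWv : (intToPadic p W ^ d).mulVec (fun i => (v i : ℤ_[p])) =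
        -((p : ℤ_[p]) • (intToPadic p F).mulVec fun i => (v i : ℤ_[p])) := by
      have := intToPadic_mulVec (p := p) (W ^ d + (p : ℤ) • F) v
      rw [hv, map_add, intToPadic_smul, map_pow, Matrix.add_mulVec, Matrix.smul_mulVec] at this
      push_cast at this
      exact eq_neg_of_add_eq_zero_left (this.symm.trans (by ext; simp))
    have hcd : Φ * intToPadic p W ^ d = intToPadic p W ^ d * Φ :=
      ((show Commute (intToPadic p W) Φ from hc).pow_left d).eq.symm
    generalize (fun i => (v i : ℤ_[p])) = x at *
    have h1 : (Φ * intToPadic p W ^ d).mulVec (Φ.mulVec x) =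
        -((p : ℤ_[p]) • Φ.mulVec ((intToPadic p F).mulVec x)) := by
      rw [Matrix.mulVec_mulVec, Matrix.mul_assoc, ← hcd, ← Matrix.mul_assoc, hΦ,
        ← Matrix.mulVec_mulVec, hWv, Matrix.mulVec_neg, Matrix.mulVec_smul]
    rw [hY, Matrix.add_mulVec, Matrix.mulVec_mulVec, hΦ, Matrix.smul_mulVec] at h1
    refine ⟨-u - Y.mulVec w, ?_⟩
    rw [eq_sub_of_add_eq h1, hw, Matrix.mulVec_smul, hu, smul_sub, smul_neg,
      smul_smul, smul_smul, pow_succ']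

end NilpotentPart

/-! ### An integral annihilator with bounded entries -/

section BoundedAnnihilator

variable {ι : Type*} [Fintype ι] [DecidableEq ι]

/-- The bound for the coefficients of a matrix `g(W)`, where `g` is a monic factor of the
characteristic polynomial of `W`, in terms of the size `N` and the entry sum of `W`. -/
def factorBound (N w : ℕ) : ℕ := (N + 1) * (w ^ N * 2 ^ N * w ^ N)

theorem abs_pow_apply_le {W : Matrix ι ι ℤ} {w : ℕ} (hw : ∑ i, ∑ j, |W i j| < (w : ℤ)) (k : ℕ)
    (i j : ι) : |(W ^ k) i j| ≤ (w : ℤ) ^ k := by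
  have hcol : ∀ j, ∑ i, |W i j| ≤ w := fun j => by
    refine le_trans ?_ hw.le
    exact Finset.sum_le_sum fun i _ =>
      Finset.single_le_sum (f := fun j => |W i j|) (fun _ _ => abs_nonneg _) (Finset.mem_univ j)
  induction k generalizing i j with
  | zero =>
    rw [pow_zero, pow_zero, Matrix.one_apply]
    split_ifs <;> simp
  | succ k ih =>
    rw [pow_succ, Matrix.mul_apply, pow_succ]
    calc |∑ t, (W ^ k) i t * W t j| ≤ ∑ t, |(W ^ k) i t * W t j| := Finset.abs_sum_le_sum_abs _ _
      _ ≤ ∑ t, (w : ℤ) ^ k * |W t j| := Finset.sum_le_sum fun t _ => by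
          rw [abs_mul]
          exact mul_le_mul_of_nonneg_right (ih i t) (abs_nonneg _)
      _ = (w : ℤ) ^ k * ∑ t, |W t j| := by rw [Finset.mul_sum]
      _ ≤ (w : ℤ) ^ k * w := mul_le_mul_of_nonneg_left (hcol j) (by positivity)

/-- Compare the two sides in a coordinate where the eigenvector has maximal absolute value. -/
theorem norm_eigenvalue_le {κ : Type*} [Fintype κ] {W : Matrix κ κ ℤ} {w : ℕ}
    (hw : ∑ i, ∑ j, |W i j| < (w : ℤ)) {z : ℂ}
    {x : κ → ℂ} (hx : x ≠ 0) (h : (W.map (Int.cast : ℤ → ℂ)).mulVec x = z • x) : ‖z‖ ≤ w := by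
  have hrow : ∀ i, ∑ j, ‖((W i j : ℤ) : ℂ)‖ ≤ w := fun i => by
    have h1 : ∑ j, |W i j| ≤ w := le_trans
      (Finset.single_le_sum (f := fun i => ∑ j, |W i j|)
        (fun _ _ => Finset.sum_nonneg fun _ _ => abs_nonneg _) (Finset.mem_univ i)) hw.le
    have h2 : ∑ j, ‖((W i j : ℤ) : ℂ)‖ = ((∑ j, |W i j| : ℤ) : ℝ) := by
      push_cast
      exact Finset.sum_congr rfl fun j _ => by rw [Complex.norm_intCast]
    rw [h2]
    exact_mod_cast h1
  have : Nonempty κ := by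
    by_contra hne
    rw [not_nonempty_iff] at hne
    exact hx (Subsingleton.elim _ _)
  obtain ⟨i, hi⟩ := Finite.exists_max fun i => ‖x i‖
  have hpos : 0 < ‖x i‖ := by
    obtain ⟨j, hj⟩ := Function.ne_iff.1 hx
    exact (norm_pos_iff.2 hj).trans_le (hi j)
  have hz : ‖z‖ * ‖x i‖ ≤ w * ‖x i‖ := by
    have := congrFun h i
    rw [← norm_mul, ← smul_eq_mul, ← Pi.smul_apply, ← this]
    calc ‖(W.map (Int.cast : ℤ → ℂ)).mulVec x i‖ ≤ ∑ j, ‖((W i j : ℤ) : ℂ) * x j‖ :=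
          norm_sum_le _ _
      _ ≤ ∑ j, ‖((W i j : ℤ) : ℂ)‖ * ‖x i‖ := Finset.sum_le_sum fun j _ => by
          rw [norm_mul]
          exact mul_le_mul_of_nonneg_left (hi j) (norm_nonneg _)
      _ = (∑ j, ‖((W i j : ℤ) : ℂ)‖) * ‖x i‖ := by rw [Finset.sum_mul]
      _ ≤ w * ‖x i‖ := mul_le_mul_of_nonneg_right (hrow i) (norm_nonneg _)
  exact le_of_mul_le_mul_right hz hpos

/-- The roots of the characteristic polynomial of a restriction of `W` are bounded. -/
theorem abs_coeff_charpoly_le {κ : Type*} [Fintype κ] {W : Matrix κ κ ℤ} {w : ℕ}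
    (hw : ∑ i, ∑ j, |W i j| < (w : ℤ)) {d : ℕ}
    {K : Matrix κ (Fin d) ℤ} {K' : Matrix (Fin d) κ ℤ} {S : Matrix (Fin d) (Fin d) ℤ}
    (hK : K' * K = 1) (hS : W * K = K * S) (hd : d ≤ Fintype.card κ) (k : ℕ) :
    |S.charpoly.coeff k| ≤ ((w ^ Fintype.card κ * 2 ^ Fintype.card κ : ℕ) : ℤ) := by
  have hw1 : 1 ≤ w := by
    have : (0 : ℤ) ≤ ∑ i, ∑ j, |W i j| :=
      Finset.sum_nonneg fun _ _ => Finset.sum_nonneg fun _ _ => abs_nonneg _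
    omega
  have hmap : S.charpoly.map (Int.castRingHom ℂ) = (S.map (Int.castRingHom ℂ)).charpoly :=
    (Matrix.charpoly_map S (Int.castRingHom ℂ)).symm
  have hroots : ∀ z ∈ ((S.charpoly.map (Int.castRingHom ℂ)).map (RingHom.id ℂ)).roots,
      ‖z‖ ≤ (w : ℝ) := by
    intro z hz
    rw [Polynomial.map_id, hmap] at hz
    have hz' := (Polynomial.mem_roots'.1 hz).2
    rw [Polynomial.IsRoot, Matrix.eval_charpoly] at hz'
    obtain ⟨u, hu, hu0⟩ := Matrix.exists_mulVec_eq_zero_iff.2 hz'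
    rw [Matrix.sub_mulVec, sub_eq_zero] at hu0
    have hKK : (K'.map (Int.castRingHom ℂ)) * K.map (Int.castRingHom ℂ) = 1 := by
      rw [← Matrix.map_mul, hK, Matrix.map_one _ (map_zero _) (map_one _)]
    have hWK : (W.map (Int.castRingHom ℂ)) * K.map (Int.castRingHom ℂ) =
        K.map (Int.castRingHom ℂ) * S.map (Int.castRingHom ℂ) := by
      rw [← Matrix.map_mul, hS, Matrix.map_mul]
    -- `K` has a left inverse and intertwines `S` with `W`, so it carries eigenvectors of `S` to
    -- nonzero eigenvectors of `W`.
    refine norm_eigenvalue_le hw (x := (K.map (Int.castRingHom ℂ)).mulVec u) (fun h0 => hu ?_) ?_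
    · have := congrArg (K'.map (Int.castRingHom ℂ)).mulVec h0
      rwa [Matrix.mulVec_mulVec, hKK, Matrix.one_mulVec, Matrix.mulVec_zero] at this
    · change (W.map (Int.castRingHom ℂ)).mulVec _ = _
      rw [Matrix.mulVec_mulVec, hWK, ← Matrix.mulVec_mulVec, ← hu0, ← Matrix.mulVec_smul]
      congr 1
      ext i
      simp [Matrix.mulVec_diagonal, Matrix.scalar_apply]
  have hb := Polynomial.coeff_bdd_of_roots_le (RingHom.id ℂ)
    (p := S.charpoly.map (Int.castRingHom ℂ)) (S.charpoly_monic.map _) (IsAlgClosed.splits _)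
    (d := Fintype.card κ) (by
      rw [S.charpoly_monic.natDegree_map, Matrix.charpoly_natDegree_eq_dim, Fintype.card_fin]
      exact hd) hroots k
  rw [Polynomial.map_id, Polynomial.coeff_map, eq_intCast, Complex.norm_intCast,
    max_eq_left (by exact_mod_cast hw1)] at hb
  have h2 : (((Fintype.card κ).choose (Fintype.card κ / 2) : ℕ) : ℝ) ≤ 2 ^ Fintype.card κ := by
    exact_mod_cast Nat.choose_le_two_pow _ _
  have h3 : ((|S.charpoly.coeff k| : ℤ) : ℝ) ≤ (w : ℝ) ^ Fintype.card κ * 2 ^ Fintype.card κ := by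
    rw [Int.cast_abs]
    exact hb.trans (mul_le_mul_of_nonneg_left h2 (by positivity))
  exact_mod_cast h3

variable {p : ℕ} [Fact p.Prime] {W : Matrix ι ι ℤ} {Φ : Matrix ι ι ℤ_[p]}

theorem intCast_dvd_of_padicInt_dvd {a : ℤ} (h : (p : ℤ_[p]) ∣ (a : ℤ_[p])) : (p : ℤ) ∣ a := by
  have := PadicInt.norm_int_lt_one_iff_dvd (p := p) a
  rw [← this]
  exact PadicInt.norm_lt_one_iff_dvd _ |>.2 h

/-- The integral vectors annihilated by an idempotent congruent to `W` modulo `p` form the kernel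
of an integer matrix of bounded size. -/
theorem exists_bounded_annihilator (hΦ : Φ * Φ = Φ)
    (hc : intToPadic p W * Φ = Φ * intToPadic p W) {Z : Matrix ι ι ℤ_[p]}
    (hW : intToPadic p W = Φ + (p : ℤ_[p]) • Z) {w : ℕ} (hw : ∑ i, ∑ j, |W i j| < (w : ℤ)) :
    ∃ G : Matrix ι ι ℤ,
      (∀ v : ι → ℤ, G.mulVec v = 0 ↔ Φ.mulVec (fun i => (v i : ℤ_[p])) = 0) ∧
      ∀ i j, |G i j| ≤ factorBound (Fintype.card ι) w := by
  let f : (ι → ℤ) →ₗ[ℤ] ι → ℤ_[p] :=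
    Φ.mulVecLin.restrictScalars ℤ ∘ₗ (Algebra.linearMap ℤ ℤ_[p]).compLeft ι
  have hf : ∀ v, f v = Φ.mulVec fun i => (v i : ℤ_[p]) := fun v => rfl
  obtain ⟨d, K, K', hK, h0, h1⟩ := exists_matrix_parametrization_ker f
  simp only [hf] at h0 h1
  have hd : d ≤ Fintype.card ι := by
    have hinj : Function.Injective (Matrix.mulVecLin K) := by
      refine Function.LeftInverse.injective (g := K'.mulVec) fun u => ?_
      rw [Matrix.mulVecLin_apply, Matrix.mulVec_mulVec, hK, Matrix.one_mulVec]
    simpa using card_le_of_injective _ _ hinj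
  have hWv : ∀ v : ι → ℤ, Φ.mulVec (fun i => (v i : ℤ_[p])) = 0 →
      Φ.mulVec (fun i => (W.mulVec v i : ℤ_[p])) = 0 := fun v hv => by
    rw [intToPadic_mulVec, Matrix.mulVec_mulVec, ← hc, ← Matrix.mulVec_mulVec, hv,
      Matrix.mulVec_zero]
  -- The integral kernel is `W`-invariant because `W` commutes with `Φ`, and `S` is the matrix of
  -- the restriction.
  set S := K' * (W * K) with hS
  have hKS : W * K = K * S := by
    refine Matrix.ext_of_mulVec_single fun j => ?_
    rw [hS, ← Matrix.mulVec_mulVec, ← Matrix.mulVec_mulVec, ← Matrix.mulVec_mulVec,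
      ← Matrix.mulVec_mulVec]
    exact (h1 _ (hWv _ (h0 _))).symm
  have hdvd : ∀ i j, (p : ℤ) ∣ (W * K) i j := fun i j => by
    apply intCast_dvd_of_padicInt_dvd
    have h2 : (W * K) i j = W.mulVec (K.mulVec (Pi.single j 1)) i := by
      rw [Matrix.mulVec_mulVec, Matrix.mulVec_single_one]
      rfl
    have h3 := congrFun (intToPadic_mulVec (p := p) W (K.mulVec (Pi.single j 1))) i
    rw [hW, Matrix.add_mulVec, h0, zero_add, Matrix.smul_mulVec] at h3
    rw [h2, h3]
    exact ⟨_, rfl⟩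
  have hSdvd : ∀ i j, (p : ℤ) ∣ S i j := fun i j => by
    rw [hS, Matrix.mul_apply]
    exact Finset.dvd_sum fun t _ => (hdvd t j).mul_left _
  -- `W` agrees with `Φ` modulo `p`, so it vanishes modulo `p` on the kernel of `Φ`; hence `S ≡ 0`
  -- and its characteristic polynomial is congruent to `Xᵈ`.
  obtain ⟨F, hF⟩ : ∃ F : Polynomial ℤ, S.charpoly =
      Polynomial.X ^ d + Polynomial.C (p : ℤ) * F := by
    have h4 : (Int.castRingHom (ZMod p)).mapMatrix S = 0 := by
      ext i j
      simpa using (ZMod.intCast_zmod_eq_zero_iff_dvd _ _).2 (hSdvd i j)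
    have h5 : (S.charpoly - Polynomial.X ^ d).map (Int.castRingHom (ZMod p)) = 0 := by
      have h6 := Matrix.charpoly_map S (Int.castRingHom (ZMod p))
      change ((Int.castRingHom (ZMod p)).mapMatrix S).charpoly = _ at h6
      rw [h4, Matrix.charpoly_zero, Fintype.card_fin] at h6
      rw [Polynomial.map_sub, ← h6]
      simp
    have h7 : Polynomial.C (p : ℤ) ∣ S.charpoly - Polynomial.X ^ d := by
      rw [Polynomial.C_dvd_iff_dvd_coeff]
      intro k
      have := congrArg (fun q => Polynomial.coeff q k) h5
      rw [Polynomial.coeff_map, Polynomial.coeff_zero, eq_intCast] at this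
      exact (ZMod.intCast_zmod_eq_zero_iff_dvd _ _).1 this
    obtain ⟨F, hF⟩ := h7
    exact ⟨F, by rw [← hF]; ring⟩
  have hG : Polynomial.aeval W S.charpoly = W ^ d + (p : ℤ) • Polynomial.aeval W F := by
    rw [hF, map_add, map_pow, Polynomial.aeval_X, map_mul, Polynomial.aeval_C, zsmul_eq_mul]
    simp
  have hGK : ∀ g : Polynomial ℤ, Polynomial.aeval W g * K = K * Polynomial.aeval S g := fun g => by
    induction g using Polynomial.induction_on' with
    | add a b ha hb => rw [map_add, map_add, Matrix.add_mul, ha, hb, Matrix.mul_add]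
    | monomial k a =>
      have : W ^ k * K = K * S ^ k := by
        induction k with
        | zero => simp
        | succ k ih => rw [pow_succ, Matrix.mul_assoc, hKS, ← Matrix.mul_assoc, ih,
            Matrix.mul_assoc, ← pow_succ]
      simp only [Polynomial.aeval_monomial, Algebra.algebraMap_eq_smul_one, Matrix.smul_mul,
        Matrix.one_mul, this, Matrix.mul_smul]
  -- Cayley–Hamilton for `S` shows that `g(W)` kills the lattice; that it kills no integral vector
  -- outside of it is `idempotent_mulVec_eq_zero`.
  refine ⟨Polynomial.aeval W S.charpoly, fun v => ⟨fun hv => ?_, fun hv => ?_⟩, fun i j => ?_⟩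
  · rw [hG] at hv
    exact idempotent_mulVec_eq_zero hΦ hc hW (by
      simpa using (Commute.all Polynomial.X F).map (Polynomial.aeval W)) hv
  · rw [← h1 v hv, Matrix.mulVec_mulVec, hGK, Matrix.aeval_self_charpoly, Matrix.mul_zero,
      Matrix.zero_mulVec]
  · have hw1 : 1 ≤ w := by
      have : (0 : ℤ) ≤ ∑ i, ∑ j, |W i j| :=
        Finset.sum_nonneg fun _ _ => Finset.sum_nonneg fun _ _ => abs_nonneg _
      omega
    rw [Polynomial.aeval_eq_sum_range, Matrix.charpoly_natDegree_eq_dim, Fintype.card_fin,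
      Matrix.sum_apply]
    set N := Fintype.card ι
    calc |∑ k ∈ Finset.range (d + 1), (S.charpoly.coeff k • W ^ k) i j|
        ≤ ∑ k ∈ Finset.range (d + 1), |(S.charpoly.coeff k • W ^ k) i j| :=
          Finset.abs_sum_le_sum_abs _ _
      _ ≤ ∑ k ∈ Finset.range (d + 1), ((w ^ N * 2 ^ N * w ^ N : ℕ) : ℤ) := by
          refine Finset.sum_le_sum fun k hk => ?_
          rw [Matrix.smul_apply, smul_eq_mul, abs_mul]
          rw [Nat.cast_mul]
          refine mul_le_mul (abs_coeff_charpoly_le hw hK hKS hd k) ?_ (abs_nonneg _) (by positivity)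
          refine (abs_pow_apply_le hw k i j).trans ?_
          rw [Nat.cast_pow]
          exact pow_le_pow_right₀ (by exact_mod_cast hw1) (by
            have := Finset.mem_range.1 hk
            omega)
      _ = ((d + 1) * (w ^ N * 2 ^ N * w ^ N) : ℕ) := by simp
      _ ≤ (factorBound N w : ℕ) := by
          rw [factorBound]
          exact_mod_cast Nat.mul_le_mul_right _ (by omega)

end BoundedAnnihilator

/-! ### The finite criterion -/

section Criterion

open scoped Kronecker

variable {n : ℕ}

/-- The matrix of `C ↦ X C (1 - Y)`. -/
def twoSided {R : Type*} [Ring R] (X Y : Matrix (Fin n) (Fin n) R) :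
    Matrix (Fin n × Fin n) (Fin n × Fin n) R :=
  X ⊗ₖ (1 - Y).transpose

/-- A vector indexed by pairs as a square matrix. -/
def unvec {R : Type*} (v : Fin n × Fin n → R) : Matrix (Fin n) (Fin n) R :=
  Matrix.of fun i j => v (i, j)

theorem unvec_twoSided_mulVec {R : Type*} [CommRing R] (X Y : Matrix (Fin n) (Fin n) R)
    (v : Fin n × Fin n → R) : unvec ((twoSided X Y).mulVec v) = X * unvec v * (1 - Y) := by
  ext i j
  simp only [unvec, twoSided, Matrix.of_apply, Matrix.mulVec, dotProduct, Matrix.mul_apply,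
    Matrix.kroneckerMap_apply, Matrix.transpose_apply, Fintype.sum_prod_type, Finset.sum_mul]
  rw [Finset.sum_comm]
  refine Finset.sum_congr rfl fun k _ => Finset.sum_congr rfl fun l _ => ?_
  ring

theorem unvec_injective {R : Type*} : Function.Injective (unvec (n := n) (R := R)) :=
  fun _ _ h => funext fun q => congrFun (congrFun h q.1) q.2

variable {p : ℕ} [Fact p.Prime] {A B : Matrix (Fin n) (Fin n) ℤ}

theorem twoSided_mul_twoSided {R : Type*} [CommRing R] (X X' Y Y' : Matrix (Fin n) (Fin n) R) :
    twoSided X Y * twoSided X' Y' = (X * X') ⊗ₖ ((1 - Y') * (1 - Y)).transpose := by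
  rw [twoSided, twoSided, ← Matrix.mul_kronecker_mul, ← Matrix.transpose_mul]

theorem intToPadic_twoSided (X Y : Matrix (Fin n) (Fin n) ℤ) :
    intToPadic p (twoSided X Y) = twoSided (intToPadic p X) (intToPadic p Y) := by
  have : intToPadic p (1 - Y) = 1 - intToPadic p Y := by rw [map_sub, map_one]
  rw [twoSided, twoSided, ← this]
  refine Matrix.ext fun i j => ?_
  exact Int.cast_mul _ _

/-- The idempotent `C ↦ E_(p)(A) C (1 - E_(p)(B))`. -/
noncomputable def twoSidedIdempotent (p : ℕ) [Fact p.Prime] (A B : Matrix (Fin n) (Fin n) ℤ) :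
    Matrix (Fin n × Fin n) (Fin n × Fin n) ℤ_[p] :=
  twoSided (eventualIdempotent p A) (eventualIdempotent p B)

theorem twoSidedIdempotent_mul_self :
    twoSidedIdempotent p A B * twoSidedIdempotent p A B = twoSidedIdempotent p A B := by
  have : (1 - eventualIdempotent p B) * (1 - eventualIdempotent p B) =
      1 - eventualIdempotent p B := by
    rw [Matrix.mul_sub, Matrix.mul_one, Matrix.sub_mul, Matrix.one_mul, eventualIdempotent_mul_self,
      sub_self, sub_zero]
  rw [twoSidedIdempotent, twoSided_mul_twoSided, eventualIdempotent_mul_self, this, twoSided]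

theorem twoSidedIdempotent_commute (s : ℕ) :
    intToPadic p (twoSided (A ^ s) (B ^ s)) * twoSidedIdempotent p A B =
      twoSidedIdempotent p A B * intToPadic p (twoSided (A ^ s) (B ^ s)) := by
  have hA : Commute (intToPadic p (A ^ s)) (eventualIdempotent p A) := by
    rw [map_pow]
    exact (show Commute _ _ from intToPadic_commute_eventualIdempotent A).pow_left s
  have hB : Commute (intToPadic p (B ^ s)) (eventualIdempotent p B) := by
    rw [map_pow]
    exact (show Commute _ _ from intToPadic_commute_eventualIdempotent B).pow_left s
  have hB' : Commute (1 - intToPadic p (B ^ s)) (1 - eventualIdempotent p B) :=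
    ((Commute.one_left _).sub_left ((Commute.one_right _).sub_right hB))
  rw [twoSidedIdempotent, intToPadic_twoSided, twoSided_mul_twoSided, twoSided_mul_twoSided, hA.eq,
    hB'.eq]

theorem intToPadic_twoSided_eq {s : ℕ} (hs : s ≠ 0)
    (hA : ∀ i j, (p : ℤ) ∣ (A ^ s * A ^ s - A ^ s) i j)
    (hB : ∀ i j, (p : ℤ) ∣ (B ^ s * B ^ s - B ^ s) i j) :
    ∃ Z, intToPadic p (twoSided (A ^ s) (B ^ s)) =
      twoSidedIdempotent p A B + (p : ℤ_[p]) • Z := by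
  obtain ⟨U, hU⟩ := eventualIdempotent_eq_pow_add hs hA
  obtain ⟨V, hV⟩ := eventualIdempotent_eq_pow_add hs hB
  refine ⟨-(U ⊗ₖ (1 - intToPadic p (B ^ s)).transpose) +
    (eventualIdempotent p A) ⊗ₖ V.transpose, ?_⟩
  rw [twoSidedIdempotent, intToPadic_twoSided]
  have hU' : ∀ i j, eventualIdempotent p A i j = intToPadic p (A ^ s) i j + p * U i j :=
    fun i j => congrFun (congrFun hU i) j
  have hV' : ∀ i j, eventualIdempotent p B i j = intToPadic p (B ^ s) i j + p * V i j :=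
    fun i j => congrFun (congrFun hV i) j
  refine Matrix.ext fun i j => ?_
  simp only [twoSided, Matrix.add_apply, Matrix.smul_apply, Matrix.neg_apply,
    Matrix.kroneckerMap_apply, Matrix.transpose_apply, Matrix.sub_apply, hU', hV', smul_eq_mul]
  ring

theorem twoSidedIdempotent_mulVec_eq_zero_iff (v : Fin n × Fin n → ℤ) :
    (twoSidedIdempotent p A B).mulVec (fun q => (v q : ℤ_[p])) = 0 ↔
      eventualIdempotent p A * intToPadic p (unvec v) * (1 - eventualIdempotent p B) = 0 := by
  rw [← unvec_injective.eq_iff, twoSidedIdempotent, unvec_twoSided_mulVec]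
  exact Iff.rfl

/-- The determinant of a matrix depending linearly on a vector does not vanish in a congruence
class if it does not vanish on small vectors of that class. -/
theorem exists_small_det_ne_zero {ι : Type*} [Fintype ι] [DecidableEq ι] {q : ℕ} (hq : 0 < q)
    (T : (ι → ℤ) →ₗ[ℤ] Matrix (Fin n) (Fin n) ℤ) {v : ι → ℤ} (hv : (T v).det ≠ 0) :
    ∃ c : ι → ℕ, (∀ i, c i < q * (n + 1)) ∧ (∀ i, (q : ℤ) ∣ c i - v i) ∧
      (T fun i => (c i : ℤ)).det ≠ 0 := by
  -- The coordinates are made small one at a time, keeping residues and the nonvanishing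
  -- determinant.
  have step : ∀ s : Finset ι, ∃ c : ι → ℤ, (∀ i ∈ s, 0 ≤ c i ∧ c i < q * (n + 1)) ∧
      (∀ i, (q : ℤ) ∣ c i - v i) ∧ (T c).det ≠ 0 := by
    intro s
    induction s using Finset.induction_on with
    | empty => exact ⟨v, by simp, by simp, hv⟩
    | insert a s ha ih =>
      obtain ⟨c, hc, hd, hdet⟩ := ih
      obtain ⟨f, hf, -, hfe⟩ := exists_polynomial_det_line
        (T (Pi.single a (q : ℤ))) (T (Function.update c a (c a % q)))
      have hline : ∀ t : ℤ, t • T (Pi.single a (q : ℤ)) + T (Function.update c a (c a % q)) =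
          T (Function.update c a (c a % q + q * t)) := fun t => by
        rw [← map_smul, ← map_add]
        congr 1
        funext i
        by_cases hi : i = a
        · subst hi
          simp
          ring
        · simp [hi]
      -- The determinant has degree at most `n` in `t`, and the value `t = c a / q`, which recovers
      -- `c`, shows that it is not identically zero. So one of `0, …, n` is not a root.
      obtain ⟨t, ht, ht'⟩ : ∃ t < n + 1, f.eval (t : ℤ) ≠ 0 := by
        by_contra! hall
        have hf0 := Polynomial.eq_zero_of_natDegree_lt_card_of_eval_eq_zero' f
          ((Finset.range (n + 1)).map Nat.castEmbedding) (by
            intro i hi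
            obtain ⟨t, ht, rfl⟩ := Finset.mem_map.1 hi
            exact hall t (Finset.mem_range.1 ht)) (by
            rw [Finset.card_map, Finset.card_range]
            simpa using Nat.lt_succ_of_le hf)
        have := hfe (c a / q)
        rw [hf0, hline, Int.emod_add_mul_ediv, Function.update_eq_self] at this
        exact hdet (by simpa using this.symm)
      refine ⟨Function.update c a (c a % q + q * t), fun i hi => ?_, fun i => ?_, ?_⟩
      · by_cases hia : i = a
        · subst hia
          rw [Function.update_self]
          have h1 := Int.emod_nonneg (c i) (by exact_mod_cast hq.ne' : (q : ℤ) ≠ 0)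
          have h2 := Int.emod_lt_of_pos (c i) (by exact_mod_cast hq : (0 : ℤ) < q)
          have h3 : (t : ℤ) ≤ n := by exact_mod_cast Nat.lt_succ_iff.1 ht
          constructor
          · positivity
          · nlinarith
        · rw [Function.update_of_ne hia]
          exact hc i ((Finset.mem_insert.1 hi).resolve_left hia)
      · by_cases hia : i = a
        · subst hia
          rw [Function.update_self]
          have h1 : (q : ℤ) ∣ c i % q - c i := ⟨-(c i / q), by
            have := Int.emod_add_mul_ediv (c i) q
            linarith⟩
          have h2 : c i % q + q * t - v i = (c i % q - c i) + (c i - v i) + q * t := by ring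
          rw [h2]
          exact ((h1.add (hd i)).add (dvd_mul_right _ _))
        · rw [Function.update_of_ne hia]
          exact hd i
      · rw [← hline, ← hfe]
        exact ht'
  obtain ⟨c, hc, hd, hdet⟩ := step Finset.univ
  have hcast : ∀ i, ((c i).toNat : ℤ) = c i := fun i =>
    Int.toNat_of_nonneg (hc i (Finset.mem_univ i)).1
  refine ⟨fun i => (c i).toNat, fun i => ?_, fun i => ?_, ?_⟩
  · have := (hc i (Finset.mem_univ i)).2
    rw [← hcast] at this
    exact_mod_cast this
  · simpa only [hcast] using hd i
  · simpa only [hcast] using hdet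

/-- Sufficiency of the finite criterion. -/
theorem rowSpaceCondition_of_certificate {s : ℕ} (hs : s ≠ 0)
    (hA : ∀ i j, (p : ℤ) ∣ (A ^ s * A ^ s - A ^ s) i j)
    (hB : ∀ i j, (p : ℤ) ∣ (B ^ s * B ^ s - B ^ s) i j)
    {K : Matrix (Fin n × Fin n) (Fin n × Fin n) ℤ}
    (hK : K * (twoSided (A ^ s) (B ^ s) * K) = twoSided (A ^ s) (B ^ s) * K)
    (hd : ∀ i j, (p : ℤ) ∣ (twoSided (A ^ s) (B ^ s) * K) i j) {c : Fin n × Fin n → ℤ}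
    (hdet : (unvec (K.mulVec c)).det ≠ 0) {X : Matrix (Fin n) (Fin n) (ZMod p)}
    (hX : (Int.castRingHom (ZMod p)).mapMatrix (A ^ s * unvec (K.mulVec c) * B ^ s) * X =
      (Int.castRingHom (ZMod p)).mapMatrix (A ^ s))
    (hX' : X * (Int.castRingHom (ZMod p)).mapMatrix (A ^ s * unvec (K.mulVec c) * B ^ s) =
      (Int.castRingHom (ZMod p)).mapMatrix (B ^ s)) : RowSpaceCondition p A B := by
  obtain ⟨Z, hZ⟩ := intToPadic_twoSided_eq hs hA hB
  have h0 := idempotent_mul_eq_zero_of_invariant twoSidedIdempotent_mul_self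
    (twoSidedIdempotent_commute s) hZ hK hd
  refine (rowSpaceCondition_iff_exists_integer hs hA hB).2 ⟨_, hdet, ?_, X, hX, hX'⟩
  rw [← twoSidedIdempotent_mulVec_eq_zero_iff, intToPadic_mulVec, Matrix.mulVec_mulVec, h0,
    Matrix.zero_mulVec]

/-- Necessity of the finite criterion. -/
theorem RowSpaceCondition.exists_certificate {s : ℕ} (hs : s ≠ 0)
    (hA : ∀ i j, (p : ℤ) ∣ (A ^ s * A ^ s - A ^ s) i j)
    (hB : ∀ i j, (p : ℤ) ∣ (B ^ s * B ^ s - B ^ s) i j) (h : RowSpaceCondition p A B) {w : ℕ}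
    (hw : ∑ i, ∑ j, |twoSided (A ^ s) (B ^ s) i j| < (w : ℤ)) :
    ∃ G : Matrix (Fin n × Fin n) (Fin n × Fin n) ℤ, (∀ i j, |G i j| ≤ factorBound (n * n) w) ∧
      ∀ (K K' : Matrix (Fin n × Fin n) (Fin n × Fin n) ℤ) (q : ℤ), q ≠ 0 → G * K = 0 →
        K' * G = q • (1 - K) →
        K * (twoSided (A ^ s) (B ^ s) * K) = twoSided (A ^ s) (B ^ s) * K ∧
        (∀ i j, (p : ℤ) ∣ (twoSided (A ^ s) (B ^ s) * K) i j) ∧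
        ∃ c : Fin n × Fin n → ℕ, (∀ i, c i < p * (n + 1)) ∧
          (unvec (K.mulVec fun i => (c i : ℤ))).det ≠ 0 ∧
          ∃ X : Matrix (Fin n) (Fin n) (ZMod p),
            (Int.castRingHom (ZMod p)).mapMatrix
              (A ^ s * unvec (K.mulVec fun i => (c i : ℤ)) * B ^ s) * X =
                (Int.castRingHom (ZMod p)).mapMatrix (A ^ s) ∧
            X * (Int.castRingHom (ZMod p)).mapMatrix
              (A ^ s * unvec (K.mulVec fun i => (c i : ℤ)) * B ^ s) =
                (Int.castRingHom (ZMod p)).mapMatrix (B ^ s) := by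
  obtain ⟨Z, hZ⟩ := intToPadic_twoSided_eq hs hA hB
  obtain ⟨C, hC, hz, X, hX, hX'⟩ := (rowSpaceCondition_iff_exists_integer hs hA hB).1 h
  obtain ⟨G, hG, hGb⟩ := exists_bounded_annihilator twoSidedIdempotent_mul_self
    (twoSidedIdempotent_commute s) hZ hw
  -- The algorithm finds `K` by a search, so only the two matrix equations may be used; together
  -- they say that `K` maps into the kernel of `G` and fixes it.
  refine ⟨G, by simpa using hGb, fun K K' q hq hGK hKG => ?_⟩
  set W := twoSided (A ^ s) (B ^ s) with hWdef
  have hfix : ∀ v, G.mulVec v = 0 → K.mulVec v = v := fun v hv => by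
    have h1 := congrArg (fun Y => Y.mulVec v) hKG
    simp only [← Matrix.mulVec_mulVec, hv, Matrix.mulVec_zero, Matrix.smul_mulVec,
      Matrix.sub_mulVec, Matrix.one_mulVec] at h1
    have := (smul_eq_zero.1 h1.symm).resolve_left hq
    exact (sub_eq_zero.1 this).symm
  have hGK' : ∀ u, G.mulVec (K.mulVec u) = 0 := fun u => by
    rw [Matrix.mulVec_mulVec, hGK, Matrix.zero_mulVec]
  have hΦK : ∀ u, (twoSidedIdempotent p A B).mulVec
      (fun i => ((K.mulVec u) i : ℤ_[p])) = 0 := fun u => (hG _).1 (hGK' u)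
  refine ⟨?_, fun i j => ?_, ?_⟩
  · refine Matrix.ext_of_mulVec_single fun j => ?_
    rw [← Matrix.mulVec_mulVec, ← Matrix.mulVec_mulVec]
    refine hfix _ ((hG _).2 ?_)
    rw [intToPadic_mulVec, Matrix.mulVec_mulVec, ← twoSidedIdempotent_commute s,
      ← Matrix.mulVec_mulVec, hΦK, Matrix.mulVec_zero]
  · apply intCast_dvd_of_padicInt_dvd
    have h2 : (W * K) i j = W.mulVec (K.mulVec (Pi.single j 1)) i := by
      rw [Matrix.mulVec_mulVec, Matrix.mulVec_single_one]
      rfl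
    have h3 := congrFun (intToPadic_mulVec (p := p) W (K.mulVec (Pi.single j 1))) i
    rw [hZ, Matrix.add_mulVec, hΦK, zero_add, Matrix.smul_mulVec] at h3
    rw [h2, h3]
    exact ⟨_, rfl⟩
  · have hCv : unvec (fun q : Fin n × Fin n => C q.1 q.2) = C := rfl
    have hKC : K.mulVec (fun q : Fin n × Fin n => C q.1 q.2) = fun q => C q.1 q.2 := by
      refine hfix _ ((hG _).2 ?_)
      rw [twoSidedIdempotent_mulVec_eq_zero_iff, hCv, hz]
    let T : (Fin n × Fin n → ℤ) →ₗ[ℤ] Matrix (Fin n) (Fin n) ℤ :=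
      { toFun := fun v => unvec (K.mulVec v)
        map_add' := fun u v => by rw [Matrix.mulVec_add]; rfl
        map_smul' := fun a v => by rw [Matrix.mulVec_smul]; rfl }
    -- `C` itself, flattened, is a coordinate vector for `C` since `K` fixes it. Small coordinates
    -- in the same residue class give the same matrix modulo `p`, so `X` can be kept.
    obtain ⟨c, hc, hcd, hdet⟩ := exists_small_det_ne_zero (Fact.out : p.Prime).pos T
      (v := fun q => C q.1 q.2) (by
        change (unvec (K.mulVec _)).det ≠ 0
        rwa [hKC])
    have hred : (Int.castRingHom (ZMod p)).mapMatrix (unvec (K.mulVec fun i => (c i : ℤ))) =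
        (Int.castRingHom (ZMod p)).mapMatrix C := by
      have h4 : C = unvec (K.mulVec fun q : Fin n × Fin n => C q.1 q.2) := by rw [hKC, hCv]
      rw [h4]
      refine Matrix.ext fun i j => ?_
      simp only [unvec, RingHom.mapMatrix_apply, Matrix.map_apply, Matrix.of_apply, Matrix.mulVec,
        dotProduct, map_sum, map_mul]
      refine Finset.sum_congr rfl fun q _ => ?_
      congr 1
      have := (ZMod.intCast_zmod_eq_zero_iff_dvd _ p).2 (hcd q)
      rw [Int.cast_sub, sub_eq_zero] at this
      exact this
    refine ⟨c, hc, hdet, X, ?_, ?_⟩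
    · rw [← hX, map_mul, map_mul, hred, map_mul, map_mul]
    · rw [← hX', map_mul, map_mul, hred, map_mul, map_mul]

end Criterion

/-! ### Matrices as computable arrays -/

section Arrays

variable {σ τ : Type*} [Primcodable σ] [Primcodable τ]

/-- A family of infinite integer arrays that is computable in the parameter and the indices. -/
def ComputableArray (f : σ → ℕ → ℕ → ℤ) : Prop :=
  Computable fun q : σ × ℕ × ℕ => f q.1 q.2.1 q.2.2

/-- The product of arrays, with inner dimension `m`. -/
def arrayMul (m : ℕ) (f g : ℕ → ℕ → ℤ) (i j : ℕ) : ℤ := ∑ k ∈ Finset.range m, f i k * g k j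

/-- The identity array. -/
def arrayOne (i j : ℕ) : ℤ := if i = j then 1 else 0

theorem ComputableArray.app {f : σ → ℕ → ℕ → ℤ} (hf : ComputableArray f) {s : τ → σ} {i j : τ → ℕ}
    (hs : Computable s) (hi : Computable i) (hj : Computable j) :
    Computable fun t => f (s t) (i t) (j t) :=
  Computable.comp (f := fun q : σ × ℕ × ℕ => f q.1 q.2.1 q.2.2) (g := fun t => (s t, i t, j t)) hf
    (hs.pair (hi.pair hj))

theorem ComputableArray.comp {f : σ → ℕ → ℕ → ℤ} (hf : ComputableArray f) {s : τ → σ}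
    (hs : Computable s) : ComputableArray fun t => f (s t) :=
  hf.app (τ := τ × ℕ × ℕ) (hs.comp Computable.fst) (computable_fst_of Computable.snd)
    (computable_snd_of Computable.snd)

theorem ComputableArray.mul {m : σ → ℕ} {f g : σ → ℕ → ℕ → ℤ} (hm : Computable m)
    (hf : ComputableArray f) (hg : ComputableArray g) :
    ComputableArray fun s => arrayMul (m s) (f s) (g s) :=
  computable_sum (σ := σ × ℕ × ℕ) (b := fun q => m q.1)
    (f := fun q k => f q.1 q.2.1 k * g q.1 k q.2.2) (hm.comp Computable.fst)
    (computable_int_mul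
      (hf.app (computable_fst_of Computable.fst)
        (computable_fst_of (computable_snd_of Computable.fst)) Computable.snd)
      (hg.app (computable_fst_of Computable.fst) Computable.snd
        (computable_snd_of (computable_snd_of Computable.fst))))

theorem ComputableArray.sub {f g : σ → ℕ → ℕ → ℤ} (hf : ComputableArray f)
    (hg : ComputableArray g) : ComputableArray fun s i j => f s i j - g s i j :=
  computable_int_sub hf hg

theorem ComputableArray.smul {c : σ → ℤ} {f : σ → ℕ → ℕ → ℤ} (hc : Computable c)
    (hf : ComputableArray f) : ComputableArray fun s i j => c s * f s i j :=
  computable_int_mul (hc.comp Computable.fst) hf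

theorem computable_arrayOne {i j : σ → ℕ} (hi : Computable i) (hj : Computable j) :
    Computable fun s => arrayOne (i s) (j s) :=
  (Computable.cond (Primrec.beq.to_comp.comp hi hj) (Computable.const (1 : ℤ))
    (Computable.const (0 : ℤ))).of_eq fun s => by
      unfold arrayOne
      by_cases h : i s = j s <;> simp [h, Bool.cond_eq_ite]

theorem ComputableArray.one : ComputableArray fun _ : σ => arrayOne :=
  computable_arrayOne (computable_fst_of Computable.snd) (computable_snd_of Computable.snd)

theorem ComputableArray.zero : ComputableArray fun (_ : σ) (_ _ : ℕ) => (0 : ℤ) :=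
  Computable.const (0 : ℤ)

theorem ComputableArray.entry {l : σ → List (List ℤ)} (hl : Computable l) :
    ComputableArray fun s => entry (l s) :=
  computable_entry (hl.comp Computable.fst) (computable_fst_of Computable.snd)
    (computable_snd_of Computable.snd)

theorem computablePred_forall_eq {m : σ → ℕ} {f g : σ → ℕ → ℕ → ℤ} (hm : Computable m)
    (hf : ComputableArray f) (hg : ComputableArray g) :
    ComputablePred fun s => ∀ i < m s, ∀ j < m s, f s i j = g s i j :=
  computablePred_forall_lt (P := fun s i => ∀ j < m s, f s i j = g s i j) hm
    (computablePred_forall_lt (σ := σ × ℕ) (P := fun q j => f q.1 q.2 j = g q.1 q.2 j)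
      (hm.comp Computable.fst)
      (computablePred_int_eq
        (hf.app (computable_fst_of Computable.fst) (computable_snd_of Computable.fst)
          Computable.snd)
        (hg.app (computable_fst_of Computable.fst) (computable_snd_of Computable.fst)
          Computable.snd)))

theorem computablePred_forall_dvd {p m : σ → ℕ} {f g : σ → ℕ → ℕ → ℤ} (hp : Computable p)
    (hm : Computable m) (hf : ComputableArray f) (hg : ComputableArray g) :
    ComputablePred fun s => ∀ i < m s, ∀ j < m s, (p s : ℤ) ∣ f s i j - g s i j :=
  computablePred_forall_lt (P := fun s i => ∀ j < m s, (p s : ℤ) ∣ f s i j - g s i j) hm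
    (computablePred_forall_lt (σ := σ × ℕ)
      (P := fun q j => (p q.1 : ℤ) ∣ f q.1 q.2 j - g q.1 q.2 j) (hm.comp Computable.fst)
      (computablePred_dvd (hp.comp (computable_fst_of Computable.fst)) (computable_int_sub
        (hf.app (computable_fst_of Computable.fst) (computable_snd_of Computable.fst)
          Computable.snd)
        (hg.app (computable_fst_of Computable.fst) (computable_snd_of Computable.fst)
          Computable.snd))))

variable {ι : Type*} {m : ℕ} (e : ι ≃ Fin m)

/-- The square matrix cut out of an array along an enumeration of the index type. -/
def arrayMatrix (f : ℕ → ℕ → ℤ) : Matrix ι ι ℤ := Matrix.of fun i j => f (e i) (e j)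

theorem arrayMatrix_mul [Fintype ι] (f g : ℕ → ℕ → ℤ) :
    arrayMatrix e (arrayMul m f g) = arrayMatrix e f * arrayMatrix e g := by
  refine Matrix.ext fun i j => ?_
  rw [Matrix.mul_apply]
  change ∑ k ∈ Finset.range m, f (e i) k * g k (e j) = ∑ k, f (e i) (e k) * g (e k) (e j)
  rw [Finset.sum_range, e.sum_comp fun k : Fin m => f (e i) k * g k (e j)]

theorem arrayMatrix_one [DecidableEq ι] : arrayMatrix e arrayOne = 1 := by
  refine Matrix.ext fun i j => ?_
  simp [arrayMatrix, arrayOne, Matrix.one_apply, Fin.val_inj]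

theorem forall_eq_iff_arrayMatrix {f g : ℕ → ℕ → ℤ} :
    (∀ i < m, ∀ j < m, f i j = g i j) ↔ arrayMatrix e f = arrayMatrix e g := by
  refine ⟨fun h => Matrix.ext fun i j => h _ (e i).2 _ (e j).2, fun h i hi j hj => ?_⟩
  have := congrFun (congrFun h (e.symm ⟨i, hi⟩)) (e.symm ⟨j, hj⟩)
  simpa [arrayMatrix] using this

theorem forall_dvd_iff_arrayMatrix {p : ℕ} {f g : ℕ → ℕ → ℤ} :
    (∀ i < m, ∀ j < m, (p : ℤ) ∣ f i j - g i j) ↔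
      ∀ i j, (p : ℤ) ∣ (arrayMatrix e f - arrayMatrix e g) i j := by
  refine ⟨fun h i j => h _ (e i).2 _ (e j).2, fun h i hi j hj => ?_⟩
  have := h (e.symm ⟨i, hi⟩) (e.symm ⟨j, hj⟩)
  simpa [arrayMatrix] using this

theorem exists_arrayMatrix_eq (X : Matrix ι ι ℤ) : ∃ f, arrayMatrix e f = X := by
  refine ⟨fun i j => if h : i < m ∧ j < m then X (e.symm ⟨i, h.1⟩) (e.symm ⟨j, h.2⟩) else 0, ?_⟩
  refine Matrix.ext fun i j => ?_
  simp [arrayMatrix]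

theorem exists_arrayMatrix_entry_eq (X : Matrix ι ι ℤ) : ∃ l, arrayMatrix e (entry l) = X := by
  obtain ⟨f, rfl⟩ := exists_arrayMatrix_eq e X
  obtain ⟨l, hl⟩ := exists_entry_eq m m f
  exact ⟨l, (forall_eq_iff_arrayMatrix e).1 hl⟩

theorem arrayMatrix_entry_rows {n : ℕ} (A : Matrix (Fin n) (Fin n) ℤ) :
    arrayMatrix (Equiv.refl (Fin n)) (entry (rows A)) = A :=
  Matrix.ext fun i j => entry_rows A i j

/-- Nonvanishing of the determinant is decidable, since both alternatives have a certificate. -/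
theorem computablePred_det_ne_zero {n : σ → ℕ} {C : σ → ℕ → ℕ → ℤ} (hn : Computable n)
    (hC : ComputableArray C) :
    ComputablePred fun s => (arrayMatrix (Equiv.refl (Fin (n s))) (C s)).det ≠ 0 := by
  refine computablePred_of_certificates (τ := List (List ℤ) × ℤ)
    -- Nonsingularity is certified by a left inverse up to a nonzero scalar, for which the adjugate
    -- serves.
    (R := fun s t => t.2 ≠ 0 ∧ ∀ i < n s, ∀ j < n s,
      arrayMul (n s) (entry t.1) (C s) i j = t.2 * arrayOne i j)
    -- Singularity is certified by a nonzero kernel vector, stored in column `0`.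
    (R' := fun s t => (∃ i < n s, entry t.1 i 0 ≠ 0) ∧
      ∀ i < n s, arrayMul (n s) (C s) (entry t.1) i 0 = 0) ?_ ?_ ?_ ?_ ?_
  · exact computablePred_and
      (computablePred_ne (computable_snd_of Computable.snd) (Computable.const 0))
      (computablePred_forall_eq (hn.comp Computable.fst)
        (ComputableArray.mul (hn.comp Computable.fst)
          (ComputableArray.entry (computable_fst_of Computable.snd)) (hC.comp Computable.fst))
        (ComputableArray.smul (computable_snd_of Computable.snd) ComputableArray.one))
  · refine computablePred_and
      (computablePred_exists_lt (σ := σ × List (List ℤ) × ℤ)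
        (P := fun q i => entry q.2.1 i 0 ≠ 0) (hn.comp Computable.fst)
        (computablePred_ne (computable_entry
          (computable_fst_of (computable_snd_of Computable.fst)) Computable.snd
          (Computable.const 0)) (Computable.const 0)))
      (computablePred_forall_lt (σ := σ × List (List ℤ) × ℤ)
        (P := fun q i => arrayMul (n q.1) (C q.1) (entry q.2.1) i 0 = 0) (hn.comp Computable.fst)
        (computablePred_int_eq ?_ (Computable.const 0)))
    exact ComputableArray.app (σ := σ × List (List ℤ) × ℤ)
      (f := fun q => arrayMul (n q.1) (C q.1) (entry q.2.1))
      (ComputableArray.mul (hn.comp Computable.fst) (hC.comp Computable.fst)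
        (ComputableArray.entry (computable_fst_of Computable.snd)))
      Computable.fst Computable.snd (Computable.const 0)
  · rintro s ⟨l, q⟩ ⟨hq, h⟩ h0
    have h1 : arrayMatrix (Equiv.refl (Fin (n s))) (entry l) *
        arrayMatrix (Equiv.refl (Fin (n s))) (C s) = q • 1 := by
      rw [← arrayMatrix_mul, (forall_eq_iff_arrayMatrix (Equiv.refl (Fin (n s)))).1 h,
        ← arrayMatrix_one (Equiv.refl (Fin (n s)))]
      rfl
    have h2 := congrArg Matrix.det h1
    rw [Matrix.det_mul, h0, mul_zero, Matrix.det_smul, Matrix.det_one, mul_one] at h2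
    exact pow_ne_zero _ hq h2.symm
  · rintro s ⟨l, q⟩ ⟨⟨i, hi, hne⟩, h⟩
    rw [not_not, ← Matrix.exists_mulVec_eq_zero_iff]
    refine ⟨fun j => entry l j 0, fun h0 => hne (congrFun h0 ⟨i, hi⟩), funext fun j => ?_⟩
    have := h j j.2
    rw [arrayMul, Finset.sum_range] at this
    exact this
  · intro s
    by_cases h : (arrayMatrix (Equiv.refl (Fin (n s))) (C s)).det = 0
    · obtain ⟨v, hv, hv'⟩ := Matrix.exists_mulVec_eq_zero_iff.2 h
      obtain ⟨l, hl⟩ := exists_entry_eq (n s) 1 fun i _ => if h : i < n s then v ⟨i, h⟩ else 0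
      have hlv : ∀ i : Fin (n s), entry l i 0 = v i := fun i => by
        rw [hl i i.2 0 one_pos, dif_pos i.2]
      obtain ⟨i, hi⟩ := Function.ne_iff.1 hv
      refine ⟨(l, 0), Or.inr ⟨⟨i, i.2, by rw [hlv]; exact hi⟩, fun j hj => ?_⟩⟩
      rw [arrayMul, Finset.sum_range]
      simp only [hlv]
      exact congrFun hv' ⟨j, hj⟩
    · obtain ⟨l, hl⟩ := exists_arrayMatrix_entry_eq (Equiv.refl (Fin (n s)))
        (arrayMatrix (Equiv.refl (Fin (n s))) (C s)).adjugate
      refine ⟨(l, _), Or.inl ⟨h, (forall_eq_iff_arrayMatrix (Equiv.refl (Fin (n s)))).2 ?_⟩⟩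
      rw [arrayMatrix_mul, hl, Matrix.adjugate_mul, ← arrayMatrix_one (Equiv.refl (Fin (n s)))]
      rfl

end Arrays

/-! ### Computable ingredients of the algorithm -/

section Algorithm

/-- The type of the inputs of the algorithm: two lists of rows and the prime. -/
abbrev Input := List (List ℤ) × List (List ℤ) × ℕ

/-- `Z` lists the powers of the `n × n` array `f` up to exponent `s`, each of them flattened. -/
def IsPowerTable (n s : ℕ) (f : ℕ → ℕ → ℤ) (Z : List (List ℤ)) : Prop :=
  (∀ i < n, ∀ j < n, entry Z 0 (j + n * i) = arrayOne i j) ∧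
    ∀ k < s, ∀ i < n, ∀ j < n, entry Z (k + 1) (j + n * i) =
      arrayMul n (fun i j => entry Z k (j + n * i)) f i j

/-- The array number `k` in a list of flattened `n × n` arrays. -/
def tableArray (n k : ℕ) (Z : List (List ℤ)) (i j : ℕ) : ℤ := entry Z k (j + n * i)

/-- The recursion relating consecutive entries forces the powers. A table can thus be found by
search and checked, and no recursion on matrices has to be shown computable. -/
theorem IsPowerTable.arrayMatrix_eq {n s : ℕ} {f : ℕ → ℕ → ℤ} {Z : List (List ℤ)}
    (h : IsPowerTable n s f Z) {k : ℕ} (hk : k ≤ s) :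
    arrayMatrix (Equiv.refl (Fin n)) (tableArray n k Z) =
      arrayMatrix (Equiv.refl (Fin n)) f ^ k := by
  induction k with
  | zero =>
    rw [pow_zero, ← arrayMatrix_one (Equiv.refl (Fin n))]
    exact (forall_eq_iff_arrayMatrix _).1 h.1
  | succ k ih =>
    rw [pow_succ, ← ih (by omega), ← arrayMatrix_mul]
    exact (forall_eq_iff_arrayMatrix _).1 (h.2 k (by omega))

theorem exists_isPowerTable (n s : ℕ) (f : ℕ → ℕ → ℤ) : ∃ Z, IsPowerTable n s f Z := by
  obtain ⟨Z, hZ⟩ := exists_entry_eq (s + 1) (n * n) fun k m =>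
    Nat.rec arrayOne (fun _ g => arrayMul n g f) k (m / n) (m % n)
  have key : ∀ k < s + 1, ∀ i < n, ∀ j < n, entry Z k (j + n * i) =
      Nat.rec arrayOne (fun _ g => arrayMul n g f) k i j := fun k hk i hi j hj => by
    have h1 : (j + n * i) / n = i := by
      rw [Nat.add_mul_div_left _ _ (by omega), Nat.div_eq_of_lt hj, zero_add]
    have h2 : (j + n * i) % n = j := by rw [Nat.add_mul_mod_self_left, Nat.mod_eq_of_lt hj]
    rw [hZ k hk _ (by nlinarith), h1, h2]
  refine ⟨Z, fun i hi j hj => key 0 (by omega) i hi j hj, fun k hk i hi j hj => ?_⟩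
  rw [key (k + 1) (by omega) i hi j hj]
  refine Finset.sum_congr rfl fun t ht => ?_
  change _ = entry Z k (t + n * i) * f t j
  rw [key k (by omega) i hi t (Finset.mem_range.1 ht)]

variable {σ τ : Type*} [Primcodable σ] [Primcodable τ]

theorem ComputableArray.tableArray {n k : σ → ℕ} {Z : σ → List (List ℤ)} (hn : Computable n)
    (hk : Computable k) (hZ : Computable Z) :
    ComputableArray fun s => tableArray (n s) (k s) (Z s) :=
  computable_entry (hZ.comp Computable.fst) (hk.comp Computable.fst)
    (computable_nat_add (computable_snd_of Computable.snd)
      (computable_nat_mul (hn.comp Computable.fst) (computable_fst_of Computable.snd)))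

theorem computablePred_isPowerTable {n s : σ → ℕ} {f : σ → ℕ → ℕ → ℤ} {Z : σ → List (List ℤ)}
    (hn : Computable n) (hs : Computable s) (hf : ComputableArray f) (hZ : Computable Z) :
    ComputablePred fun t => IsPowerTable (n t) (s t) (f t) (Z t) :=
  computablePred_and
    (computablePred_forall_eq hn (ComputableArray.tableArray hn (Computable.const 0) hZ)
      ComputableArray.one)
    (computablePred_forall_lt (P := fun t k => ∀ i < n t, ∀ j < n t,
      entry (Z t) (k + 1) (j + n t * i) =
        arrayMul (n t) (fun i j => entry (Z t) k (j + n t * i)) (f t) i j) hs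
      (computablePred_forall_eq (hn.comp Computable.fst)
        (ComputableArray.tableArray (hn.comp Computable.fst)
          (Computable.succ.comp Computable.snd) (hZ.comp Computable.fst))
        (ComputableArray.mul (hn.comp Computable.fst)
          (ComputableArray.tableArray (hn.comp Computable.fst) Computable.snd
            (hZ.comp Computable.fst)) (hf.comp Computable.fst))))

/-- A common exponent for which the powers of both input matrices are idempotent modulo `p`,
and the tables of powers, can be computed. -/
theorem exists_computable_idempotent_powers :
    ∃ g : Input → ℕ × List (List ℤ) × List (List ℤ), Computable g ∧ ∀ a : Input,
      IsPowerTable a.1.length ((g a).1 + 1) (entry a.1) (g a).2.1 ∧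
      IsPowerTable a.1.length ((g a).1 + 1) (entry a.2.1) (g a).2.2 ∧
      (a.2.2 = 0 ∨
        ((∀ i < a.1.length, ∀ j < a.1.length, (a.2.2 : ℤ) ∣
          arrayMul a.1.length (tableArray a.1.length ((g a).1 + 1) (g a).2.1)
            (tableArray a.1.length ((g a).1 + 1) (g a).2.1) i j -
            tableArray a.1.length ((g a).1 + 1) (g a).2.1 i j) ∧
        ∀ i < a.1.length, ∀ j < a.1.length, (a.2.2 : ℤ) ∣
          arrayMul a.1.length (tableArray a.1.length ((g a).1 + 1) (g a).2.2)
            (tableArray a.1.length ((g a).1 + 1) (g a).2.2) i j -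
            tableArray a.1.length ((g a).1 + 1) (g a).2.2 i j)) := by
  refine exists_computable_choice (R := fun (a : Input) (t : ℕ × List (List ℤ) × List (List ℤ)) =>
    IsPowerTable a.1.length (t.1 + 1) (entry a.1) t.2.1 ∧
      IsPowerTable a.1.length (t.1 + 1) (entry a.2.1) t.2.2 ∧
      (a.2.2 = 0 ∨
        ((∀ i < a.1.length, ∀ j < a.1.length, (a.2.2 : ℤ) ∣
          arrayMul a.1.length (tableArray a.1.length (t.1 + 1) t.2.1)
            (tableArray a.1.length (t.1 + 1) t.2.1) i j -
            tableArray a.1.length (t.1 + 1) t.2.1 i j) ∧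
        ∀ i < a.1.length, ∀ j < a.1.length, (a.2.2 : ℤ) ∣
          arrayMul a.1.length (tableArray a.1.length (t.1 + 1) t.2.2)
            (tableArray a.1.length (t.1 + 1) t.2.2) i j -
            tableArray a.1.length (t.1 + 1) t.2.2 i j))) ?_ ?_
  · have hn : Computable fun q : Input × ℕ × List (List ℤ) × List (List ℤ) => q.1.1.length :=
      Computable.list_length.comp (computable_fst_of Computable.fst)
    have hp : Computable fun q : Input × ℕ × List (List ℤ) × List (List ℤ) => q.1.2.2 :=
      computable_snd_of (computable_snd_of Computable.fst)
    have hs : Computable fun q : Input × ℕ × List (List ℤ) × List (List ℤ) => q.2.1 + 1 :=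
      Computable.succ.comp (computable_fst_of Computable.snd)
    have hZ : Computable fun q : Input × ℕ × List (List ℤ) × List (List ℤ) => q.2.2.1 :=
      computable_fst_of (computable_snd_of Computable.snd)
    have hY : Computable fun q : Input × ℕ × List (List ℤ) × List (List ℤ) => q.2.2.2 :=
      computable_snd_of (computable_snd_of Computable.snd)
    have hP := ComputableArray.tableArray hn hs hZ
    have hF := ComputableArray.tableArray hn hs hY
    exact computablePred_and
      (computablePred_isPowerTable hn hs
        (ComputableArray.entry (computable_fst_of Computable.fst)) hZ)
      (computablePred_and
        (computablePred_isPowerTable hn hs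
          (ComputableArray.entry (computable_fst_of (computable_snd_of Computable.fst))) hY)
        (computablePred_or (computablePred_nat_eq hp (Computable.const 0))
          (computablePred_and
            (computablePred_forall_dvd hp hn (ComputableArray.mul hn hP hP) hP)
            (computablePred_forall_dvd hp hn (ComputableArray.mul hn hF hF) hF))))
  · rintro ⟨l, l', p⟩
    dsimp only
    set n := l.length
    -- The search must terminate on every input. Modulo a positive number, prime or not, matrices
    -- form a finite monoid; zero is exempted.
    rcases Nat.eq_zero_or_pos p with rfl | hp
    · obtain ⟨Z, hZ⟩ := exists_isPowerTable n 1 (entry l)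
      obtain ⟨Y, hY⟩ := exists_isPowerTable n 1 (entry l')
      exact ⟨(0, Z, Y), hZ, hY, Or.inl rfl⟩
    · have : NeZero p := ⟨hp.ne'⟩
      have hfin : Finite (Matrix (Fin n) (Fin n) (ZMod p)) :=
        inferInstanceAs (Finite (Fin n → Fin n → ZMod p))
      set A := arrayMatrix (Equiv.refl (Fin n)) (entry l) with hA
      set B := arrayMatrix (Equiv.refl (Fin n)) (entry l') with hB
      -- An idempotent power in the product monoid gives one exponent for both matrices. The table
      -- stores `s - 1`, which makes the exponent positive by construction.
      obtain ⟨s, hs, hi⟩ := exists_large_idempotent_pow ((Int.castRingHom (ZMod p)).mapMatrix A,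
        (Int.castRingHom (ZMod p)).mapMatrix B) 1
      obtain ⟨t, rfl⟩ : ∃ t, s = t + 1 := ⟨s - 1, by omega⟩
      obtain ⟨Z, hZ⟩ := exists_isPowerTable n (t + 1) (entry l)
      obtain ⟨Y, hY⟩ := exists_isPowerTable n (t + 1) (entry l')
      refine ⟨(t, Z, Y), hZ, hY, Or.inr ⟨?_, ?_⟩⟩
      · refine (forall_dvd_iff_arrayMatrix (Equiv.refl (Fin n))).2 ?_
        rw [arrayMatrix_mul, hZ.arrayMatrix_eq le_rfl, dvd_sub_iff_map_eq, map_mul, map_pow]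
        exact congrArg Prod.fst hi
      · refine (forall_dvd_iff_arrayMatrix (Equiv.refl (Fin n))).2 ?_
        rw [arrayMatrix_mul, hY.arrayMatrix_eq le_rfl, dvd_sub_iff_map_eq, map_mul, map_pow]
        exact congrArg Prod.snd hi

/-- The array of the operator `C ↦ P C (1 - F)` on flattened arrays. -/
def operatorArray (n : ℕ) (P F : ℕ → ℕ → ℤ) (i j : ℕ) : ℤ :=
  P (i / n) (j / n) * (arrayOne (j % n) (i % n) - F (j % n) (i % n))

theorem ComputableArray.operatorArray {n : σ → ℕ} {P F : σ → ℕ → ℕ → ℤ} (hn : Computable n)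
    (hP : ComputableArray P) (hF : ComputableArray F) :
    ComputableArray fun s => operatorArray (n s) (P s) (F s) := by
  have hn' : Computable fun q : σ × ℕ × ℕ => n q.1 := hn.comp Computable.fst
  have hi : Computable fun q : σ × ℕ × ℕ => q.2.1 := computable_fst_of Computable.snd
  have hj : Computable fun q : σ × ℕ × ℕ => q.2.2 := computable_snd_of Computable.snd
  exact computable_int_mul
    (hP.app Computable.fst (computable_nat_div hi hn') (computable_nat_div hj hn'))
    (computable_int_sub
      (computable_arrayOne (computable_nat_mod hj hn') (computable_nat_mod hi hn'))
      (hF.app Computable.fst (computable_nat_mod hj hn') (computable_nat_mod hi hn')))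

theorem finProdFinEquiv_div {n : ℕ} (q : Fin n × Fin n) :
    (finProdFinEquiv q : ℕ) / n = q.1 ∧ (finProdFinEquiv q : ℕ) % n = q.2 := by
  have hn : 0 < n := q.1.pos
  rw [finProdFinEquiv_apply_val, Nat.add_mul_div_left _ _ hn, Nat.div_eq_of_lt q.2.2,
    Nat.add_mul_mod_self_left, Nat.mod_eq_of_lt q.2.2]
  simp

theorem arrayMatrix_operatorArray (n : ℕ) (P F : ℕ → ℕ → ℤ) :
    arrayMatrix finProdFinEquiv (operatorArray n P F) =
      twoSided (arrayMatrix (Equiv.refl (Fin n)) P) (arrayMatrix (Equiv.refl (Fin n)) F) := by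
  refine Matrix.ext fun i j => ?_
  rw [twoSided, ← arrayMatrix_one (Equiv.refl (Fin n))]
  change operatorArray n P F _ _ = _
  rw [operatorArray, (finProdFinEquiv_div i).1, (finProdFinEquiv_div i).2,
    (finProdFinEquiv_div j).1, (finProdFinEquiv_div j).2]
  rfl

/-- A strict bound for the sum of the absolute values of the entries of an array. -/
def entrySum (m : ℕ) (f : ℕ → ℕ → ℤ) : ℕ :=
  (∑ i ∈ Finset.range m, ∑ j ∈ Finset.range m, ((f i j).natAbs : ℤ)).toNat + 1

theorem computable_entrySum {m : σ → ℕ} {f : σ → ℕ → ℕ → ℤ} (hm : Computable m)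
    (hf : ComputableArray f) : Computable fun s => entrySum (m s) (f s) := by
  refine Computable.succ.comp (computable_toNat (computable_sum
    (f := fun s i => ∑ j ∈ Finset.range (m s), ((f s i j).natAbs : ℤ)) hm
    (computable_sum (σ := σ × ℕ) (b := fun q => m q.1)
      (f := fun q j => ((f q.1 q.2 j).natAbs : ℤ)) (hm.comp Computable.fst)
      (computable_natCast (computable_natAbs ?_)))))
  exact hf.app (computable_fst_of Computable.fst) (computable_snd_of Computable.fst)
    Computable.snd

theorem sum_abs_lt_entrySum {ι : Type*} [Fintype ι] {m : ℕ} (e : ι ≃ Fin m) (f : ℕ → ℕ → ℤ) :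
    ∑ i, ∑ j, |arrayMatrix e f i j| < (entrySum m f : ℤ) := by
  have h1 : ∑ i, ∑ j, |arrayMatrix e f i j| =
      ∑ i ∈ Finset.range m, ∑ j ∈ Finset.range m, ((f i j).natAbs : ℤ) := by
    rw [Finset.sum_range, ← e.sum_comp]
    refine Finset.sum_congr rfl fun i _ => ?_
    rw [Finset.sum_range, ← e.sum_comp]
    refine Finset.sum_congr rfl fun j _ => ?_
    rw [Int.natCast_natAbs]
    rfl
  have h2 := Int.self_le_toNat
    (∑ i ∈ Finset.range m, ∑ j ∈ Finset.range m, ((f i j).natAbs : ℤ))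
  rw [h1, entrySum]
  push_cast
  omega

theorem computable_factorBound {N w : σ → ℕ} (hN : Computable N) (hw : Computable w) :
    Computable fun s => factorBound (N s) (w s) :=
  computable_nat_mul (computable_nat_add hN (Computable.const 1))
    (computable_nat_mul (computable_nat_mul (computable_nat_pow hw hN)
      (computable_nat_pow (Computable.const 2) hN)) (computable_nat_pow hw hN))

/-- The `m × m` array whose entries are the digits of `c` to the base `2 * b + 1`, shifted to the
interval from `-b` to `b`. -/
def digitArray (b m c i j : ℕ) : ℤ := (digit (2 * b + 1) c (j + m * i) : ℤ) - b

theorem ComputableArray.digitArray {b m c : σ → ℕ} (hb : Computable b) (hm : Computable m)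
    (hc : Computable c) : ComputableArray fun s => digitArray (b s) (m s) (c s) :=
  computable_int_sub (computable_natCast (computable_digit
      (computable_nat_add (computable_nat_mul (Computable.const 2) (hb.comp Computable.fst))
        (Computable.const 1)) (hc.comp Computable.fst)
      (computable_nat_add (computable_snd_of Computable.snd)
        (computable_nat_mul (hm.comp Computable.fst) (computable_fst_of Computable.snd)))))
    (computable_natCast (hb.comp Computable.fst))

/-- Allows an exhaustive search over matrices with bounded entries as a bounded quantifier over one
number. -/
theorem exists_arrayMatrix_digit_eq {ι : Type*} {m b : ℕ} (e : ι ≃ Fin m) {X : Matrix ι ι ℕ}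
    (hX : ∀ i j, X i j < b) :
    ∃ c < b ^ (m * m), arrayMatrix e (fun i j => (digit b c (j + m * i) : ℤ)) =
      X.map (Nat.cast : ℕ → ℤ) := by
  have hdm : ∀ t < m * m, t / m < m ∧ t % m < m := fun t ht => by
    have hm : 0 < m := Nat.pos_of_ne_zero (by rintro rfl; omega)
    exact ⟨Nat.div_lt_of_lt_mul ht, Nat.mod_lt _ hm⟩
  obtain ⟨c, hc, hd⟩ := exists_digit_eq b (m * m)
    (fun t => if h : t < m * m then X (e.symm ⟨t / m, (hdm t h).1⟩) (e.symm ⟨t % m, (hdm t h).2⟩)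
      else 0) (fun t ht => by rw [dif_pos ht]; exact hX _ _)
  refine ⟨c, hc, Matrix.ext fun i j => ?_⟩
  have hq := finProdFinEquiv_div (e i, e j)
  have hlt := (finProdFinEquiv (e i, e j)).2
  rw [finProdFinEquiv_apply_val] at hq hlt
  have h1 := hd _ hlt
  rw [dif_pos hlt] at h1
  change ((digit b c (e j + m * e i) : ℕ) : ℤ) = (X i j : ℤ)
  rw [h1]
  simp [hq]

theorem exists_arrayMatrix_digitArray_eq {ι : Type*} {m b : ℕ} (e : ι ≃ Fin m) {G : Matrix ι ι ℤ}
    (hG : ∀ i j, |G i j| ≤ b) :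
    ∃ c < (2 * b + 1) ^ (m * m), arrayMatrix e (digitArray b m c) = G := by
  have hb := fun i j => abs_le.1 (hG i j)
  obtain ⟨c, hc, h⟩ := exists_arrayMatrix_digit_eq (b := 2 * b + 1) e
    (X := Matrix.of fun i j => (G i j + b).toNat) (fun i j => by
      have := hb i j
      simp only [Matrix.of_apply]
      omega)
  refine ⟨c, hc, Matrix.ext fun i j => ?_⟩
  have h1 := congrFun (congrFun h i) j
  have h2 := hb i j
  change ((digit (2 * b + 1) c (e j + m * e i) : ℕ) : ℤ) = ((G i j + b).toNat : ℤ) at h1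
  change ((digit (2 * b + 1) c (e j + m * e i) : ℕ) : ℤ) - b = G i j
  omega

/-- The integral projection onto the kernel of a matrix can be computed. -/
theorem exists_computable_projection_ker {m : σ → ℕ} {G : σ → ℕ → ℕ → ℤ} (hm : Computable m)
    (hG : ComputableArray G) :
    ∃ g : σ → List (List ℤ) × List (List ℤ) × ℤ, Computable g ∧ ∀ s, (g s).2.2 ≠ 0 ∧
      (∀ i < m s, ∀ j < m s, arrayMul (m s) (G s) (entry (g s).1) i j = 0) ∧
      ∀ i < m s, ∀ j < m s, arrayMul (m s) (entry (g s).2.1) (G s) i j =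
        (g s).2.2 * (arrayOne i j - entry (g s).1 i j) := by
  refine exists_computable_choice (R := fun s (t : List (List ℤ) × List (List ℤ) × ℤ) =>
    t.2.2 ≠ 0 ∧ (∀ i < m s, ∀ j < m s, arrayMul (m s) (G s) (entry t.1) i j = 0) ∧
      ∀ i < m s, ∀ j < m s, arrayMul (m s) (entry t.2.1) (G s) i j =
        t.2.2 * (arrayOne i j - entry t.1 i j)) ?_ fun s => ?_
  · have hm' : Computable fun q : σ × List (List ℤ) × List (List ℤ) × ℤ => m q.1 :=
      hm.comp Computable.fst
    have hG' : ComputableArray fun q : σ × List (List ℤ) × List (List ℤ) × ℤ => G q.1 :=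
      hG.comp Computable.fst
    have hK : ComputableArray fun q : σ × List (List ℤ) × List (List ℤ) × ℤ => entry q.2.1 :=
      ComputableArray.entry (computable_fst_of Computable.snd)
    have hK' : ComputableArray fun q : σ × List (List ℤ) × List (List ℤ) × ℤ => entry q.2.2.1 :=
      ComputableArray.entry (computable_fst_of (computable_snd_of Computable.snd))
    have hq : Computable fun q : σ × List (List ℤ) × List (List ℤ) × ℤ => q.2.2.2 :=
      computable_snd_of (computable_snd_of Computable.snd)
    exact computablePred_and (computablePred_ne hq (Computable.const 0))
      (computablePred_and
        (computablePred_forall_eq hm' (ComputableArray.mul hm' hG' hK) ComputableArray.zero)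
        (computablePred_forall_eq hm' (ComputableArray.mul hm' hK' hG')
          (ComputableArray.smul hq (ComputableArray.one.sub hK))))
  · obtain ⟨K, K', q, hq, h1, h2⟩ := exists_projection_ker
      (arrayMatrix (Equiv.refl (Fin (m s))) (G s))
    obtain ⟨l, rfl⟩ := exists_arrayMatrix_entry_eq (Equiv.refl (Fin (m s))) K
    obtain ⟨l', rfl⟩ := exists_arrayMatrix_entry_eq (Equiv.refl (Fin (m s))) K'
    refine ⟨(l, l', q), hq, ?_, ?_⟩
    · refine (forall_eq_iff_arrayMatrix (Equiv.refl (Fin (m s)))).2 ?_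
      rw [arrayMatrix_mul, h1]
      rfl
    · refine (forall_eq_iff_arrayMatrix (Equiv.refl (Fin (m s)))).2 ?_
      rw [arrayMatrix_mul, h2, ← arrayMatrix_one (Equiv.refl (Fin (m s)))]
      rfl

end Algorithm

/-! ### The decision procedure -/

section Decision

/-- The array of the matrix `K c`, where `c` is encoded by its digits to the base `b`. -/
def candidateArray (n b : ℕ) (K : ℕ → ℕ → ℤ) (c i j : ℕ) : ℤ :=
  ∑ m ∈ Finset.range (n * n), K (j + n * i) m * (digit b c m : ℤ)

theorem arrayMatrix_candidateArray (n b : ℕ) (K : ℕ → ℕ → ℤ) (c : ℕ) :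
    arrayMatrix (Equiv.refl (Fin n)) (candidateArray n b K c) =
      unvec ((arrayMatrix finProdFinEquiv K).mulVec
        fun q : Fin n × Fin n => ((digit b c (finProdFinEquiv q) : ℕ) : ℤ)) := by
  refine Matrix.ext fun i j => ?_
  change ∑ m ∈ Finset.range (n * n), K (j + n * i) m * (digit b c m : ℤ) =
    ∑ q : Fin n × Fin n, K (finProdFinEquiv (i, j)) (finProdFinEquiv q) *
      (digit b c (finProdFinEquiv q) : ℤ)
  rw [Finset.sum_range, finProdFinEquiv_apply_val]
  exact (finProdFinEquiv.sum_comp fun m : Fin (n * n) =>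
    K (j + n * i) m * (digit b c m : ℤ)).symm

/-- The array whose entries are the digits of `x` to the base `p`. -/
def residueArray (n p x i j : ℕ) : ℤ := (digit p x (j + n * i) : ℤ)

/-- `C` induces modulo `p` an isomorphism from the image of the idempotent `F` to that of `P`. -/
def InvertibleModulo (n p : ℕ) (P F C : ℕ → ℕ → ℤ) : Prop :=
  ∃ x < p ^ (n * n),
    (∀ i < n, ∀ j < n, (p : ℤ) ∣ arrayMul n (arrayMul n (arrayMul n P C) F)
      (residueArray n p x) i j - P i j) ∧
    ∀ i < n, ∀ j < n, (p : ℤ) ∣ arrayMul n (residueArray n p x)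
      (arrayMul n (arrayMul n P C) F) i j - F i j

theorem invertibleModulo_iff {n p : ℕ} [NeZero p] {P F C : ℕ → ℕ → ℤ}
    {P' F' C' : Matrix (Fin n) (Fin n) ℤ} (hP : arrayMatrix (Equiv.refl (Fin n)) P = P')
    (hF : arrayMatrix (Equiv.refl (Fin n)) F = F') (hC : arrayMatrix (Equiv.refl (Fin n)) C = C') :
    InvertibleModulo n p P F C ↔ ∃ X : Matrix (Fin n) (Fin n) (ZMod p),
      (Int.castRingHom (ZMod p)).mapMatrix (P' * C' * F') * X =
        (Int.castRingHom (ZMod p)).mapMatrix P' ∧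
      X * (Int.castRingHom (ZMod p)).mapMatrix (P' * C' * F') =
        (Int.castRingHom (ZMod p)).mapMatrix F' := by
  have key : ∀ x, ((∀ i < n, ∀ j < n, (p : ℤ) ∣ arrayMul n (arrayMul n (arrayMul n P C) F)
      (residueArray n p x) i j - P i j) ∧
    ∀ i < n, ∀ j < n, (p : ℤ) ∣ arrayMul n (residueArray n p x)
      (arrayMul n (arrayMul n P C) F) i j - F i j) ↔
      (Int.castRingHom (ZMod p)).mapMatrix (P' * C' * F') * (Int.castRingHom (ZMod p)).mapMatrix
        (arrayMatrix (Equiv.refl (Fin n)) (residueArray n p x)) =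
        (Int.castRingHom (ZMod p)).mapMatrix P' ∧
      (Int.castRingHom (ZMod p)).mapMatrix
        (arrayMatrix (Equiv.refl (Fin n)) (residueArray n p x)) *
          (Int.castRingHom (ZMod p)).mapMatrix (P' * C' * F') =
        (Int.castRingHom (ZMod p)).mapMatrix F' := fun x => by
    rw [forall_dvd_iff_arrayMatrix (Equiv.refl (Fin n)),
      forall_dvd_iff_arrayMatrix (Equiv.refl (Fin n)), dvd_sub_iff_map_eq, dvd_sub_iff_map_eq]
    simp only [arrayMatrix_mul, hP, hF, hC, map_mul]
  constructor
  · rintro ⟨x, -, hx⟩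
    exact ⟨_, (key x).1 hx⟩
  · rintro ⟨X, hX⟩
    obtain ⟨x, hx, hxe⟩ := exists_arrayMatrix_digit_eq (b := p) (Equiv.refl (Fin n))
      (X := X.map ZMod.val) fun i j => ZMod.val_lt _
    refine ⟨x, hx, (key x).2 ?_⟩
    have : (Int.castRingHom (ZMod p)).mapMatrix
        (arrayMatrix (Equiv.refl (Fin n)) (residueArray n p x)) = X := by
      change (Int.castRingHom (ZMod p)).mapMatrix (arrayMatrix (Equiv.refl (Fin n))
        fun i j => (digit p x (j + n * i) : ℤ)) = X
      rw [hxe]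
      refine Matrix.ext fun i j => ?_
      simp
    rw [this]
    exact hX

/-- The conditions on an integral projection `K` that certify the row space condition. -/
def IsCertificate (n p : ℕ) (P F K : ℕ → ℕ → ℤ) : Prop :=
  (∀ i < n * n, ∀ j < n * n, arrayMul (n * n) K (arrayMul (n * n) (operatorArray n P F) K) i j =
    arrayMul (n * n) (operatorArray n P F) K i j) ∧
  (∀ i < n * n, ∀ j < n * n, (p : ℤ) ∣ arrayMul (n * n) (operatorArray n P F) K i j - 0) ∧
  ∃ c < (p * (n + 1)) ^ (n * n),
    (arrayMatrix (Equiv.refl (Fin n)) (candidateArray n (p * (n + 1)) K c)).det ≠ 0 ∧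
      InvertibleModulo n p P F (candidateArray n (p * (n + 1)) K c)

section Computability

variable {σ : Type*} [Primcodable σ] {n p : σ → ℕ} {P F K : σ → ℕ → ℕ → ℤ}

theorem ComputableArray.candidateArray {b c : σ → ℕ} (hn : Computable n) (hb : Computable b)
    (hK : ComputableArray K) (hc : Computable c) :
    ComputableArray fun s => candidateArray (n s) (b s) (K s) (c s) :=
  computable_sum (σ := σ × ℕ × ℕ) (b := fun q => n q.1 * n q.1)
    (f := fun q m => K q.1 (q.2.2 + n q.1 * q.2.1) m * (digit (b q.1) (c q.1) m : ℤ))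
    (computable_nat_mul (hn.comp Computable.fst) (hn.comp Computable.fst))
    (computable_int_mul
      (hK.app (computable_fst_of Computable.fst)
        (computable_nat_add (computable_snd_of (computable_snd_of Computable.fst))
          (computable_nat_mul (hn.comp (computable_fst_of Computable.fst))
            (computable_fst_of (computable_snd_of Computable.fst)))) Computable.snd)
      (computable_natCast (computable_digit (hb.comp (computable_fst_of Computable.fst))
        (hc.comp (computable_fst_of Computable.fst)) Computable.snd)))

theorem ComputableArray.residueArray {x : σ → ℕ} (hn : Computable n) (hp : Computable p)
    (hx : Computable x) : ComputableArray fun s => residueArray (n s) (p s) (x s) :=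
  computable_natCast (computable_digit (hp.comp Computable.fst) (hx.comp Computable.fst)
    (computable_nat_add (computable_snd_of Computable.snd)
      (computable_nat_mul (hn.comp Computable.fst) (computable_fst_of Computable.snd))))

theorem computablePred_invertibleModulo {C : σ → ℕ → ℕ → ℤ} (hn : Computable n)
    (hp : Computable p) (hP : ComputableArray P) (hF : ComputableArray F)
    (hC : ComputableArray C) :
    ComputablePred fun s => InvertibleModulo (n s) (p s) (P s) (F s) (C s) := by
  have hn' : Computable fun q : σ × ℕ => n q.1 := hn.comp Computable.fst
  have hp' : Computable fun q : σ × ℕ => p q.1 := hp.comp Computable.fst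
  have hP' : ComputableArray fun q : σ × ℕ => P q.1 := hP.comp Computable.fst
  have hF' : ComputableArray fun q : σ × ℕ => F q.1 := hF.comp Computable.fst
  have hC' : ComputableArray fun q : σ × ℕ => C q.1 := hC.comp Computable.fst
  have hX : ComputableArray fun q : σ × ℕ => residueArray (n q.1) (p q.1) q.2 :=
    ComputableArray.residueArray hn' hp' Computable.snd
  have hPCF := ComputableArray.mul hn' (ComputableArray.mul hn' hP' hC') hF'
  exact computablePred_exists_lt (P := fun s x =>
    (∀ i < n s, ∀ j < n s, (p s : ℤ) ∣
      arrayMul (n s) (arrayMul (n s) (arrayMul (n s) (P s) (C s)) (F s))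
        (residueArray (n s) (p s) x) i j - P s i j) ∧
    ∀ i < n s, ∀ j < n s, (p s : ℤ) ∣ arrayMul (n s) (residueArray (n s) (p s) x)
      (arrayMul (n s) (arrayMul (n s) (P s) (C s)) (F s)) i j - F s i j)
    (computable_nat_pow hp (computable_nat_mul hn hn))
    (computablePred_and
      (computablePred_forall_dvd hp' hn' (ComputableArray.mul hn' hPCF hX) hP')
      (computablePred_forall_dvd hp' hn' (ComputableArray.mul hn' hX hPCF) hF'))

theorem computablePred_isCertificate (hn : Computable n) (hp : Computable p)
    (hP : ComputableArray P) (hF : ComputableArray F) (hK : ComputableArray K) :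
    ComputablePred fun s => IsCertificate (n s) (p s) (P s) (F s) (K s) := by
  have hN := computable_nat_mul hn hn
  have hWK := ComputableArray.mul hN (ComputableArray.operatorArray hn hP hF) hK
  have hb := computable_nat_mul hp (computable_nat_add hn (Computable.const 1))
  have hn' : Computable fun q : σ × ℕ => n q.1 := hn.comp Computable.fst
  have hC : ComputableArray fun q : σ × ℕ =>
      candidateArray (n q.1) (p q.1 * (n q.1 + 1)) (K q.1) q.2 :=
    ComputableArray.candidateArray hn' (hb.comp Computable.fst) (hK.comp Computable.fst)
      Computable.snd
  refine computablePred_and (computablePred_forall_eq hN (ComputableArray.mul hN hK hWK) hWK)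
    (computablePred_and (computablePred_forall_dvd hp hN hWK ComputableArray.zero)
      (computablePred_exists_lt (P := fun s c =>
        (arrayMatrix (Equiv.refl (Fin (n s)))
          (candidateArray (n s) (p s * (n s + 1)) (K s) c)).det ≠ 0 ∧
        InvertibleModulo (n s) (p s) (P s) (F s)
          (candidateArray (n s) (p s * (n s + 1)) (K s) c))
        (computable_nat_pow hb hN)
        (computablePred_and (computablePred_det_ne_zero hn' hC)
          (computablePred_invertibleModulo hn' (hp.comp Computable.fst)
            (hP.comp Computable.fst) (hF.comp Computable.fst) hC))))

end Computability

variable {n p : ℕ} [Fact p.Prime] {A B : Matrix (Fin n) (Fin n) ℤ} {P F : ℕ → ℕ → ℤ} {s : ℕ}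

theorem IsCertificate.rowSpaceCondition {K : ℕ → ℕ → ℤ} (h : IsCertificate n p P F K)
    (hP : arrayMatrix (Equiv.refl (Fin n)) P = A ^ s)
    (hF : arrayMatrix (Equiv.refl (Fin n)) F = B ^ s) (hs : s ≠ 0)
    (hA : ∀ i j, (p : ℤ) ∣ (A ^ s * A ^ s - A ^ s) i j)
    (hB : ∀ i j, (p : ℤ) ∣ (B ^ s * B ^ s - B ^ s) i j) : RowSpaceCondition p A B := by
  have : NeZero p := ⟨(Fact.out : p.Prime).ne_zero⟩
  obtain ⟨h1, h2, c, -, hdet, hinv⟩ := h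
  obtain ⟨X, hX, hX'⟩ := (invertibleModulo_iff hP hF rfl).1 hinv
  have hW := arrayMatrix_operatorArray n P F
  rw [hP, hF] at hW
  rw [arrayMatrix_candidateArray] at hdet hX hX'
  refine rowSpaceCondition_of_certificate hs hA hB (K := arrayMatrix finProdFinEquiv K) ?_
    (fun i j => ?_) hdet hX hX'
  · rw [← hW, ← arrayMatrix_mul, ← arrayMatrix_mul]
    exact (forall_eq_iff_arrayMatrix _).1 h1
  · rw [← hW, ← arrayMatrix_mul, ← sub_zero (arrayMatrix finProdFinEquiv _)]
    exact (forall_dvd_iff_arrayMatrix (g := fun _ _ => 0) finProdFinEquiv).1 h2 i j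

/-- Completeness of the enumeration: the annihilator of bounded size is among the digit arrays
tried, and any projection found for it passes the test. -/
theorem RowSpaceCondition.exists_isCertificate (h : RowSpaceCondition p A B)
    (hP : arrayMatrix (Equiv.refl (Fin n)) P = A ^ s)
    (hF : arrayMatrix (Equiv.refl (Fin n)) F = B ^ s) (hs : s ≠ 0)
    (hA : ∀ i j, (p : ℤ) ∣ (A ^ s * A ^ s - A ^ s) i j)
    (hB : ∀ i j, (p : ℤ) ∣ (B ^ s * B ^ s - B ^ s) i j) {b : ℕ}
    (hb : b = factorBound (n * n) (entrySum (n * n) (operatorArray n P F))) :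
    ∃ g < (2 * b + 1) ^ (n * n * (n * n)), ∀ (K K' : ℕ → ℕ → ℤ) (q : ℤ), q ≠ 0 →
      (∀ i < n * n, ∀ j < n * n, arrayMul (n * n) (digitArray b (n * n) g) K i j = 0) →
      (∀ i < n * n, ∀ j < n * n, arrayMul (n * n) K' (digitArray b (n * n) g) i j =
        q * (arrayOne i j - K i j)) → IsCertificate n p P F K := by
  have : NeZero p := ⟨(Fact.out : p.Prime).ne_zero⟩
  have hW := arrayMatrix_operatorArray n P F
  rw [hP, hF] at hW
  obtain ⟨G, hG, hcert⟩ := h.exists_certificate hs hA hB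
    (w := entrySum (n * n) (operatorArray n P F)) (by
      rw [← hW]
      exact sum_abs_lt_entrySum _ _)
  obtain ⟨g, hg, rfl⟩ := exists_arrayMatrix_digitArray_eq finProdFinEquiv
    (b := b) (G := G) (by rw [hb]; exact_mod_cast hG)
  refine ⟨g, hg, fun K K' q hq hGK hKG => ?_⟩
  obtain ⟨h1, h2, c, hc, hdet, hX⟩ := hcert (arrayMatrix finProdFinEquiv K)
    (arrayMatrix finProdFinEquiv K') q hq (by
      rw [← arrayMatrix_mul]
      exact (forall_eq_iff_arrayMatrix (g := fun _ _ => 0) _).1 hGK) (by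
      rw [← arrayMatrix_mul, ← arrayMatrix_one (finProdFinEquiv (m := n) (n := n))]
      exact (forall_eq_iff_arrayMatrix (g := fun i j => q * (arrayOne i j - K i j)) _).1 hKG)
  rw [← hW, ← arrayMatrix_mul] at h1 h2
  rw [← arrayMatrix_mul] at h1
  obtain ⟨d, hd, hdc⟩ := exists_digit_eq (p * (n + 1)) (n * n)
    (fun t => if h : t < n * n then c (finProdFinEquiv.symm ⟨t, h⟩) else 0) (fun t ht => by
      rw [dif_pos ht]
      exact hc _)
  have hcd : (fun q => (c q : ℤ)) = fun q : Fin n × Fin n =>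
      ((digit (p * (n + 1)) d (finProdFinEquiv q) : ℕ) : ℤ) := funext fun q => by
    rw [hdc _ (finProdFinEquiv q).2, dif_pos (finProdFinEquiv q).2]
    exact congrArg (fun r => (c r : ℤ)) (finProdFinEquiv.symm_apply_apply q).symm
  rw [hcd, ← arrayMatrix_candidateArray] at hdet hX
  refine ⟨(forall_eq_iff_arrayMatrix finProdFinEquiv).2 h1,
    (forall_dvd_iff_arrayMatrix (g := fun _ _ => 0) finProdFinEquiv).2 fun i j => ?_,
    d, hd, hdet, (invertibleModulo_iff hP hF rfl).2 hX⟩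
  have := h2 i j
  rw [← sub_zero (arrayMatrix finProdFinEquiv _)] at this
  exact this

/-- One algorithm decides the row space condition for all inputs. -/
theorem exists_computable_rowSpaceCondition :
    ∃ f : Input → Bool, Computable f ∧
      ∀ (p : ℕ) [Fact p.Prime] (n : ℕ) (A B : Matrix (Fin n) (Fin n) ℤ),
        f (rows A, rows B, p) = true ↔ RowSpaceCondition p A B := by
  obtain ⟨t, ht, htab⟩ := exists_computable_idempotent_powers
  let n : Input → ℕ := fun a => a.1.length
  let P : Input → ℕ → ℕ → ℤ := fun a => tableArray (n a) ((t a).1 + 1) (t a).2.1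
  let F : Input → ℕ → ℕ → ℤ := fun a => tableArray (n a) ((t a).1 + 1) (t a).2.2
  let b : Input → ℕ := fun a =>
    factorBound (n a * n a) (entrySum (n a * n a) (operatorArray (n a) (P a) (F a)))
  have hn : Computable n := Computable.list_length.comp Computable.fst
  have hN : Computable fun a => n a * n a := computable_nat_mul hn hn
  have hs : Computable fun a => (t a).1 + 1 := Computable.succ.comp (computable_fst_of ht)
  have hP : ComputableArray P :=
    ComputableArray.tableArray hn hs (computable_fst_of (computable_snd_of ht))
  have hF : ComputableArray F :=
    ComputableArray.tableArray hn hs (computable_snd_of (computable_snd_of ht))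
  have hb : Computable b := computable_factorBound hN
    (computable_entrySum hN (ComputableArray.operatorArray hn hP hF))
  obtain ⟨k, hk, hker⟩ := exists_computable_projection_ker (σ := Input × ℕ)
    (m := fun q => n q.1 * n q.1) (G := fun q => digitArray (b q.1) (n q.1 * n q.1) q.2)
    (hN.comp Computable.fst)
    (ComputableArray.digitArray (hb.comp Computable.fst) (hN.comp Computable.fst) Computable.snd)
  -- The algorithm: for each code `g` of a matrix within the bound, take the computed projection
  -- onto its kernel and test it.
  obtain ⟨f, hf, hfc⟩ := exists_of_computablePred (computablePred_exists_lt
    (b := fun a => (2 * b a + 1) ^ (n a * n a * (n a * n a)))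
    (P := fun a g => IsCertificate (n a) a.2.2 (P a) (F a) (entry (k (a, g)).1))
    (computable_nat_pow (computable_nat_add (computable_nat_mul (Computable.const 2) hb)
      (Computable.const 1)) (computable_nat_mul hN hN))
    (computablePred_isCertificate (hn.comp Computable.fst)
      (computable_snd_of (computable_snd_of Computable.fst)) (hP.comp Computable.fst)
      (hF.comp Computable.fst) (ComputableArray.entry (computable_fst_of hk))))
  refine ⟨f, hf, fun p _ m A B => (hfc _).trans ?_⟩
  obtain ⟨hZ, hY, h0⟩ := htab (rows A, rows B, p)
  set a : Input := (rows A, rows B, p) with ha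
  have hna : a.1.length = m := by simp [ha, rows]
  have hna' : n a = m := hna
  have hp0 : a.2.2 ≠ 0 := (Fact.out : p.Prime).ne_zero
  obtain ⟨hA, hB⟩ := h0.resolve_left hp0
  rw [hna] at hZ hY hA hB
  have hPA : arrayMatrix (Equiv.refl (Fin m)) (P a) = A ^ ((t a).1 + 1) := by
    have := hZ.arrayMatrix_eq le_rfl
    rw [arrayMatrix_entry_rows] at this
    simpa only [P, hna'] using this
  have hFB : arrayMatrix (Equiv.refl (Fin m)) (F a) = B ^ ((t a).1 + 1) := by
    have := hY.arrayMatrix_eq le_rfl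
    rw [arrayMatrix_entry_rows] at this
    simpa only [F, hna'] using this
  have hA' := (forall_dvd_iff_arrayMatrix (Equiv.refl (Fin m))).1 hA
  have hB' := (forall_dvd_iff_arrayMatrix (Equiv.refl (Fin m))).1 hB
  have hPA' : tableArray m ((t a).1 + 1) (t a).2.1 = P a := by simp only [P, hna']
  have hFB' : tableArray m ((t a).1 + 1) (t a).2.2 = F a := by simp only [F, hna']
  rw [arrayMatrix_mul, hPA', hPA] at hA'
  rw [arrayMatrix_mul, hFB', hFB] at hB'
  rw [hna']
  constructor
  -- Soundness ignores the origin of the projection, so the correct annihilator need not be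
  -- recognized.
  · rintro ⟨g, -, hg⟩
    exact hg.rowSpaceCondition hPA hFB (Nat.succ_ne_zero _) hA' hB'
  · intro h
    obtain ⟨g, hg, hcert⟩ := h.exists_isCertificate hPA hFB (Nat.succ_ne_zero _) hA' hB'
      (b := b a) (by simp only [b, hna'])
    obtain ⟨h1, h2, h3⟩ := hker (a, g)
    simp only [hna'] at h2 h3
    exact ⟨g, hg, hcert _ _ _ h1 h2 h3⟩

end Decision

/-! ### Linear algebra over a field -/

section LinearAlgebra

/-- Two linear maps with the same range, from spaces of the same finite dimension, differ by an
isomorphism of these spaces. -/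
theorem exists_linearEquiv_of_range_eq {K V V' X : Type*} [Field K] [AddCommGroup V] [Module K V]
    [AddCommGroup V'] [Module K V'] [AddCommGroup X] [Module K X] [FiniteDimensional K V]
    [FiniteDimensional K V'] (f : V →ₗ[K] X) (g : V' →ₗ[K] X)
    (h : LinearMap.range f = LinearMap.range g)
    (hd : Module.finrank K V = Module.finrank K V') : ∃ e : V ≃ₗ[K] V', ∀ v, g (e v) = f v := by
  -- Complements of the kernels are matched through the common range, and the kernels have equal
  -- dimension by rank-nullity.
  obtain ⟨C, hC⟩ := (LinearMap.ker f).exists_isCompl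
  obtain ⟨C', hC'⟩ := (LinearMap.ker g).exists_isCompl
  have hf := f.finrank_range_add_finrank_ker
  have hg := g.finrank_range_add_finrank_ker
  have hr : Module.finrank K (LinearMap.range f) = Module.finrank K (LinearMap.range g) := by rw [h]
  let e₀ := LinearEquiv.ofFinrankEq (R := K) (LinearMap.ker f) (LinearMap.ker g) (by omega)
  let e₁ := (f.kerComplementEquivRange hC.symm).trans
    ((LinearEquiv.ofEq _ _ h).trans (g.kerComplementEquivRange hC'.symm).symm)
  refine ⟨(Submodule.prodEquivOfIsCompl _ _ hC).symm.trans
    ((e₀.prodCongr e₁).trans (Submodule.prodEquivOfIsCompl _ _ hC')), fun v => ?_⟩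
  obtain ⟨⟨x, y⟩, rfl⟩ := (Submodule.prodEquivOfIsCompl _ _ hC).surjective v
  have hx : f x = 0 := x.2
  have hx' : g (e₀ x) = 0 := (e₀ x).2
  have hy : g (e₁ y) = f y := by
    have h1 := g.kerComplementEquivRange hC'.symm |>.apply_symm_apply
      (LinearEquiv.ofEq _ _ h (f.kerComplementEquivRange hC.symm y))
    exact congrArg Subtype.val h1
  rw [LinearEquiv.trans_apply, LinearEquiv.symm_apply_apply]
  simp only [LinearEquiv.trans_apply, LinearEquiv.prodCongr_apply,
    Submodule.coe_prodEquivOfIsCompl', map_add, hx, hx', hy]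

open Polynomial in
/-- A Drazin inverse: `A * S` is the projection onto the eventual range of `A` along the eventual
kernel. -/
theorem exists_drazin_inverse {K : Type*} [Field K] {n : ℕ} (A : Matrix (Fin n) (Fin n) K) :
    ∃ S T : Matrix (Fin n) (Fin n) K, A * S = S * A ∧ S = A ^ n * T ∧ A * S * A ^ n = A ^ n := by
  obtain ⟨q, hq, hX⟩ := exists_eq_pow_rootMultiplicity_mul_and_not_dvd A.charpoly
    A.charpoly_monic.ne_zero 0
  rw [map_zero, sub_zero] at hq hX
  set k := rootMultiplicity 0 A.charpoly
  have hk : k ≤ n := by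
    have h1 := A.charpoly_natDegree_eq_dim
    have h2 : k ≤ A.charpoly.natDegree := by
      rw [← natDegree_X_pow (R := K) k]
      exact natDegree_le_of_dvd ⟨q, hq⟩ A.charpoly_monic.ne_zero
    rwa [h1, Fintype.card_fin] at h2
  -- From `a Xⁿ⁺¹ + b q = 1` take `S = Aⁿ a(A)`; then `A S = 1 - b(A) q(A)`, and `Aⁿ q(A) = 0` since
  -- `k ≤ n`.
  obtain ⟨a, b, hab⟩ := ((irreducible_X.coprime_iff_not_dvd).2 hX).pow_left (m := n + 1)
  have h0 : A ^ n * aeval A q = 0 := by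
    have h1 := A.aeval_self_charpoly
    rw [hq, map_mul, map_pow, aeval_X] at h1
    have h2 : A ^ n = A ^ (n - k) * A ^ k := by rw [← pow_add, Nat.sub_add_cancel hk]
    rw [h2, Matrix.mul_assoc, h1, Matrix.mul_zero]
  have h1 := congrArg (aeval A) hab
  rw [map_add, map_mul, map_mul, map_pow, aeval_X, map_one] at h1
  have hc : ∀ P Q : K[X], aeval A P * aeval A Q = aeval A Q * aeval A P := fun P Q => by
    rw [← map_mul, ← map_mul, mul_comm]
  have hA : ∀ P : K[X], ∀ m, aeval A P * A ^ m = A ^ m * aeval A P := fun P m => by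
    have := hc P (X ^ m)
    rwa [map_pow, aeval_X] at this
  refine ⟨A ^ n * aeval A a, aeval A a, ?_, rfl, ?_⟩
  · rw [← hA, ← Matrix.mul_assoc]
    have := hA a 1
    rw [pow_one] at this
    rw [← this, Matrix.mul_assoc, Matrix.mul_assoc, ← pow_succ, ← pow_succ']
  · have h2 : A * (A ^ n * aeval A a) = 1 - aeval A b * aeval A q := by
      rw [← Matrix.mul_assoc, ← pow_succ', ← hA, ← h1, add_sub_cancel_right]
    rw [h2, Matrix.sub_mul, Matrix.one_mul, Matrix.mul_assoc, hA, h0, Matrix.mul_zero, sub_zero]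

end LinearAlgebra

/-! ### Vectors over `ℤ_p`, `ℚ` and `ℚ_p` -/

section Vectors

variable {p : ℕ} [Fact p.Prime] {ι κ : Type*}

/-- A vector over `ℤ_p`, regarded as a vector over `ℚ_p`. -/
noncomputable def padicVec (w : ι → ℤ_[p]) : ι → ℚ_[p] := fun i => w i

/-- A rational vector, regarded as a vector over `ℚ_p`. -/
noncomputable def ratVec (p : ℕ) [Fact p.Prime] (x : ι → ℚ) : ι → ℚ_[p] := fun i => x i

theorem padicMap_mulVec [Fintype κ] (X : Matrix ι κ ℤ_[p]) (w : κ → ℤ_[p]) :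
    (padicMap X).mulVec (padicVec w) = padicVec (X.mulVec w) :=
  funext fun i => (RingHom.map_mulVec PadicInt.Coe.ringHom X w i).symm

theorem ratPadic_mulVec [Fintype κ] (X : Matrix ι κ ℚ) (x : κ → ℚ) :
    (ratPadic p X).mulVec (ratVec p x) = ratVec p (X.mulVec x) :=
  funext fun i => (RingHom.map_mulVec (Rat.castHom ℚ_[p]) X x i).symm

theorem padicVec_injective : Function.Injective (padicVec (p := p) (ι := ι)) :=
  fun _ _ h => funext fun i => PadicInt.ext (congrFun h i)

theorem padicVec_add (v w : ι → ℤ_[p]) : padicVec (v + w) = padicVec v + padicVec w :=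
  funext fun _ => PadicInt.coe_add _ _

theorem padicVec_smul (c : ℤ_[p]) (w : ι → ℤ_[p]) :
    padicVec (c • w) = (c : ℚ_[p]) • padicVec w :=
  funext fun _ => PadicInt.coe_mul _ _

theorem exists_padicVec_smul_eq [Finite ι] (x : ι → ℚ_[p]) :
    ∃ (t : ℕ) (w : ι → ℤ_[p]), (p : ℚ_[p]) ^ t • x = padicVec w := by
  obtain ⟨t, ht⟩ := exists_pow_smul_integral x
  exact ⟨t, fun i => ⟨_, ht i⟩, rfl⟩

/-- Rational vectors are dense. -/
theorem exists_ratVec_add_padicVec_eq (x : ι → ℚ_[p]) :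
    ∃ (y : ι → ℚ) (w : ι → ℤ_[p]), x = ratVec p y + padicVec w := by
  choose y hy using fun i => Padic.rat_dense p (x i) one_pos
  exact ⟨y, fun i => ⟨x i - y i, (hy i).le⟩,
    funext fun i => (add_sub_cancel (y i : ℚ_[p]) (x i)).symm⟩

/-- A rational system of linear equations that is solvable over `ℚ_p` is solvable over `ℚ`. -/
theorem exists_mulVec_eq_of_ratPadic [Fintype κ] {X : Matrix ι κ ℚ} {b : ι → ℚ} {u : κ → ℚ_[p]}
    (h : (ratPadic p X).mulVec u = ratVec p b) : ∃ x, X.mulVec x = b := by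
  -- A `ℚ`-linear retraction `ℚ_p → ℚ`, applied to each coordinate, turns a `p`-adic solution into a
  -- rational one.
  obtain ⟨π, hπ⟩ := LinearMap.exists_leftInverse_of_injective (Algebra.linearMap ℚ ℚ_[p])
    (LinearMap.ker_eq_bot.2 (algebraMap ℚ ℚ_[p]).injective)
  have hπ1 : ∀ q : ℚ, π q = q := fun q => by
    have := LinearMap.congr_fun hπ q
    simpa using this
  refine ⟨fun j => π (u j), funext fun i => ?_⟩
  have h1 := congrArg π (congrFun h i)
  change π (∑ j, (X i j : ℚ_[p]) * u j) = π (b i : ℚ_[p]) at h1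
  rw [hπ1, map_sum] at h1
  rw [← h1]
  refine Finset.sum_congr rfl fun j _ => ?_
  have : (X i j : ℚ_[p]) * u j = X i j • u j := by
    rw [Algebra.smul_def]
    rfl
  rw [this, map_smul, smul_eq_mul]

end Vectors

/-! ### Embedding the localized dimension group in `ℚ_pⁿ` -/

section Tensor

variable (p : ℕ) [Fact p.Prime] {n : ℕ}

/-- The multiplication map `ℚ_p ⊗ ℚⁿ → ℚ_pⁿ`. -/
noncomputable def tensorRatToPadic (n : ℕ) :
    ℚ_[p] ⊗[ℤ] (Fin n → ℚ) →ₗ[ℤ] (Fin n → ℚ_[p]) :=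
  TensorProduct.lift (LinearMap.mk₂ ℤ (fun (y : ℚ_[p]) (q : Fin n → ℚ) => y • ratVec p q)
    (fun x y q => add_smul x y _) (fun c y q => smul_assoc c y _)
    (fun y q q' => by ext i; simp [ratVec, mul_add])
    (fun c y q => by ext i; simp [ratVec]; ring))

theorem tensorRatToPadic_tmul (y : ℚ_[p]) (q : Fin n → ℚ) :
    tensorRatToPadic p n (y ⊗ₜ[ℤ] q) = y • ratVec p q :=
  rfl

/-- Denominators can be moved across the tensor sign, so every tensor is a combination of unit
vectors with coefficients in `ℚ_p`, and these coefficients are its image. -/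
theorem tensorRatToPadic_injective : Function.Injective (tensorRatToPadic p n) := by
  have single : ∀ (y : ℚ_[p]) (i : Fin n) (q : ℚ), y ⊗ₜ[ℤ] (Pi.single i q : Fin n → ℚ) =
      (y * q) ⊗ₜ[ℤ] (Pi.single i 1 : Fin n → ℚ) := fun y i q => by
    have hd : (q.den : ℚ_[p]) ≠ 0 := Nat.cast_ne_zero.2 q.den_nz
    have h1 : y = (q.den : ℤ) • (y / q.den) := by
      rw [zsmul_eq_mul, Int.cast_natCast, mul_div_cancel₀ _ hd]
    have h2 : (q.den : ℤ) • (Pi.single i q : Fin n → ℚ) = q.num • Pi.single i 1 := by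
      rw [← Pi.single_smul, ← Pi.single_smul, zsmul_eq_mul, zsmul_eq_mul, Int.cast_natCast,
        Rat.den_mul_eq_num, mul_one]
    conv_lhs => rw [h1, TensorProduct.smul_tmul, h2, ← TensorProduct.smul_tmul]
    congr 1
    rw [zsmul_eq_mul, ← mul_div_assoc, mul_comm, mul_div_assoc]
    congr 1
    rw [div_eq_iff hd]
    exact_mod_cast (Rat.mul_den_eq_num q).symm
  have normal : ∀ x : ℚ_[p] ⊗[ℤ] (Fin n → ℚ), ∃ y : Fin n → ℚ_[p],
      x = ∑ i, y i ⊗ₜ[ℤ] (Pi.single i 1 : Fin n → ℚ) := fun x => by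
    induction x using TensorProduct.induction_on with
    | zero => exact ⟨0, by simp⟩
    | tmul y q =>
      refine ⟨fun i => y * q i, ?_⟩
      rw [← Finset.univ_sum_single q, TensorProduct.tmul_sum]
      exact Finset.sum_congr rfl fun i _ => by rw [single]; simp
    | add x y hx hy =>
      obtain ⟨a, rfl⟩ := hx
      obtain ⟨b, rfl⟩ := hy
      refine ⟨a + b, ?_⟩
      simp only [Pi.add_apply, TensorProduct.add_tmul, Finset.sum_add_distrib]
  rw [injective_iff_map_eq_zero]
  intro x hx
  obtain ⟨y, rfl⟩ := normal x
  have : tensorRatToPadic p n (∑ i, y i ⊗ₜ[ℤ] (Pi.single i 1 : Fin n → ℚ)) = y := by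
    rw [map_sum]
    ext j
    simp [tensorRatToPadic_tmul, ratVec, Pi.single_apply, apply_ite (Rat.cast : ℚ → ℚ_[p])]
  rw [this] at hx
  simp [hx]

/-- The map factors through `ℚ_p ⊗ ℚⁿ`, and enlarging either tensor factor is injective by flatness
over `ℤ`. -/
theorem tensorToPadic_injective (A : Matrix (Fin n) (Fin n) ℤ) :
    Function.Injective (tensorToPadic p A) := by
  let c : ℤ_[p] →ₗ[ℤ] ℚ_[p] := (Algebra.linearMap ℤ_[p] ℚ_[p]).restrictScalars ℤ
  have h : (tensorToPadic p A).restrictScalars ℤ = tensorRatToPadic p n ∘ₗ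
      (dimensionGroup A).subtype.lTensor ℚ_[p] ∘ₗ c.rTensor (dimensionGroup A) := by
    refine TensorProduct.ext' fun z g => ?_
    change tensorToPadic p A (z ⊗ₜ[ℤ] g) = (z : ℚ_[p]) • ratVec p (g : Fin n → ℚ)
    rw [tensorToPadic, LinearMap.liftBaseChange_tmul]
    rfl
  have h' : Function.Injective ((tensorToPadic p A).restrictScalars ℤ) := by
    rw [h]
    exact (tensorRatToPadic_injective p).comp
      ((Module.Flat.lTensor_preserves_injective_linearMap _ Subtype.val_injective).comp
        (Module.Flat.rTensor_preserves_injective_linearMap _ Subtype.val_injective))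
  exact h'

end Tensor

/-! ### The localized dimension group in coordinates -/

section LocalGroup

variable {n r : ℕ} {p : ℕ} [Fact p.Prime] {A : Matrix (Fin n) (Fin n) ℤ}
  {M : Matrix (Fin r) (Fin n) ℤ_[p]} {L : Matrix (Fin n) (Fin r) ℤ_[p]}
  {S : Matrix (Fin n) (Fin n) ℚ}

theorem exists_mul_mul_pow_eq (hLM : L * M = eventualIdempotent p A) (hML : M * L = 1) (k : ℕ) :
    ∃ Q : Matrix (Fin r) (Fin r) ℤ_[p], Q * (M * intToPadic p A ^ k) = M := by
  obtain ⟨Q, hQ⟩ := ((isUnit_of_factorization hLM hML).pow k).exists_left_inv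
  exact ⟨Q, by rw [mul_intToPadic_of_factorization hLM hML, ← Matrix.mul_assoc, hQ,
    Matrix.one_mul]⟩

theorem padicMap_intToPadic_pow (k : ℕ) :
    padicMap (intToPadic p A ^ k) = ratPadic p (ratMatrix A ^ k) := by
  rw [← map_pow, padicMap_intToPadic_ratMatrix, ratMatrix_pow]

variable (A M L S) in
/-- `M` is a matrix of basis rows of the eventual row space of `A` with right inverse `L`, and `S`
is the Drazin inverse of `A`. -/
structure IsLocalFrame : Prop where
  mul_left : L * M = eventualIdempotent p A
  mul_right : M * L = 1
  drazin_comm : ratMatrix A * S = S * ratMatrix A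
  exists_eq : ∃ T, S = ratMatrix A ^ n * T
  drazin_pow : ratMatrix A * S * ratMatrix A ^ n = ratMatrix A ^ n

theorem IsRowBasis.exists_isLocalFrame (hM : IsRowBasis M (eventualRowSpace p A)) :
    ∃ L S, IsLocalFrame A M L S := by
  obtain ⟨L, hLM, hML⟩ := hM.exists_factorization
  obtain ⟨S, T, hc, hT, hn⟩ := exists_drazin_inverse (ratMatrix A)
  exact ⟨L, S, hLM, hML, hc, ⟨T, hT⟩, hn⟩

/-- The projection onto the eventual range does not change the coordinates given by basis rows. -/
theorem IsLocalFrame.mul_projection (h : IsLocalFrame A M L S) :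
    padicMap M * ratPadic p (ratMatrix A * S) = padicMap M := by
  obtain ⟨hLM, hML, hc, -, hn⟩ := h
  obtain ⟨Q, hQ⟩ := exists_mul_mul_pow_eq hLM hML n
  have h1 : ratMatrix A ^ n * (ratMatrix A * S) = ratMatrix A ^ n := by
    have : Commute (ratMatrix A) (ratMatrix A * S) :=
      (Commute.refl _).mul_right hc
    rw [(this.pow_left n).eq, hn]
  have h2 : padicMap M = padicMap Q * (padicMap M * ratPadic p (ratMatrix A ^ n)) := by
    rw [← padicMap_intToPadic_pow, ← padicMap_mul, ← padicMap_mul, hQ]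
  conv_lhs => rw [h2, Matrix.mul_assoc, Matrix.mul_assoc, ← ratPadic_mul, h1]
  exact h2.symm

theorem IsLocalFrame.projection_mul_self (h : IsLocalFrame A M L S) :
    ratMatrix A * S * (ratMatrix A * S) = ratMatrix A * S := by
  obtain ⟨-, -, hc, ⟨T, hT⟩, hn⟩ := h
  have h1 : ratMatrix A * S * S = S := by
    conv_lhs => rw [hT, ← Matrix.mul_assoc, ← hT, hn]
    exact hT.symm
  rw [Matrix.mul_assoc, ← Matrix.mul_assoc S, ← hc, h1]

theorem tensorToPadic_tmul (z : ℤ_[p]) (g : dimensionGroup A) :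
    tensorToPadic p A (z ⊗ₜ[ℤ] g) = (z : ℚ_[p]) • ratVec p (g : Fin n → ℚ) := by
  rw [tensorToPadic, LinearMap.liftBaseChange_tmul]
  rfl

theorem padicMap_mulVec_padicVec_eq_smul {v : Fin n → ℚ_[p]} {w : Fin r → ℤ_[p]} (c : ℤ_[p])
    (h : (padicMap M).mulVec v = padicVec w) :
    (padicMap M).mulVec ((c : ℚ_[p]) • v) = padicVec (c • w) := by
  rw [Matrix.mulVec_smul, h, padicVec_smul]

/-- If `Aᵏ g` is integral, so is `M g`, because `M = Q M Aᵏ` with `Q` integral. Conversely, up to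
vectors that clearly belong to the group, `v` is rational by density; a rational `g` in the eventual
range with `M g` integral has `E g = L M g` integral, and `E` is close to a power of `A`. -/
theorem IsLocalFrame.mem_range_iff (h : IsLocalFrame A M L S) {v : Fin n → ℚ_[p]} :
    v ∈ LinearMap.range (tensorToPadic p A) ↔
      (ratPadic p (ratMatrix A * S)).mulVec v = v ∧
        ∃ w : Fin r → ℤ_[p], (padicMap M).mulVec v = padicVec w := by
  obtain ⟨hLM, hML, hc, ⟨T, hT⟩, hn⟩ := h
  constructor
  · rintro ⟨x, rfl⟩
    induction x using TensorProduct.induction_on with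
    | zero => exact ⟨by simp, 0, by rw [map_zero, Matrix.mulVec_zero]; exact funext fun _ => rfl⟩
    | tmul z g =>
      rw [tensorToPadic_tmul]
      obtain ⟨⟨x, hx⟩, k, m, hm⟩ := g.2
      obtain ⟨Q, hQ⟩ := exists_mul_mul_pow_eq hLM hML k
      refine ⟨?_, _, padicMap_mulVec_padicVec_eq_smul (w := (Q * M).mulVec fun i => (m i : ℤ_[p]))
        z ?_⟩
      · rw [Matrix.mulVec_smul, ratPadic_mulVec, hx, Matrix.mulVec_mulVec, hn]
      · have h1 : ratVec p (fun i => (m i : ℚ)) = padicVec fun i => (m i : ℤ_[p]) := by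
          ext i
          simp [ratVec, padicVec]
        conv_lhs => rw [← hQ, ← Matrix.mul_assoc, padicMap_mul, padicMap_intToPadic_pow,
          ← Matrix.mulVec_mulVec, ratPadic_mulVec, hm, h1, padicMap_mulVec]
    | add x y hx hy =>
      obtain ⟨hx, v, hv⟩ := hx
      obtain ⟨hy, w, hw⟩ := hy
      exact ⟨by rw [map_add, Matrix.mulVec_add, hx, hy], v + w, by
        rw [map_add, Matrix.mulVec_add, hv, hw, padicVec_add]⟩
  · rintro ⟨hv, w, hw⟩
    have hS : ratMatrix A * S = ratMatrix A ^ n * (ratMatrix A * T) := by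
      rw [hT, ← Matrix.mul_assoc, ← Matrix.mul_assoc, ← pow_succ', pow_succ]
    rw [hS, ratPadic_mul, ← Matrix.mulVec_mulVec] at hv
    -- The approximation is made before applying `Aⁿ`, so that the rational part `Aⁿ y` stays in the
    -- eventual range and the error is an integral combination of the columns of `Aⁿ`.
    obtain ⟨y, u, hu⟩ := exists_ratVec_add_padicVec_eq
      ((ratPadic p (ratMatrix A * T)).mulVec v)
    rw [hu, Matrix.mulVec_add, ratPadic_mulVec] at hv
    have hcol : (ratPadic p (ratMatrix A ^ n)).mulVec (padicVec u) ∈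
        LinearMap.range (tensorToPadic p A) := by
      have hg : ∀ j, (ratMatrix A ^ n).mulVec (Pi.single j 1) ∈ dimensionGroup A := fun j =>
        ⟨⟨_, rfl⟩, 0, (A ^ n).mulVec (Pi.single j 1), by
          rw [pow_zero, Matrix.one_mulVec, ← ratMatrix_pow]
          ext i
          simp [ratMatrix]⟩
      refine ⟨∑ j, u j ⊗ₜ[ℤ] ⟨_, hg j⟩, ?_⟩
      rw [map_sum]
      simp only [tensorToPadic_tmul]
      ext i
      simp [ratVec, padicVec, Matrix.mulVec, dotProduct, mul_comm]
    rw [← hv]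
    refine Submodule.add_mem _ ?_ hcol
    set g := (ratMatrix A ^ n).mulVec y with hg
    obtain ⟨w', hw'⟩ : ∃ w' : Fin r → ℤ_[p], (padicMap M).mulVec (ratVec p g) = padicVec w' := by
      refine ⟨w - (M * intToPadic p A ^ n).mulVec u, ?_⟩
      have h1 : padicVec (w - (M * intToPadic p A ^ n).mulVec u) =
          padicVec w - padicVec ((M * intToPadic p A ^ n).mulVec u) :=
        funext fun _ => PadicInt.coe_sub _ _
      rw [h1, ← hw, ← hv, ← padicMap_mulVec, padicMap_mul, padicMap_intToPadic_pow,
        Matrix.mulVec_add, ← Matrix.mulVec_mulVec, add_sub_cancel_right]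
    obtain ⟨t, z, hz⟩ := exists_padicVec_smul_eq (ratVec p g)
    obtain ⟨e, -, -, Z, hZ⟩ := exists_eventualIdempotent_eq (p := p) A t 0
    have hint : (ratPadic p (ratMatrix A ^ e)).mulVec (ratVec p g) =
        padicVec (L.mulVec w' - Z.mulVec z) := by
      have h1 : padicVec (L.mulVec w' - Z.mulVec z) =
          padicVec (L.mulVec w') - padicVec (Z.mulVec z) := funext fun _ => PadicInt.coe_sub _ _
      have h2 := congrArg (fun X => X.mulVec (ratVec p g)) (congrArg padicMap hZ)
      simp only [padicMap_add, padicMap_smul, Matrix.add_mulVec, Matrix.smul_mulVec] at h2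
      rw [padicMap_eventualIdempotent_mul hLM, ← Matrix.mulVec_mulVec, hw', padicMap_mulVec,
        map_pow, padicMap_intToPadic_pow, ← Matrix.mulVec_smul] at h2
      push_cast at h2
      rw [hz, padicMap_mulVec] at h2
      rw [h1, h2, add_sub_cancel_right]
    rw [ratPadic_mulVec] at hint
    -- `Aᵉ g` is only `p`-adically integral, so `N g` lies in the dimension group for some `N` prime
    -- to `p`; this `N` is inverted in `ℤ_p`.
    obtain ⟨N, m, hN, hm⟩ := exists_isUnit_natCast_smul (ι := Fin n) (κ := Unit)
      (X := Matrix.of fun i _ => (ratMatrix A ^ e).mulVec g i)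
      (Y := Matrix.of fun i _ => (L.mulVec w' - Z.mulVec z) i)
      (Matrix.ext fun i _ => congrFun hint i)
    have hgN : (N : ℤ) • g ∈ dimensionGroup A := by
      refine ⟨⟨(N : ℤ) • y, by rw [Matrix.mulVec_smul]⟩, e, fun i => m i (), ?_⟩
      rw [Matrix.mulVec_smul]
      ext i
      have := congrFun (congrFun hm i) ()
      simpa using this
    obtain ⟨c, hcN⟩ := hN.exists_left_inv
    refine ⟨c ⊗ₜ[ℤ] ⟨_, hgN⟩, ?_⟩
    rw [tensorToPadic_tmul]
    ext i
    have h3 : (c : ℚ_[p]) * N = 1 := by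
      have := congrArg ((↑) : ℤ_[p] → ℚ_[p]) hcN
      push_cast at this
      exact this
    have h4 : ((N : ℤ) • g) i = N * g i := by simp
    change (c : ℚ_[p]) * ((((N : ℤ) • g) i : ℚ) : ℚ_[p]) = g i
    rw [h4, Rat.cast_mul, Rat.cast_natCast, ← mul_assoc, h3, one_mul]

end LocalGroup

/-! ### From a strong local isomorphism to intertwined bases -/

section Forward

variable {n r r' : ℕ} {p : ℕ} [Fact p.Prime] {A B : Matrix (Fin n) (Fin n) ℤ}
  {M : Matrix (Fin r) (Fin n) ℤ_[p]} {L : Matrix (Fin n) (Fin r) ℤ_[p]}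
  {M' : Matrix (Fin r') (Fin n) ℤ_[p]} {L' : Matrix (Fin n) (Fin r') ℤ_[p]}
  {S S' : Matrix (Fin n) (Fin n) ℚ}

theorem padicInt_coe_pow (k : ℕ) : (((p : ℤ_[p]) ^ k : ℤ_[p]) : ℚ_[p]) = (p : ℚ_[p]) ^ k := by
  push_cast
  rfl

theorem padic_pow_ne_zero (k : ℕ) : (p : ℚ_[p]) ^ k ≠ 0 :=
  pow_ne_zero _ (Nat.cast_ne_zero.2 (Fact.out : p.Prime).ne_zero)

theorem eq_zero_of_padicVec_eq_smul {w : Fin r → ℤ_[p]}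
    (h : ∀ k : ℕ, ∃ u : Fin r → ℤ_[p], padicVec w = (p : ℚ_[p]) ^ k • padicVec u) : w = 0 := by
  refine padicInt_funext_of_forall_dvd fun k => ?_
  obtain ⟨u, hu⟩ := h k
  exact ⟨u, padicVec_injective (by rw [hu, padicVec_smul, padicInt_coe_pow])⟩

/-- The vectors killed by the coordinates are infinitely divisible in the local group. -/
theorem IsLocalFrame.inv_smul_mem (h : IsLocalFrame A M L S) {v : Fin n → ℚ_[p]}
    (hv : v ∈ LinearMap.range (tensorToPadic p A)) (h0 : (padicMap M).mulVec v = 0) (k : ℕ) :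
    ((p : ℚ_[p]) ^ k)⁻¹ • v ∈ LinearMap.range (tensorToPadic p A) := by
  rw [h.mem_range_iff] at hv ⊢
  exact ⟨by rw [Matrix.mulVec_smul, hv.1], 0, by
    rw [Matrix.mulVec_smul, h0, smul_zero]; exact funext fun _ => rfl⟩

theorem IsLocalFrame.section_mem (h : IsLocalFrame A M L S) (w : Fin r → ℤ_[p]) :
    ∃ v ∈ LinearMap.range (tensorToPadic p A), (padicMap M).mulVec v = padicVec w := by
  have h1 : (padicMap M).mulVec
      ((ratPadic p (ratMatrix A * S)).mulVec (padicVec (L.mulVec w))) = padicVec w := by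
    rw [Matrix.mulVec_mulVec, h.mul_projection, padicMap_mulVec, Matrix.mulVec_mulVec, h.mul_right,
      Matrix.one_mulVec]
  exact ⟨_, h.mem_range_iff.2 ⟨by rw [Matrix.mulVec_mulVec, ← ratPadic_mul,
    h.projection_mul_self], w, h1⟩, h1⟩

/-- The kernel of the coordinates is the divisible part of the local group. An isomorphism preserves
it and induces `D` on the quotients by it, which the coordinates identify with `ℤ_pʳ` and `ℤ_pʳ'`.
-/
theorem StronglyLocallyIsomorphic.exists_bijective (hAB : StronglyLocallyIsomorphic p A B)
    (h : IsLocalFrame A M L S) (h' : IsLocalFrame B M' L' S') :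
    ∃ (J : Matrix (Fin n) (Fin n) ℤ) (D : Matrix (Fin r') (Fin r) ℤ_[p]),
      Function.Bijective D.mulVec ∧
      padicMap M' * ratPadic p (ratMatrix J * (ratMatrix A * S)) = padicMap D * padicMap M ∧
      ∀ y : Fin n → ℚ, ∃ x, (ratMatrix J * (ratMatrix A * S)).mulVec x =
        (ratMatrix B * S').mulVec y := by
  obtain ⟨J, e, he⟩ := hAB
  have hJ : J.map (Int.cast : ℤ → ℚ_[p]) = ratPadic p (ratMatrix J) :=
    Matrix.ext fun i j => (Rat.cast_intCast (J i j)).symm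
  rw [hJ] at he
  set Jp := ratPadic p (ratMatrix J) with hJp
  have hmap : ∀ v ∈ LinearMap.range (tensorToPadic p A),
      Jp.mulVec v ∈ LinearMap.range (tensorToPadic p B) := by
    rintro _ ⟨x, rfl⟩
    exact ⟨e x, he x⟩
  have hsurj : ∀ y ∈ LinearMap.range (tensorToPadic p B),
      ∃ v ∈ LinearMap.range (tensorToPadic p A), Jp.mulVec v = y := by
    rintro _ ⟨y, rfl⟩
    exact ⟨_, ⟨e.symm y, rfl⟩, by rw [← he, e.apply_symm_apply]⟩
  have hinj : ∀ v ∈ LinearMap.range (tensorToPadic p A), Jp.mulVec v = 0 → v = 0 := by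
    rintro _ ⟨x, rfl⟩ hx
    rw [← he] at hx
    have := tensorToPadic_injective p B (hx.trans (map_zero _).symm)
    rw [e.map_eq_zero_iff.1 this, map_zero]
  -- All `p⁻ᵏ v` lie in the group, hence so do their images, whose coordinates are integral; so the
  -- coordinates of the image of `v` are divisible by every `pᵏ`.
  have hker : ∀ v ∈ LinearMap.range (tensorToPadic p A), (padicMap M).mulVec v = 0 →
      (padicMap M').mulVec (Jp.mulVec v) = 0 := fun v hv h0 => by
    obtain ⟨w, hw⟩ := (h'.mem_range_iff.1 (hmap v hv)).2
    rw [hw, eq_zero_of_padicVec_eq_smul (w := w) fun k => ?_]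
    · exact funext fun _ => rfl
    · obtain ⟨u, hu⟩ := (h'.mem_range_iff.1 (hmap _ (h.inv_smul_mem hv h0 k))).2
      exact ⟨u, by rw [← hu, Matrix.mulVec_smul, Matrix.mulVec_smul, smul_inv_smul₀
        (padic_pow_ne_zero k), hw]⟩
  choose s hs hs' using fun i : Fin r => h.section_mem (Pi.single i 1)
  choose d hd using fun i => (h'.mem_range_iff.1 (hmap _ (hs i))).2
  let D : Matrix (Fin r') (Fin r) ℤ_[p] := Matrix.of fun j i => d i j
  have hD : ∀ v ∈ LinearMap.range (tensorToPadic p A), ∀ w, (padicMap M).mulVec v = padicVec w →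
      (padicMap M').mulVec (Jp.mulVec v) = padicVec (D.mulVec w) := fun v hv w hw => by
    have hsum : ∑ i, w i • s i ∈ LinearMap.range (tensorToPadic p A) :=
      Submodule.sum_mem _ fun i _ => Submodule.smul_mem _ _ (hs i)
    have hsmul : ∀ i, w i • s i = (w i : ℚ_[p]) • s i := fun i => rfl
    have hMs : (padicMap M).mulVec (∑ i, w i • s i) = padicVec w := by
      simp only [hsmul, Matrix.mulVec_sum, Matrix.mulVec_smul, hs']
      ext j
      simp only [padicVec, Finset.sum_apply, Pi.smul_apply, smul_eq_mul]
      refine (Finset.sum_eq_single j (fun i _ hi => ?_) (by simp)).trans (by simp)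
      rw [Pi.single_eq_of_ne hi.symm, PadicInt.coe_zero, mul_zero]
    have hMd : (padicMap M').mulVec (Jp.mulVec (∑ i, w i • s i)) = padicVec (D.mulVec w) := by
      simp only [hsmul, Matrix.mulVec_sum, Matrix.mulVec_smul, hd]
      ext j
      simp [padicVec, D, Matrix.mulVec, dotProduct, mul_comm]
    have := hker _ (Submodule.sub_mem _ hv hsum) (by rw [Matrix.mulVec_sub, hw, hMs, sub_self])
    rw [Matrix.mulVec_sub, Matrix.mulVec_sub, sub_eq_zero] at this
    rw [this, hMd]
  -- The local group spans the `p`-adic eventual range, which makes the relation on the group an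
  -- identity of matrices.
  have hscale : ∀ u : Fin n → ℚ_[p], ∃ t : ℕ, (p : ℚ_[p]) ^ t •
      (ratPadic p (ratMatrix A * S)).mulVec u ∈ LinearMap.range (tensorToPadic p A) := fun u => by
    obtain ⟨t, w, hw⟩ := exists_padicVec_smul_eq ((padicMap M).mulVec u)
    refine ⟨t, h.mem_range_iff.2 ⟨?_, w, ?_⟩⟩
    · rw [Matrix.mulVec_smul, Matrix.mulVec_mulVec, ← ratPadic_mul, h.projection_mul_self]
    · rw [Matrix.mulVec_smul, Matrix.mulVec_mulVec, h.mul_projection, hw]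
  refine ⟨J, D, ⟨?_, fun w => ?_⟩, ?_, fun y => ?_⟩
  · have : Function.Injective D.mulVecLin := by
      rw [injective_iff_map_eq_zero]
      intro w hw
      obtain ⟨v, hv, hvw⟩ := h.section_mem w
      have hy : (padicMap M').mulVec (Jp.mulVec v) = 0 := by
        rw [hD v hv w hvw]
        rw [Matrix.mulVecLin_apply] at hw
        rw [hw]
        exact funext fun _ => rfl
      -- If `D w = 0`, the image of `v` is infinitely divisible in the target; pulling the quotients
      -- back makes `v`, and with it `w`, infinitely divisible.
      refine eq_zero_of_padicVec_eq_smul fun k => ?_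
      obtain ⟨v', hv', he'⟩ := hsurj _ (h'.inv_smul_mem (hmap v hv) hy k)
      have hvv : v = (p : ℚ_[p]) ^ k • v' := by
        have h1 : (p : ℚ_[p]) ^ k • v' = ((p : ℤ_[p]) ^ k) • v' := by
          rw [← padicInt_coe_pow]
          rfl
        refine sub_eq_zero.1 (hinj _ (Submodule.sub_mem _ hv ?_) ?_)
        · rw [h1]
          exact Submodule.smul_mem _ _ hv'
        · rw [Matrix.mulVec_sub, Matrix.mulVec_smul, he', smul_inv_smul₀ (padic_pow_ne_zero k),
            sub_self]
      obtain ⟨u, hu⟩ := (h.mem_range_iff.1 hv').2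
      exact ⟨u, by rw [← hvw, hvv, Matrix.mulVec_smul, hu]⟩
    exact this
  · obtain ⟨y, hy, hyw⟩ := h'.section_mem w
    obtain ⟨v, hv, rfl⟩ := hsurj y hy
    obtain ⟨u, hu⟩ := (h.mem_range_iff.1 hv).2
    exact ⟨u, padicVec_injective (by rw [← hD v hv u hu, hyw])⟩
  · refine Matrix.ext_of_mulVec_single fun j => ?_
    obtain ⟨t, ht⟩ := hscale (Pi.single j 1)
    obtain ⟨w, hw⟩ := (h.mem_range_iff.1 ht).2
    have h1 := hD _ ht w hw
    rw [← padicMap_mulVec, ← hw] at h1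
    simp only [Matrix.mulVec_smul] at h1
    have h2 := smul_right_injective _ (padic_pow_ne_zero t) h1
    rw [Matrix.mulVec_mulVec _ (padicMap M), h.mul_projection] at h2
    rw [← Matrix.mulVec_mulVec, ← Matrix.mulVec_mulVec, ← h2, ratPadic_mul,
      ← Matrix.mulVec_mulVec]
  · obtain ⟨t, w, hw⟩ := exists_padicVec_smul_eq ((padicMap M').mulVec (ratVec p y))
    have hmem : (p : ℚ_[p]) ^ t • (ratPadic p (ratMatrix B * S')).mulVec (ratVec p y) ∈
        LinearMap.range (tensorToPadic p B) := by
      refine h'.mem_range_iff.2 ⟨?_, w, ?_⟩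
      · rw [Matrix.mulVec_smul, Matrix.mulVec_mulVec, ← ratPadic_mul, h'.projection_mul_self]
      · rw [Matrix.mulVec_smul, Matrix.mulVec_mulVec, h'.mul_projection, hw]
    obtain ⟨v, hv, hJv⟩ := hsurj _ hmem
    -- Surjectivity gives a `p`-adic solution of a rational linear system, and it descends to `ℚ`.
    refine exists_mulVec_eq_of_ratPadic (p := p) (u := ((p : ℚ_[p]) ^ t)⁻¹ • v) ?_
    rw [ratPadic_mul, ← Matrix.mulVec_mulVec, Matrix.mulVec_smul, (h.mem_range_iff.1 hv).1,
      Matrix.mulVec_smul, hJv, inv_smul_smul₀ (padic_pow_ne_zero t), ratPadic_mulVec]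

/-- The `ℚ`-linear map `x ↦ X x` given by a matrix over `ℚ_p`. -/
noncomputable def ratMulVec (X : Matrix (Fin r) (Fin n) ℚ_[p]) :
    (Fin n → ℚ) →ₗ[ℚ] (Fin r → ℚ_[p]) where
  toFun x := X.mulVec (ratVec p x)
  map_add' x y := by
    have : ratVec p (x + y) = ratVec p x + ratVec p y := by
      ext i
      simp [ratVec]
    rw [this, Matrix.mulVec_add]
  map_smul' c x := by
    have : ratVec p (c • x) = (c : ℚ_[p]) • ratVec p x := by
      ext i
      simp [ratVec]
    rw [this, Matrix.mulVec_smul]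
    rfl

theorem eq_of_forall_ratVec {X Y : Matrix (Fin r) (Fin n) ℚ_[p]}
    (h : ∀ x, X.mulVec (ratVec p x) = Y.mulVec (ratVec p x)) : X = Y := by
  refine Matrix.ext_of_mulVec_single fun j => ?_
  have : ratVec p (Pi.single j 1 : Fin n → ℚ) = Pi.single j 1 := by
    ext i
    simp [ratVec, Pi.single_apply, apply_ite (Rat.cast : ℚ → ℚ_[p])]
  rw [← this, h]

/-- The matrix `C` need not come from the isomorphism of the groups: two `ℚ`-linear maps on `ℚⁿ`
with the same range differ by an automorphism of `ℚⁿ`. -/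
theorem intertwined_of_ratMulVec_range_eq {M M' : Matrix (Fin r) (Fin n) ℤ_[p]}
    (D : GL (Fin r) ℤ_[p])
    (h : LinearMap.range (ratMulVec (padicMap D.1 * padicMap M')) =
      LinearMap.range (ratMulVec (padicMap M))) : Intertwined M M' := by
  obtain ⟨e, he⟩ := exists_linearEquiv_of_range_eq _ _ h rfl
  refine ⟨⟨LinearMap.toMatrix' e.toLinearMap, LinearMap.toMatrix' e.symm.toLinearMap, ?_, ?_⟩, D,
    eq_of_forall_ratVec fun x => ?_⟩
  · rw [← LinearMap.toMatrix'_comp, LinearEquiv.comp_symm, LinearMap.toMatrix'_id]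
  · rw [← LinearMap.toMatrix'_comp, LinearEquiv.symm_comp, LinearMap.toMatrix'_id]
  · refine Eq.trans ?_ (he x)
    change (padicMap M * ratPadic p (LinearMap.toMatrix' e.toLinearMap)).mulVec _ = _
    rw [← Matrix.mulVec_mulVec, ratPadic_mulVec, LinearMap.toMatrix'_mulVec]
    rfl

theorem StronglyLocallyIsomorphic.rank_eq (hAB : StronglyLocallyIsomorphic p A B)
    (hM : IsRowBasis M (eventualRowSpace p A)) (hM' : IsRowBasis M' (eventualRowSpace p B)) :
    r = r' := by
  obtain ⟨L, S, h⟩ := hM.exists_isLocalFrame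
  obtain ⟨L', S', h'⟩ := hM'.exists_isLocalFrame
  obtain ⟨J, D, hD, -, -⟩ := hAB.exists_bijective h h'
  have := (LinearEquiv.ofBijective D.mulVecLin hD).finrank_eq
  simpa using this

theorem StronglyLocallyIsomorphic.intertwined {M M' : Matrix (Fin r) (Fin n) ℤ_[p]}
    (hAB : StronglyLocallyIsomorphic p A B) (hM : IsRowBasis M (eventualRowSpace p A))
    (hM' : IsRowBasis M' (eventualRowSpace p B)) : Intertwined M M' := by
  obtain ⟨L, S, h⟩ := hM.exists_isLocalFrame
  obtain ⟨L', S', h'⟩ := hM'.exists_isLocalFrame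
  obtain ⟨J, D, hD, hJ, hs⟩ := hAB.exists_bijective h h'
  obtain ⟨D, rfl⟩ := Matrix.mulVec_surjective_iff_isUnit.1 hD.2
  have hDD : padicMap (D⁻¹).1 * padicMap D.1 = 1 := by
    rw [← padicMap_mul, ← Units.val_mul, inv_mul_cancel, Units.val_one, padicMap_one]
  refine intertwined_of_ratMulVec_range_eq D⁻¹ (le_antisymm ?_ ?_)
  · rintro _ ⟨y, rfl⟩
    obtain ⟨x, hx⟩ := hs y
    refine ⟨x, ?_⟩
    change (padicMap M).mulVec _ = (padicMap (D⁻¹).1 * padicMap M').mulVec _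
    rw [← h'.mul_projection, ← Matrix.mulVec_mulVec, ← Matrix.mulVec_mulVec, ratPadic_mulVec, ← hx,
      ← ratPadic_mulVec, Matrix.mulVec_mulVec _ (padicMap M'), hJ, Matrix.mulVec_mulVec,
      ← Matrix.mul_assoc, hDD, Matrix.one_mul]
  · rintro _ ⟨x, rfl⟩
    refine ⟨(ratMatrix J * (ratMatrix A * S)).mulVec x, ?_⟩
    change (padicMap (D⁻¹).1 * padicMap M').mulVec _ = (padicMap M).mulVec _
    rw [← ratPadic_mulVec, Matrix.mulVec_mulVec, Matrix.mul_assoc, hJ, ← Matrix.mul_assoc, hDD,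
      Matrix.one_mul]

end Forward

/-! ### From intertwined bases to a strong local isomorphism -/

section Backward

variable {n r : ℕ} {p : ℕ} [Fact p.Prime] {A B : Matrix (Fin n) (Fin n) ℤ}
  {M M' : Matrix (Fin r) (Fin n) ℤ_[p]} {L L' : Matrix (Fin n) (Fin r) ℤ_[p]}
  {S S' : Matrix (Fin n) (Fin n) ℚ}

theorem stronglyLocallyIsomorphic_of_inverse {J : Matrix (Fin n) (Fin n) ℤ}
    {R : Matrix (Fin n) (Fin n) ℚ}
    (hJ : ∀ v ∈ LinearMap.range (tensorToPadic p A),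
      (ratPadic p (ratMatrix J)).mulVec v ∈ LinearMap.range (tensorToPadic p B) ∧
      (ratPadic p R).mulVec ((ratPadic p (ratMatrix J)).mulVec v) = v)
    (hR : ∀ v ∈ LinearMap.range (tensorToPadic p B),
      (ratPadic p R).mulVec v ∈ LinearMap.range (tensorToPadic p A) ∧
      (ratPadic p (ratMatrix J)).mulVec ((ratPadic p R).mulVec v) = v) :
    StronglyLocallyIsomorphic p A B := by
  let m : LinearMap.range (tensorToPadic p A) ≃ₗ[ℤ_[p]] LinearMap.range (tensorToPadic p B) :=
    LinearEquiv.ofLinearMap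
      (((ratPadic p (ratMatrix J)).mulVecLin.restrictScalars ℤ_[p]).restrict
        fun v hv => (hJ v hv).1)
      (((ratPadic p R).mulVecLin.restrictScalars ℤ_[p]).restrict fun v hv => (hR v hv).1)
      (LinearMap.ext fun v => Subtype.ext (hR v v.2).2)
      (LinearMap.ext fun v => Subtype.ext (hJ v v.2).2)
  let a := LinearEquiv.ofInjective (tensorToPadic p A) (tensorToPadic_injective p A)
  let b := LinearEquiv.ofInjective (tensorToPadic p B) (tensorToPadic_injective p B)
  refine ⟨J, a.trans (m.trans b.symm), fun x => ?_⟩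
  have h1 : tensorToPadic p B (b.symm (m (a x))) = (m (a x) : Fin n → ℚ_[p]) :=
    congrArg Subtype.val (b.apply_symm_apply (m (a x)))
  have hJp : J.map (Int.cast : ℤ → ℚ_[p]) = ratPadic p (ratMatrix J) :=
    Matrix.ext fun i j => (Rat.cast_intCast (J i j)).symm
  rw [hJp]
  exact h1

/-- Coordinates with the same rational range, on the images of idempotents of the same rank, are
exchanged by mutually inverse rational matrices. -/
theorem exists_transfer {P P' : Matrix (Fin n) (Fin n) ℚ} (hP : P * P = P) (hP' : P' * P' = P')
    (hrank : P.rank = P'.rank) {X X' : Matrix (Fin r) (Fin n) ℚ_[p]}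
    (hX : X * ratPadic p P = X) (hX' : X' * ratPadic p P' = X')
    (h : LinearMap.range (ratMulVec X) = LinearMap.range (ratMulVec X')) :
    ∃ Φ Φ' : Matrix (Fin n) (Fin n) ℚ, Φ' * Φ = P ∧ Φ * Φ' = P' ∧ P' * Φ = Φ ∧ P * Φ' = Φ' ∧
      X' * ratPadic p Φ = X := by
  -- Coordinates invariant under the idempotent take all their rational values on its image, so the
  -- two restrictions have equal range and spaces of equal dimension as sources.
  have key : ∀ {Q : Matrix (Fin n) (Fin n) ℚ} {Y : Matrix (Fin r) (Fin n) ℚ_[p]},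
      Y * ratPadic p Q = Y →
      LinearMap.range (ratMulVec Y ∘ₗ (LinearMap.range Q.mulVecLin).subtype) =
        LinearMap.range (ratMulVec Y) := fun {Q Y} hY => by
    refine le_antisymm (LinearMap.range_comp_le_range _ _) ?_
    rintro _ ⟨x, rfl⟩
    refine ⟨⟨_, x, rfl⟩, ?_⟩
    change Y.mulVec (ratVec p (Q.mulVec x)) = Y.mulVec (ratVec p x)
    rw [← ratPadic_mulVec, Matrix.mulVec_mulVec, hY]
  obtain ⟨φ, hφ⟩ := exists_linearEquiv_of_range_eq
    (ratMulVec X ∘ₗ (LinearMap.range P.mulVecLin).subtype)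
    (ratMulVec X' ∘ₗ (LinearMap.range P'.mulVecLin).subtype) (by rw [key hX, key hX', h]) hrank
  let π : (Fin n → ℚ) →ₗ[ℚ] LinearMap.range P.mulVecLin := P.mulVecLin.rangeRestrict
  let π' : (Fin n → ℚ) →ₗ[ℚ] LinearMap.range P'.mulVecLin := P'.mulVecLin.rangeRestrict
  have hπ : ∀ w : LinearMap.range P.mulVecLin, π w = w := by
    rintro ⟨_, x, rfl⟩
    refine Subtype.ext ?_
    change P.mulVec (P.mulVec x) = P.mulVec x
    rw [Matrix.mulVec_mulVec, hP]
  have hπ' : ∀ w : LinearMap.range P'.mulVecLin, π' w = w := by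
    rintro ⟨_, x, rfl⟩
    refine Subtype.ext ?_
    change P'.mulVec (P'.mulVec x) = P'.mulVec x
    rw [Matrix.mulVec_mulVec, hP']
  let Φ := LinearMap.toMatrix' ((LinearMap.range P'.mulVecLin).subtype ∘ₗ φ.toLinearMap ∘ₗ π)
  let Φ' := LinearMap.toMatrix' ((LinearMap.range P.mulVecLin).subtype ∘ₗ φ.symm.toLinearMap ∘ₗ π')
  have hΦ : ∀ x, Φ.mulVec x = φ (π x) := fun x => LinearMap.toMatrix'_mulVec _ _
  have hΦ' : ∀ x, Φ'.mulVec x = φ.symm (π' x) := fun x => LinearMap.toMatrix'_mulVec _ _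
  refine ⟨Φ, Φ', ?_, ?_, ?_, ?_, eq_of_forall_ratVec fun x => ?_⟩
  · refine Matrix.ext_of_mulVec_single fun j => ?_
    rw [← Matrix.mulVec_mulVec, hΦ, hΦ', hπ', φ.symm_apply_apply]
    rfl
  · refine Matrix.ext_of_mulVec_single fun j => ?_
    rw [← Matrix.mulVec_mulVec, hΦ', hΦ, hπ, φ.apply_symm_apply]
    rfl
  · refine Matrix.ext_of_mulVec_single fun j => ?_
    rw [← Matrix.mulVec_mulVec, hΦ]
    exact congrArg Subtype.val (hπ' _)
  · refine Matrix.ext_of_mulVec_single fun j => ?_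
    rw [← Matrix.mulVec_mulVec, hΦ']
    exact congrArg Subtype.val (hπ _)
  · rw [← Matrix.mulVec_mulVec, ratPadic_mulVec, hΦ]
    refine (hφ (π x)).trans ?_
    change X.mulVec (ratVec p (P.mulVec x)) = _
    rw [← ratPadic_mulVec, Matrix.mulVec_mulVec, hX]

theorem IsLocalFrame.rank_eq (h : IsLocalFrame A M L S) :
    (ratMatrix A * S).rank = (ratMatrix A ^ n).rank := by
  obtain ⟨T, hT⟩ := h.exists_eq
  refine le_antisymm ?_ ?_
  · have : ratMatrix A * S = ratMatrix A ^ n * (ratMatrix A * T) := by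
      rw [hT, ← Matrix.mul_assoc, ← Matrix.mul_assoc, ← pow_succ', pow_succ]
    rw [this]
    exact Matrix.rank_mul_le_left _ _
  · conv_lhs => rw [← h.drazin_pow]
    exact Matrix.rank_mul_le_left _ _

theorem IsLocalFrame.drazin_pow_mul (h : IsLocalFrame A M L S) {X : Matrix (Fin n) (Fin n) ℚ}
    (hX : ratMatrix A * S * X = X) (k : ℕ) : S ^ k * (ratMatrix A ^ k * X) = X := by
  have hc : Commute S (ratMatrix A) := h.drazin_comm.symm
  rw [← Matrix.mul_assoc, ← hc.mul_pow, hc.eq]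
  induction k with
  | zero => rw [pow_zero, Matrix.one_mul]
  | succ k ih => rw [pow_succ, Matrix.mul_assoc, hX, ih]

theorem IsLocalFrame.pow_mul_drazin (h : IsLocalFrame A M L S) {X : Matrix (Fin n) (Fin n) ℚ}
    (hX : ratMatrix A * S * X = X) (k : ℕ) : ratMatrix A ^ k * (S ^ k * X) = X := by
  have hc : Commute (ratMatrix A) S := h.drazin_comm
  rw [← Matrix.mul_assoc, (hc.pow_pow k k).eq, Matrix.mul_assoc, h.drazin_pow_mul hX]

theorem IsLocalFrame.commute_projection (h : IsLocalFrame A M L S) :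
    Commute (ratMatrix A) (ratMatrix A * S) ∧ Commute S (ratMatrix A * S) :=
  ⟨(Commute.refl _).mul_right h.drazin_comm,
    (show Commute S (ratMatrix A) from h.drazin_comm.symm).mul_right (Commute.refl _)⟩

/-- `C` may ignore the eventual ranges, so only the resulting equality of rational ranges is kept.
Equal ranks then provide an isomorphism `Φ` of eventual ranges, made integral by multiplying with
powers of `B` and `A` and a number prime to `p`. -/
theorem Intertwined.stronglyLocallyIsomorphic (hi : Intertwined M M')
    (hM : IsRowBasis M (eventualRowSpace p A)) (hM' : IsRowBasis M' (eventualRowSpace p B))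
    (hrank : (ratMatrix A ^ n).rank = (ratMatrix B ^ n).rank) :
    StronglyLocallyIsomorphic p A B := by
  obtain ⟨L, S, h⟩ := hM.exists_isLocalFrame
  obtain ⟨L', S', h'⟩ := hM'.exists_isLocalFrame
  obtain ⟨C, D, hCD⟩ := hi
  have hDD : (D⁻¹).1 * D.1 = 1 := D.inv_mul
  have hCC : C.1 * (C⁻¹).1 = 1 := C.mul_inv
  set C₀ : Matrix (Fin n) (Fin n) ℚ := C.1
  set C₁ : Matrix (Fin n) (Fin n) ℚ := (C⁻¹).1
  change padicMap M * ratPadic p C₀ = padicMap D.1 * padicMap M' at hCD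
  have hM'C : padicMap M' = padicMap ((D⁻¹).1 * M) * ratPadic p C₀ := by
    rw [padicMap_mul, Matrix.mul_assoc, hCD, ← Matrix.mul_assoc, ← padicMap_mul, hDD, padicMap_one,
      Matrix.one_mul]
  have hMC : padicMap ((D⁻¹).1 * M) = padicMap M' * ratPadic p C₁ := by
    rw [hM'C, Matrix.mul_assoc, ← ratPadic_mul, hCC, ratPadic_one, Matrix.mul_one]
  have hrange : LinearMap.range (ratMulVec (padicMap ((D⁻¹).1 * M))) =
      LinearMap.range (ratMulVec (padicMap M')) := by
    refine le_antisymm ?_ ?_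
    · rintro _ ⟨x, rfl⟩
      refine ⟨C₁.mulVec x, ?_⟩
      change (padicMap M').mulVec _ = (padicMap ((D⁻¹).1 * M)).mulVec _
      rw [hMC, ← ratPadic_mulVec, Matrix.mulVec_mulVec]
    · rintro _ ⟨x, rfl⟩
      refine ⟨C₀.mulVec x, ?_⟩
      change (padicMap ((D⁻¹).1 * M)).mulVec _ = (padicMap M').mulVec _
      rw [hM'C, ← ratPadic_mulVec, Matrix.mulVec_mulVec]
  obtain ⟨Φ, Φ', hΦ'Φ, hΦΦ', hPΦ, hPΦ', hΦ⟩ := exists_transfer h.projection_mul_self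
    h'.projection_mul_self (by rw [h.rank_eq, h'.rank_eq, hrank])
    (by rw [padicMap_mul, Matrix.mul_assoc, h.mul_projection]) h'.mul_projection hrange
  have hME := mul_eventualIdempotent_of_factorization h.mul_left h.mul_right
  -- The hypothesis holds because `M' Φ = D⁻¹ M` gives `E_B Φ E_A = L' D⁻¹ M`.
  obtain ⟨e, f, N, J, hN, hJ⟩ := exists_integral_sandwich (X := B) (Y := A) (Ψ := Φ)
    (Z := L' * ((D⁻¹).1 * M)) (by
      rw [padicMap_eventualIdempotent_mul h'.mul_left, Matrix.mul_assoc (padicMap L'), hΦ,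
        Matrix.mul_assoc, ← padicMap_mul, Matrix.mul_assoc, hME, ← padicMap_mul])
  have hN0 : (N : ℚ) ≠ 0 := by
    rintro h0
    rw [Nat.cast_eq_zero] at h0
    rw [h0, Nat.cast_zero] at hN
    exact not_isUnit_zero hN
  set P := ratMatrix A * S with hP
  set P' := ratMatrix B * S' with hP'
  -- The inverse of `J` between the eventual ranges, where the Drazin inverses undo the powers of
  -- `A` and `B`. It need not be integral.
  let R : Matrix (Fin n) (Fin n) ℚ := (N : ℚ)⁻¹ • (S ^ f * Φ' * S' ^ e)
  have hRJ : R * ratMatrix J = P := by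
    rw [← hJ, Matrix.smul_mul, Matrix.mul_smul, smul_smul, inv_mul_cancel₀ hN0, one_smul]
    simp only [Matrix.mul_assoc]
    rw [h'.drazin_pow_mul (X := Φ * ratMatrix A ^ f) (by rw [← Matrix.mul_assoc, ← hP', hPΦ]),
      ← Matrix.mul_assoc Φ', hΦ'Φ, ← (h.commute_projection.1.pow_left f).eq,
      h.drazin_pow_mul h.projection_mul_self]
  have hJR : ratMatrix J * R = P' := by
    rw [← hJ, Matrix.smul_mul, Matrix.mul_smul, smul_smul, mul_inv_cancel₀ hN0, one_smul]
    simp only [Matrix.mul_assoc]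
    rw [h.pow_mul_drazin (X := Φ' * S' ^ e) (by rw [← Matrix.mul_assoc, ← hP, hPΦ']),
      ← Matrix.mul_assoc Φ, hΦΦ', ← (h'.commute_projection.2.pow_left e).eq,
      h'.pow_mul_drazin h'.projection_mul_self]
  have hP'J : P' * ratMatrix J = ratMatrix J := by
    rw [← hJ, Matrix.mul_smul, ← Matrix.mul_assoc, ← Matrix.mul_assoc,
      ← (h'.commute_projection.1.pow_left e).eq, Matrix.mul_assoc _ P', hPΦ]
  have hPR : P * R = R := by
    rw [Matrix.mul_smul, ← Matrix.mul_assoc, ← Matrix.mul_assoc,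
      ← (h.commute_projection.2.pow_left f).eq, Matrix.mul_assoc _ P, hPΦ']
  -- On coordinates `J` acts by a unit, because `N`, `D⁻¹` and the actions of `A` and `B` are all
  -- invertible over `ℤ_p`; so `J` and `R` both preserve integrality of coordinates.
  obtain ⟨G, hG, hMJ⟩ : ∃ G : Matrix (Fin r) (Fin r) ℤ_[p], IsUnit G ∧
      padicMap M' * ratPadic p (ratMatrix J) = padicMap G * padicMap M := by
    refine ⟨(N : ℤ_[p]) • ((M' * intToPadic p B * L') ^ e * (D⁻¹).1 *
      (M * intToPadic p A * L) ^ f), ?_, ?_⟩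
    · obtain ⟨u, hu⟩ := hN
      rw [← hu, ← Units.smul_def]
      exact IsUnit.smul u ((((isUnit_of_factorization h'.mul_left h'.mul_right).pow e).mul
        ⟨D⁻¹, rfl⟩).mul ((isUnit_of_factorization h.mul_left h.mul_right).pow f))
    · have hA := congrArg padicMap (mul_intToPadic_of_factorization h.mul_left h.mul_right f)
      have hB := congrArg padicMap (mul_intToPadic_of_factorization h'.mul_left h'.mul_right e)
      rw [padicMap_mul, padicMap_mul, padicMap_intToPadic_pow] at hA hB
      rw [← hJ, ratPadic_smul, Matrix.mul_smul, ratPadic_mul, ratPadic_mul, ← Matrix.mul_assoc,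
        ← Matrix.mul_assoc, hB, Matrix.mul_assoc (padicMap _) (padicMap M'), hΦ, padicMap_mul,
        Matrix.mul_assoc (padicMap _) (padicMap _ * padicMap M), Matrix.mul_assoc (padicMap _)
        (padicMap M), hA, padicMap_smul, padicMap_mul, padicMap_mul, Matrix.smul_mul]
      simp only [Matrix.mul_assoc]
      simp
  obtain ⟨G', hG'⟩ := hG.exists_left_inv
  have hMR : padicMap M * ratPadic p R = padicMap G' * padicMap M' := by
    have h1 : padicMap M = padicMap G' * (padicMap G * padicMap M) := by
      rw [← Matrix.mul_assoc, ← padicMap_mul, hG', padicMap_one, Matrix.one_mul]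
    rw [h1, ← hMJ, Matrix.mul_assoc, Matrix.mul_assoc, ← ratPadic_mul, hJR, h'.mul_projection]
  refine stronglyLocallyIsomorphic_of_inverse (J := J) (R := R) (fun v hv => ?_) fun v hv => ?_
  · obtain ⟨hv, w, hw⟩ := h.mem_range_iff.1 hv
    refine ⟨h'.mem_range_iff.2 ⟨?_, G.mulVec w, ?_⟩, ?_⟩
    · rw [Matrix.mulVec_mulVec, ← ratPadic_mul, hP'J]
    · rw [Matrix.mulVec_mulVec, hMJ, ← Matrix.mulVec_mulVec, hw, padicMap_mulVec]
    · rw [Matrix.mulVec_mulVec, ← ratPadic_mul, hRJ, hv]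
  · obtain ⟨hv, w, hw⟩ := h'.mem_range_iff.1 hv
    refine ⟨h.mem_range_iff.2 ⟨?_, G'.mulVec w, ?_⟩, ?_⟩
    · rw [Matrix.mulVec_mulVec, ← ratPadic_mul, hPR]
    · rw [Matrix.mulVec_mulVec, hMR, ← Matrix.mulVec_mulVec, hw, padicMap_mulVec]
    · rw [Matrix.mulVec_mulVec, ← ratPadic_mul, hJR, hv]

theorem stronglyLocallyIsomorphic_iff_intertwined
    (hrank : (ratMatrix A ^ n).rank = (ratMatrix B ^ n).rank)
    (hM : IsRowBasis M (eventualRowSpace p A)) (hM' : IsRowBasis M' (eventualRowSpace p B)) :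
    StronglyLocallyIsomorphic p A B ↔ Intertwined M M' :=
  ⟨fun h => h.intertwined hM hM', fun h => h.stronglyLocallyIsomorphic hM hM' hrank⟩

theorem stronglyLocallyIsomorphic_iff_rowSpaceCondition
    (hrank : (ratMatrix A ^ n).rank = (ratMatrix B ^ n).rank) :
    StronglyLocallyIsomorphic p A B ↔ RowSpaceCondition p A B := by
  constructor
  · intro h
    obtain ⟨r, M, hM⟩ := exists_isRowBasis (p := p) A
    obtain ⟨r', M', hM'⟩ := exists_isRowBasis (p := p) B
    obtain rfl := h.rank_eq hM hM'
    exact ⟨r, M, M', hM, hM', h.intertwined hM hM'⟩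
  · rintro ⟨r, M, M', hM, hM', h⟩
    exact h.stronglyLocallyIsomorphic hM hM' hrank

end Backward

end DimGroup

theorem theorem11p2 :
    (∀ (p : ℕ) [Fact p.Prime] (n : ℕ) (A B : Matrix (Fin n) (Fin n) ℤ),
      -- the dimension groups of `A` and `B` have the same rank
      (DimGroup.ratMatrix A ^ n).rank = (DimGroup.ratMatrix B ^ n).rank →
        (DimGroup.StronglyLocallyIsomorphic p A B ↔ DimGroup.RowSpaceCondition p A B) ∧
        ∀ (r : ℕ) (M M' : Matrix (Fin r) (Fin n) ℤ_[p]),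
          DimGroup.IsRowBasis M (DimGroup.eventualRowSpace p A) →
          DimGroup.IsRowBasis M' (DimGroup.eventualRowSpace p B) →
          (DimGroup.StronglyLocallyIsomorphic p A B ↔ DimGroup.Intertwined M M')) ∧
    -- one algorithm decides the condition for all inputs `A`, `B`, `p`
    ∃ f : List (List ℤ) × List (List ℤ) × ℕ → Bool, Computable f ∧
      ∀ (p : ℕ) [Fact p.Prime] (n : ℕ) (A B : Matrix (Fin n) (Fin n) ℤ),
        f (DimGroup.rows A, DimGroup.rows B, p) = true ↔ DimGroup.RowSpaceCondition p A B := by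
  refine ⟨fun p _ n A B hrank => ⟨DimGroup.stronglyLocallyIsomorphic_iff_rowSpaceCondition hrank,
    fun r M M' hM hM' => DimGroup.stronglyLocallyIsomorphic_iff_intertwined hrank hM hM'⟩,
    DimGroup.exists_computable_rowSpaceCondition⟩
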